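/- Let $(M,g)$ be a smooth $n$-dimensional Riemannian manifold, and let $T^*_0M$ be its cotangent bundle without the zero section. A chart $(x^i)$ of $M$ induces the chart $(q^i,p_i)$ of $T^*_0M$. Let $\Gamma^k_{ij}$ be the Christoffel symbols of $g$ and $R^h_{kij}$ the components of its curvature tensor, $R(\partial_i,\partial_j)\partial_k=R^h_{kij}\partial_h$. Put $\Gamma^0_{ij}=p_k\Gamma^k_{ij}$, $R^0_{kij}=p_hR^h_{kij}$, $g^{0i}=p_hg^{hi}$, $t=\frac12 g^{ik}p_ip_k$, $\frac{\delta}{\delta q^i}=\frac{\partial}{\partial q^i}+\Gamma^0_{ih}\frac{\partial}{\partial p_h}$ and $Dp_i=dp_i-\Gamma^0_{ij}dq^j$. (Summation over repeated indices.) Let $c_1,c_2,d_1,d_2$ be smooth functions of $t\in(0,\infty)$ with $c_1>0$, $c_2>0$, $c_1+2td_1>0$, $c_2+2td_2>0$, let $$G^{(1)}_{ij}=c_1g_{ij}+d_1p_ip_j,\qquad G_{(2)}^{ij}=c_2g^{ij}+d_2g^{0i}g^{0j},\qquad G=G^{(1)}_{ij}dq^idq^j+G_{(2)}^{ij}Dp_iDp_j$$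 and let $H_{(1)}$, $H^{(2)}$ be the inverse matrices of $G^{(1)}$, $G_{(2)}$. An $M$-tensor field of type $(r,s)$ on $T^*_0M$ is a family of smooth components, functions of $(q,p)$ assigned to the induced charts, which changes under a change of charts of $M$ like the components of a tensor field of type $(r,s)$ on $M$. **(a)** The following are the components of $M$-tensor fields $Q$, $P$, $S$ on $T^*_0M$, of types $(2,1)$, $(2,1)$, $(0,3)$: $$Q^{ij}_h=\tfrac12H^{(2)}_{hk}\Big(\frac{\partial G_{(2)}^{jk}}{\partial p_i}+\frac{\partial G_{(2)}^{ik}}{\partial p_j}-\frac{\partial G_{(2)}^{ij}}{\partial p_k}\Big),\quad P^{hi}_j=\tfrac12H_{(1)}^{hk}\Big(\frac{\partial G^{(1)}_{jk}}{\partial p_i}-G_{(2)}^{il}R^0_{ljk}\Big),\quad S_{hij}=-\tfrac12H^{(2)}_{hk}\frac{\partial G^{(1)}_{ij}}{\partial p_k}+\tfrac12R^0_{hij},$$ and the Levi-Civita connection $\nabla$ of $(T^*_0M,G)$ is given in every adapted frame $(\frac{\delta}{\delta q^i},\frac{\partial}{\partial p_i})$ by $$\nabla_{\frac{\partial}{\partial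 p_i}}\frac{\partial}{\partial p_j}=Q^{ij}_h\frac{\partial}{\partial p_h},\qquad \nabla_{\frac{\delta}{\delta q^i}}\frac{\partial}{\partial p_j}=-\Gamma^j_{ih}\frac{\partial}{\partial p_h}+P^{hj}_i\frac{\delta}{\delta q^h},$$ $$\nabla_{\frac{\partial}{\partial p_i}}\frac{\delta}{\delta q^j}=P^{hi}_j\frac{\delta}{\delta q^h},\qquad \nabla_{\frac{\delta}{\delta q^i}}\frac{\delta}{\delta q^j}=\Gamma^h_{ij}\frac{\delta}{\delta q^h}+S_{hij}\frac{\partial}{\partial p_h}.$$ **(b)** Let moreover $n\ge2$ and let $(M,g)$ have constant sectional curvature $c>0$. Let $J$ be the tensor field on $T^*_0M$ with $J\frac{\delta}{\delta q^i}=(a_1g_{ij}+b_1p_ip_j)\frac{\partial}{\partial p_j}$ and $J\frac{\partial}{\partial p_i}=-(a_2g^{ij}+b_2g^{0i}g^{0j})\frac{\delta}{\delta q^j}$, where $a_1(t)=A\sqrt t$ with $A>0$, and $a_2,b_1,b_2$ are smooth functions of $t\in(0,\infty)$ with $A+2\sqrt t\,b_1>0$. Suppose that $(G,J)$ is Kähler,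 i.e. $J^2=-I$, $G(JX,JY)=G(X,Y)$, the Nijenhuis tensor field of $J$ vanishes and the $2$-form $G(X,JY)$ is closed. Let $\lambda=c_1/a_1$. Then $$Q^{ij}_h=\frac{\sqrt c-\sqrt{2t}\,b_1}{4\sqrt c\,t}g^{ij}p_h-\frac{\lambda-2t\lambda'}{4t\lambda}(\delta^i_hg^{0j}+\delta^j_hg^{0i})+\alpha\,g^{0i}g^{0j}p_h,$$ $$P^{hi}_j=\frac{-\sqrt c\lambda+\sqrt2b_1\lambda t^{1/2}+2\sqrt c\lambda't+2\sqrt2b_1\lambda't^{3/2}}{4\sqrt c\lambda t}g^{hi}p_j+\frac1{4t}\delta^i_jg^{0h}+\frac{\lambda+2t\lambda'}{4t\lambda}\delta^h_jg^{0i}+\beta\,g^{0h}g^{0i}p_j,$$ $$S_{hij}=-\frac{\sqrt c(\sqrt c+\sqrt{2t}\,b_1)}2g_{ij}p_h+\frac{\sqrt c(\sqrt c\lambda-\sqrt2b_1\lambda t^{1/2}-2\sqrt c\lambda't-2\sqrt2b_1\lambda't^{3/2})}{2\lambda}g_{hj}p_i$$ $$\qquad-\frac{\sqrt c(\sqrt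 c\lambda+\sqrt2b_1\lambda t^{1/2}+2\sqrt c\lambda't+2\sqrt2b_1\lambda't^{3/2})}{2\lambda}g_{hi}p_j-\gamma\,p_hp_ip_j,$$ where $$\alpha=\frac{\lambda(b_1^2\lambda+c\lambda')-\sqrt{2c}\lambda(b_1'\lambda-b_1\lambda')t^{1/2}+2(b_1^2\lambda\lambda'-2c\lambda'^2+c\lambda\lambda'')t-2\sqrt{2c}(\lambda\lambda'b_1'+2b_1\lambda'^2-b_1\lambda\lambda'')t^{3/2}}{4\sqrt c\,t\lambda(\sqrt c+\sqrt{2t}\,b_1)(\lambda+2t\lambda')},$$ $$\beta=\frac{\lambda(-b_1^2\lambda+c\lambda')+\sqrt{2c}b_1'\lambda^2t^{1/2}-2(2b_1^2\lambda\lambda'+2c\lambda'^2-c\lambda\lambda'')t+2\sqrt{2c}(b_1'\lambda\lambda'-3b_1\lambda'^2+b_1\lambda\lambda'')t^{3/2}-4b_1^2\lambda'^2t^2}{2\sqrt{2c}\,\lambda t(\sqrt{2c}+2b_1\sqrt t)(\lambda+2t\lambda')},$$ $$\gamma=\frac{1}{2\lambda(\lambda+2t\lambda')}\Big[\lambda(2b_1^2\lambda+c\lambda')+\sqrt{2c}\lambda(\lambda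 b_1'+4\lambda'b_1)t^{1/2}+2(\lambda^2b_1b_1'+5\lambda\lambda'b_1^2-2c\lambda'^2+c\lambda\lambda'')t$$ $$\qquad+2\sqrt{2c}(\lambda\lambda'b_1'-2\lambda'^2b_1+2\lambda\lambda''b_1)t^{3/2}+4\lambda b_1(\lambda'b_1'+\lambda''b_1)t^2\Big].$$ -/

import Mathlib

open Bundle VectorField
open scoped Manifold ContDiff Topology

noncomputable section

namespace CotangentLift

/-- The Euclidean model space `ℝⁿ`. -/
abbrev E (n : ℕ) : Type := EuclideanSpace ℝ (Fin n)

/-- The `i`-th vector of the standard basis of `ℝⁿ`. -/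
def e {n : ℕ} (i : Fin n) : E n := EuclideanSpace.single i 1

section Bundles

variable (n : ℕ) (M : Type*) [TopologicalSpace M] [ChartedSpace (E n) M]
  [IsManifold 𝓘(ℝ, E n) ∞ M]

/-- The total space `T*M` of the cotangent bundle of the `n`-manifold `M`; a point `u` of it
consists of the base point `u.1 : M` and of the covector `u.2` at `u.1`. -/
abbrev TStar : Type _ :=
  TotalSpace (E n →L[ℝ] ℝ) (fun x : M => TangentSpace 𝓘(ℝ, E n) x →L[ℝ] Trivial M ℝ x)

/-- The model space of the manifold `T*M`. -/
abbrev EStar : Type := E n × (E n →L[ℝ] ℝ)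

/-- The model with corners of the manifold `T*M`. -/
abbrev IStar : ModelWithCorners ℝ (EStar n) (ModelProd (E n) (E n →L[ℝ] ℝ)) :=
  𝓘(ℝ, E n).prod 𝓘(ℝ, E n →L[ℝ] ℝ)

/-- The nonzero cotangent bundle `T*₀M`, an open subset of `T*M`. -/
def TStarZero : Set (TStar n M) := {u | u.2 ≠ 0}

/-- Smooth Riemannian metrics on `M`. -/
abbrev Metric : Type _ :=
  ContMDiffRiemannianMetric 𝓘(ℝ, E n) ∞ (E n) (fun x : M => TangentSpace 𝓘(ℝ, E n) x)

/-- The (not necessarily continuous) vector fields on `T*M`. -/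
abbrev VField : Type _ := (u : TStar n M) → TangentSpace (IStar n) u

end Bundles

variable {n : ℕ} {M : Type*} [TopologicalSpace M] [ChartedSpace (E n) M]
  [IsManifold 𝓘(ℝ, E n) ∞ M]

/-! ### The base manifold in a local chart `φ = (x¹, …, xⁿ)` -/

/-- `φ` is a smooth local chart of `M`. -/
def IsChart (φ : OpenPartialHomeomorph M (E n)) : Prop :=
  φ ∈ IsManifold.maximalAtlas 𝓘(ℝ, E n) ∞ M

/-- The coordinate vector field `∂/∂xⁱ` of the chart `φ`, that is, `x ↦ (dφₓ)⁻¹ eᵢ`. -/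
def coordVec (φ : OpenPartialHomeomorph M (E n)) (i : Fin n) (x : M) :
    TangentSpace 𝓘(ℝ, E n) x :=
  mpullback 𝓘(ℝ, E n) 𝓘(ℝ, E n) φ (fun _ => e i) x

/-- The matrix `(g_{ij}(y))` of the metric, at the point with coordinates `y`. -/
def gLow (g : Metric n M) (φ : OpenPartialHomeomorph M (E n)) (y : E n) :
    Matrix (Fin n) (Fin n) ℝ :=
  Matrix.of fun i j => g.inner (φ.symm y) (coordVec φ i (φ.symm y)) (coordVec φ j (φ.symm y))

/-- The inverse matrix `(g^{ij}(y))`. -/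
def gUp (g : Metric n M) (φ : OpenPartialHomeomorph M (E n)) (y : E n) :
    Matrix (Fin n) (Fin n) ℝ :=
  (gLow g φ y)⁻¹

/-- The partial derivative `∂f/∂xⁱ` at `y` of a function on `ℝⁿ`. -/
def pd (i : Fin n) (f : E n → ℝ) (y : E n) : ℝ := fderiv ℝ f y (e i)

/-- The Christoffel symbols `Γ^k_{ij}(y)` of the Levi-Civita connection of `g`. -/
def christoffel (g : Metric n M) (φ : OpenPartialHomeomorph M (E n)) (k i j : Fin n) (y : E n) :
    ℝ :=
  (1 / 2) * ∑ l, gUp g φ y k l *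
    (pd i (fun z => gLow g φ z j l) y + pd j (fun z => gLow g φ z i l) y
      - pd l (fun z => gLow g φ z i j) y)

/-- The components `R^h_{kij}(y)` of the curvature tensor of `g`, with
`R(∂ᵢ, ∂ⱼ)∂ₖ = R^h_{kij} ∂ₕ` and `R(X, Y) = [∇_X, ∇_Y] - ∇_{[X, Y]}`. -/
def curvature (g : Metric n M) (φ : OpenPartialHomeomorph M (E n)) (h k i j : Fin n) (y : E n) :
    ℝ :=
  pd i (christoffel g φ h j k) y - pd j (christoffel g φ h i k) y
    + ∑ l, (christoffel g φ h i l y * christoffel g φ l j k y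
      - christoffel g φ h j l y * christoffel g φ l i k y)

/-- The scalar product of two vectors given by their components at `y`. -/
def ip (g : Metric n M) (φ : OpenPartialHomeomorph M (E n)) (y : E n) (X Y : Fin n → ℝ) : ℝ :=
  ∑ i, ∑ j, gLow g φ y i j * X i * Y j

/-- The sectional curvature `g(R(X,Y)Y, X) / (g(X,X) g(Y,Y) - g(X,Y)²)` of the plane spanned by
the vectors with components `X`, `Y` at `y`. -/
def sectionalCurvature (g : Metric n M) (φ : OpenPartialHomeomorph M (E n)) (y : E n)
    (X Y : Fin n → ℝ) : ℝ :=
  ip g φ y (fun h => ∑ k, ∑ i, ∑ j, curvature g φ h k i j y * Y k * X i * Y j) X /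
    (ip g φ y X X * ip g φ y Y Y - ip g φ y X Y ^ 2)

/-- `(M, g)` has constant sectional curvature `c`. -/
def HasConstantSectionalCurvature (g : Metric n M) (c : ℝ) : Prop :=
  ∀ φ : OpenPartialHomeomorph M (E n), IsChart φ → ∀ y ∈ φ.target, ∀ X Y : Fin n → ℝ,
    LinearIndependent ℝ ![X, Y] → sectionalCurvature g φ y X Y = c

/-! ### Functions of the coordinates `(q, p)` in the induced chart -/

/-- `Γ⁰_{ij} = p_k Γ^k_{ij}`. -/
def christoffelZero (g : Metric n M) (φ : OpenPartialHomeomorph M (E n)) (i j : Fin n)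
    (y p : E n) : ℝ :=
  ∑ k, p k * christoffel g φ k i j y

/-- `R⁰_{kij} = p_h R^h_{kij}`. -/
def curvatureZero (g : Metric n M) (φ : OpenPartialHomeomorph M (E n)) (k i j : Fin n)
    (y p : E n) : ℝ :=
  ∑ h, p h * curvature g φ h k i j y

/-- `g^{0i} = p_h g^{hi}`. -/
def pUp (g : Metric n M) (φ : OpenPartialHomeomorph M (E n)) (y p : E n) (i : Fin n) : ℝ :=
  ∑ h, p h * gUp g φ y h i

/-- The energy density `t = ½ g^{ik} p_i p_k`. -/
def energy (g : Metric n M) (φ : OpenPartialHomeomorph M (E n)) (y p : E n) : ℝ :=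
  (1 / 2) * ∑ i, ∑ k, gUp g φ y i k * p i * p k

/-- The components `u(t) g_{ij} + v(t) p_i p_j`. -/
def natLow (g : Metric n M) (u v : ℝ → ℝ) (φ : OpenPartialHomeomorph M (E n)) (y p : E n) :
    Matrix (Fin n) (Fin n) ℝ :=
  Matrix.of fun i j => u (energy g φ y p) * gLow g φ y i j + v (energy g φ y p) * p i * p j

/-- The components `u(t) g^{ij} + v(t) g^{0i} g^{0j}`. -/
def natUp (g : Metric n M) (u v : ℝ → ℝ) (φ : OpenPartialHomeomorph M (E n)) (y p : E n) :
    Matrix (Fin n) (Fin n) ℝ :=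
  Matrix.of fun i j =>
    u (energy g φ y p) * gUp g φ y i j + v (energy g φ y p) * pUp g φ y p i * pUp g φ y p j

/-- The coefficients of a natural Riemannian metric of diagonal type on `T*₀M`. -/
structure MetricCoeffs where
  (c₁ c₂ d₁ d₂ : ℝ → ℝ)
  smooth_c₁ : ContDiffOn ℝ ∞ c₁ (Set.Ioi 0)
  smooth_c₂ : ContDiffOn ℝ ∞ c₂ (Set.Ioi 0)
  smooth_d₁ : ContDiffOn ℝ ∞ d₁ (Set.Ioi 0)
  smooth_d₂ : ContDiffOn ℝ ∞ d₂ (Set.Ioi 0)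
  pos_c₁ : ∀ t > 0, 0 < c₁ t
  pos_c₂ : ∀ t > 0, 0 < c₂ t
  pos_d₁ : ∀ t > 0, 0 < c₁ t + 2 * t * d₁ t
  pos_d₂ : ∀ t > 0, 0 < c₂ t + 2 * t * d₂ t

/-- The coefficients of a natural tensor field `J` of diagonal type on `T*₀M` in the singular case
`a₁(t) = A √t`, with the sign conventions `A > 0` and `a₁ + 2 t b₁ > 0`. -/
structure ComplexCoeffs where
  (A : ℝ)
  (a₂ b₁ b₂ : ℝ → ℝ)
  smooth_a₂ : ContDiffOn ℝ ∞ a₂ (Set.Ioi 0)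
  smooth_b₁ : ContDiffOn ℝ ∞ b₁ (Set.Ioi 0)
  smooth_b₂ : ContDiffOn ℝ ∞ b₂ (Set.Ioi 0)
  pos_A : 0 < A
  pos_b₁ : ∀ t > 0, 0 < A + 2 * √t * b₁ t

/-- The coefficient `a₁(t) = A √t`. -/
def ComplexCoeffs.a₁ (j : ComplexCoeffs) (t : ℝ) : ℝ := j.A * √t

/-- `G^{(1)}_{ij} = c₁ g_{ij} + d₁ p_i p_j`. -/
def G1 (g : Metric n M) (w : MetricCoeffs) (φ : OpenPartialHomeomorph M (E n)) (y p : E n) :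
    Matrix (Fin n) (Fin n) ℝ :=
  natLow g w.c₁ w.d₁ φ y p

/-- `G_{(2)}^{ij} = c₂ g^{ij} + d₂ g^{0i} g^{0j}`. -/
def G2 (g : Metric n M) (w : MetricCoeffs) (φ : OpenPartialHomeomorph M (E n)) (y p : E n) :
    Matrix (Fin n) (Fin n) ℝ :=
  natUp g w.c₂ w.d₂ φ y p

/-- `H_{(1)}^{ij}`, the inverse of `G^{(1)}`. -/
def H1 (g : Metric n M) (w : MetricCoeffs) (φ : OpenPartialHomeomorph M (E n)) (y p : E n) :
    Matrix (Fin n) (Fin n) ℝ :=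
  (G1 g w φ y p)⁻¹

/-- `H^{(2)}_{ij}`, the inverse of `G_{(2)}`. -/
def H2 (g : Metric n M) (w : MetricCoeffs) (φ : OpenPartialHomeomorph M (E n)) (y p : E n) :
    Matrix (Fin n) (Fin n) ℝ :=
  (G2 g w φ y p)⁻¹

/-- The components `Q^{ij}_h`. -/
def Q (g : Metric n M) (w : MetricCoeffs) (φ : OpenPartialHomeomorph M (E n)) (y p : E n)
    (i j h : Fin n) : ℝ :=
  (1 / 2) * ∑ k, H2 g w φ y p h k *
    (pd i (fun r => G2 g w φ y r j k) p + pd j (fun r => G2 g w φ y r i k) p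
      - pd k (fun r => G2 g w φ y r i j) p)

/-- The components `P^{hi}_j`. -/
def P (g : Metric n M) (w : MetricCoeffs) (φ : OpenPartialHomeomorph M (E n)) (y p : E n)
    (h i j : Fin n) : ℝ :=
  (1 / 2) * ∑ k, H1 g w φ y p h k *
    (pd i (fun r => G1 g w φ y r j k) p - ∑ l, G2 g w φ y p i l * curvatureZero g φ l j k y p)

/-- The components `S_{hij}`. -/
def S (g : Metric n M) (w : MetricCoeffs) (φ : OpenPartialHomeomorph M (E n)) (y p : E n)
    (h i j : Fin n) : ℝ :=
  -(1 / 2) * ∑ k, H2 g w φ y p h k * pd k (fun r => G1 g w φ y r i j) p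
    + (1 / 2) * curvatureZero g φ h i j y p

/-! ### The cotangent bundle in the induced charts -/

/-- The chart `Φ = (q¹, …, qⁿ, p₁, …, pₙ)` of `T*M` induced by the chart `φ` of `M`:
`qⁱ(u) = xⁱ(π(u))` and `p_i(u) = u(∂/∂xⁱ)`. -/
def indChart (φ : OpenPartialHomeomorph M (E n)) (u : TStar n M) : E n × E n :=
  (φ u.1, WithLp.toLp 2 fun i => (u.2 (coordVec φ i u.1) : ℝ))

/-- The vector field `∂/∂qⁱ` of the induced chart. -/
def dQ (φ : OpenPartialHomeomorph M (E n)) (i : Fin n) : VField n M :=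
  mpullback (IStar n) 𝓘(ℝ, E n × E n) (indChart φ) (fun _ => ((e i, 0) : E n × E n))

/-- The vertical vector field `∂/∂pᵢ` of the induced chart. -/
def dP (φ : OpenPartialHomeomorph M (E n)) (i : Fin n) : VField n M :=
  mpullback (IStar n) 𝓘(ℝ, E n × E n) (indChart φ) (fun _ => ((0, e i) : E n × E n))

/-- The horizontal vector field `δ/δqⁱ = ∂/∂qⁱ + Γ⁰_{ih} ∂/∂pₕ`. -/
def delta (g : Metric n M) (φ : OpenPartialHomeomorph M (E n)) (i : Fin n) : VField n M := fun u =>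
  dQ φ i u + ∑ h, christoffelZero g φ i h (indChart φ u).1 (indChart φ u).2 • dP φ h u

/-- The value `dqⁱ(ξ)` for a tangent vector `ξ` of `T*M` at `u`. -/
def covQ (φ : OpenPartialHomeomorph M (E n)) (i : Fin n) (u : TStar n M)
    (ξ : TangentSpace (IStar n) u) : ℝ :=
  (mfderiv (IStar n) 𝓘(ℝ, E n × E n) (indChart φ) u ξ : E n × E n).1 i

/-- The value `Dpᵢ(ξ) = dpᵢ(ξ) - Γ⁰_{ij} dq^j(ξ)` for a tangent vector `ξ` of `T*M` at `u`. -/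
def covP (g : Metric n M) (φ : OpenPartialHomeomorph M (E n)) (i : Fin n) (u : TStar n M)
    (ξ : TangentSpace (IStar n) u) : ℝ :=
  (mfderiv (IStar n) 𝓘(ℝ, E n × E n) (indChart φ) u ξ : E n × E n).2 i
    - ∑ j, christoffelZero g φ i j (indChart φ u).1 (indChart φ u).2 * covQ φ j u ξ

/-- The metric `G = G^{(1)}_{ij} dqⁱ dq^j + G_{(2)}^{ij} Dpᵢ Dpⱼ` at the point `u` of `T*₀M`,
computed in the preferred chart of `M` at the base point of `u`. -/
def metricG (g : Metric n M) (w : MetricCoeffs) (u : TStar n M) (ξ η : TangentSpace (IStar n) u) :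
    ℝ :=
  let φ := chartAt (E n) u.1
  let y := (indChart φ u).1
  let p := (indChart φ u).2
  ∑ i, ∑ j, (G1 g w φ y p i j * covQ φ i u ξ * covQ φ j u η
    + G2 g w φ y p i j * covP g φ i u ξ * covP g φ j u η)

/-- The tensor field `J` of type `(1,1)` on `T*₀M` given by `J δ/δqⁱ = J^{(1)}_{ij} ∂/∂pⱼ`,
`J ∂/∂pᵢ = -J_{(2)}^{ij} δ/δq^j`, `J^{(1)}_{ij} = a₁ g_{ij} + b₁ p_i p_j`,
`J_{(2)}^{ij} = a₂ g^{ij} + b₂ g^{0i} g^{0j}`, at the point `u`, computed in the preferred chart of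
`M` at the base point of `u`. -/
def tensorJ (g : Metric n M) (a : ComplexCoeffs) (u : TStar n M)
    (ξ : TangentSpace (IStar n) u) : TangentSpace (IStar n) u :=
  let φ := chartAt (E n) u.1
  let y := (indChart φ u).1
  let p := (indChart φ u).2
  ∑ i, ∑ j, ((covQ φ i u ξ * natLow g a.a₁ a.b₁ φ y p i j) • dP φ j u
    - (covP g φ i u ξ * natUp g a.a₂ a.b₂ φ y p i j) • delta g φ j u)

/-- The derivative `X f` at `u` of a function `f` on `T*M` along a tangent vector `ξ` at `u`. -/
def dirDeriv (f : TStar n M → ℝ) (u : TStar n M) (ξ : TangentSpace (IStar n) u) : ℝ :=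
  mfderiv (IStar n) 𝓘(ℝ, ℝ) f u ξ

/-- The vector field `X` is differentiable at `u`. -/
def DiffAt (X : VField n M) (u : TStar n M) : Prop :=
  MDifferentiableAt (IStar n) (IStar n).tangent
    (fun v => (TotalSpace.mk' (EStar n) v (X v) : TangentBundle (IStar n) (TStar n M))) u

/-- `nabla` is the Levi-Civita connection of the metric `G` on the open subset `T*₀M` of `T*M`: it
is a covariant derivative on `T*₀M`, is compatible with `G` and has no torsion. The vector
`∇_ξ Y` is `nabla Y u ξ`, for `ξ` tangent at `u`. -/
structure IsLeviCivita (G : (u : TStar n M) → TangentSpace (IStar n) u →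
      TangentSpace (IStar n) u → ℝ)
    (nabla : VField n M →
      ((u : TStar n M) → TangentSpace (IStar n) u →L[ℝ] TangentSpace (IStar n) u)) : Prop where
  isCovariantDerivative : IsCovariantDerivativeOn (EStar n) nabla (TStarZero n M)
  metric : ∀ u ∈ TStarZero n M, ∀ Y Z : VField n M, DiffAt Y u → DiffAt Z u →
    ∀ ξ : TangentSpace (IStar n) u,
      dirDeriv (fun v => G v (Y v) (Z v)) u ξ = G u (nabla Y u ξ) (Z u) + G u (Y u) (nabla Z u ξ)
  torsionFree : ∀ u ∈ TStarZero n M, ∀ X Y : VField n M, DiffAt X u → DiffAt Y u →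
    nabla Y u (X u) - nabla X u (Y u) = mlieBracket (IStar n) X Y u

/-- `(G, J)` is a Kähler structure on `T*₀M`: `J` is an almost complex structure, `G` is Hermitian
with respect to `J`, the Nijenhuis tensor field of `J` vanishes, and the fundamental `2`-form
`φ(X, Y) = G(X, JY)` is closed. -/
structure IsKahler (G : (u : TStar n M) → TangentSpace (IStar n) u →
      TangentSpace (IStar n) u → ℝ)
    (J : (u : TStar n M) → TangentSpace (IStar n) u → TangentSpace (IStar n) u) : Prop where
  almostComplex : ∀ u ∈ TStarZero n M, ∀ ξ, J u (J u ξ) = -ξ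
  hermitian : ∀ u ∈ TStarZero n M, ∀ ξ η, G u (J u ξ) (J u η) = G u ξ η
  integrable : ∀ u ∈ TStarZero n M, ∀ X Y : VField n M, DiffAt X u → DiffAt Y u →
    mlieBracket (IStar n) (fun v => J v (X v)) (fun v => J v (Y v)) u
      - J u (mlieBracket (IStar n) (fun v => J v (X v)) Y u)
      - J u (mlieBracket (IStar n) X (fun v => J v (Y v)) u)
      - mlieBracket (IStar n) X Y u = 0
  closed : ∀ u ∈ TStarZero n M, ∀ X Y Z : VField n M, DiffAt X u → DiffAt Y u → DiffAt Z u →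
    dirDeriv (fun v => G v (Y v) (J v (Z v))) u (X u)
      + dirDeriv (fun v => G v (Z v) (J v (X v))) u (Y u)
      + dirDeriv (fun v => G v (X v) (J v (Y v))) u (Z u)
      - G u (mlieBracket (IStar n) X Y u) (J u (Z u))
      - G u (mlieBracket (IStar n) Y Z u) (J u (X u))
      - G u (mlieBracket (IStar n) Z X u) (J u (Y u)) = 0

/-! ### `M`-tensor fields -/

/-- The entry `∂ψᵃ/∂φⁱ` at `x` of the Jacobian matrix of the change of charts `φ → ψ`. -/
def jac (φ ψ : OpenPartialHomeomorph M (E n)) (x : M) (a i : Fin n) : ℝ :=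
  (fderiv ℝ (fun y => ψ (φ.symm y)) (φ x) (e i)) a

/-- The components `T φ (q, p) a b` (with upper indices `a` and lower indices `b`), assigned to the
induced charts, are those of a smooth `M`-tensor field of type `(r, s)` on `T*₀M`: they are smooth
functions of `(q, p)` and they change as the components of a tensor field of type `(r, s)` on `M`. -/
structure IsMTensor (r s : ℕ)
    (T : OpenPartialHomeomorph M (E n) → E n → E n → (Fin r → Fin n) → (Fin s → Fin n) → ℝ) :
    Prop where
  smooth : ∀ φ, IsChart φ → ∀ a b,
    ContDiffOn ℝ ∞ (fun z : E n × E n => T φ z.1 z.2 a b) (φ.target ×ˢ {0}ᶜ)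
  change : ∀ φ ψ, IsChart φ → IsChart ψ → ∀ u ∈ TStarZero n M, u.1 ∈ φ.source → u.1 ∈ ψ.source →
    ∀ a b, T ψ (indChart ψ u).1 (indChart ψ u).2 a b =
      ∑ i : Fin r → Fin n, ∑ j : Fin s → Fin n,
        (∏ k, jac φ ψ u.1 (a k) (i k)) * (∏ l, jac ψ φ u.1 (j l) (b l)) *
          T φ (indChart φ u).1 (indChart φ u).2 i j

/-! ### The explicit components over a space form

Here `l`, `l'`, `l''`, `b`, `b'` stand for `λ(t)`, `λ'(t)`, `λ''(t)`, `b₁(t)`, `b₁'(t)`. -/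

/-- The Kronecker symbol. -/
def kron (i j : Fin n) : ℝ := if i = j then 1 else 0

/-- The coefficient of `g^{0i} g^{0j} p_h` in `Q^{ij}_h`. -/
def coeffQ (c t l l' l'' b b' : ℝ) : ℝ :=
  (l * (b ^ 2 * l + c * l') - √(2 * c) * l * (b' * l - b * l') * √t
      + 2 * (b ^ 2 * l * l' - 2 * c * l' ^ 2 + c * l * l'') * t
      - 2 * √(2 * c) * (l * l' * b' + 2 * b * l' ^ 2 - l * l'' * b) * (t * √t)) /
    (4 * √c * t * l * (√c + √(2 * t) * b) * (l + 2 * t * l'))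

/-- The coefficient of `g^{0h} g^{0i} p_j` in `P^{hi}_j`. -/
def coeffP (c t l l' l'' b b' : ℝ) : ℝ :=
  (l * (-(b ^ 2) * l + c * l') + √(2 * c) * b' * l ^ 2 * √t
      - 2 * (2 * b ^ 2 * l * l' + 2 * c * l' ^ 2 - c * l * l'') * t
      + 2 * √(2 * c) * (b' * l * l' - 3 * b * l' ^ 2 + b * l * l'') * (t * √t)
      - 4 * b ^ 2 * l' ^ 2 * t ^ 2) /
    (2 * √(2 * c) * l * t * (√(2 * c) + 2 * b * √t) * (l + 2 * t * l'))

/-- The coefficient of `p_h p_i p_j` in `S_{hij}`. -/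
def coeffS (c t l l' l'' b b' : ℝ) : ℝ :=
  -((l * (2 * b ^ 2 * l + c * l') + √(2 * c) * l * (l * b' + 4 * l' * b) * √t
      + 2 * (l ^ 2 * b * b' + 5 * l * l' * b ^ 2 - 2 * c * l' ^ 2 + c * l * l'') * t
      + 2 * √(2 * c) * (l * l' * b' - 2 * l' ^ 2 * b + 2 * l * l'' * b) * (t * √t)
      + 4 * l * b * (l' * b' + l'' * b) * t ^ 2) /
    (2 * l * (l + 2 * t * l')))

/-- The explicit components `Q^{ij}_h`, with `lam = λ` and `b = b₁`. -/
def explicitQ (g : Metric n M) (c : ℝ) (lam b : ℝ → ℝ) (φ : OpenPartialHomeomorph M (E n))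
    (y p : E n) (i j h : Fin n) : ℝ :=
  let t := energy g φ y p
  let l := lam t
  let l' := deriv lam t
  let l'' := deriv (deriv lam) t
  let g0 := pUp g φ y p
  (√c - √(2 * t) * b t) / (4 * √c * t) * gUp g φ y i j * p h
    - (l - 2 * t * l') / (4 * t * l) * (kron i h * g0 j + kron j h * g0 i)
    + coeffQ c t l l' l'' (b t) (deriv b t) * g0 i * g0 j * p h

/-- The explicit components `P^{hi}_j`, with `lam = λ` and `b = b₁`. -/
def explicitP (g : Metric n M) (c : ℝ) (lam b : ℝ → ℝ) (φ : OpenPartialHomeomorph M (E n))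
    (y p : E n) (h i j : Fin n) : ℝ :=
  let t := energy g φ y p
  let l := lam t
  let l' := deriv lam t
  let l'' := deriv (deriv lam) t
  let g0 := pUp g φ y p
  (-√c * l + √2 * b t * l * √t + 2 * √c * l' * t + 2 * √2 * b t * l' * (t * √t)) /
        (4 * √c * l * t) * gUp g φ y h i * p j
    + 1 / (4 * t) * kron i j * g0 h
    + (l + 2 * t * l') / (4 * t * l) * kron h j * g0 i
    + coeffP c t l l' l'' (b t) (deriv b t) * g0 h * g0 i * p j

/-- The explicit components `S_{hij}`, with `lam = λ` and `b = b₁`. -/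
def explicitS (g : Metric n M) (c : ℝ) (lam b : ℝ → ℝ) (φ : OpenPartialHomeomorph M (E n))
    (y p : E n) (h i j : Fin n) : ℝ :=
  let t := energy g φ y p
  let l := lam t
  let l' := deriv lam t
  let l'' := deriv (deriv lam) t
  (-√c * (√c + √(2 * t) * b t) / 2) * gLow g φ y i j * p h
    + √c * (√c * l - √2 * b t * l * √t - 2 * √c * l' * t - 2 * √2 * b t * l' * (t * √t)) /
        (2 * l) * gLow g φ y h j * p i
    - √c * (√c * l + √2 * b t * l * √t + 2 * √c * l' * t + 2 * √2 * b t * l' * (t * √t)) /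
        (2 * l) * gLow g φ y h i * p j
    + coeffS c t l l' l'' (b t) (deriv b t) * p h * p i * p j

end CotangentLift

end

open CotangentLift

set_option linter.unusedSectionVars false

noncomputable section
namespace CotangentLift
variable {n : ℕ} {M : Type*} [TopologicalSpace M] [ChartedSpace (E n) M]
  [IsManifold 𝓘(ℝ, E n) ∞ M]

/-! Tensoriality. `G1`, `G2` and R⁰ are built from g, p and functions of t. At a fixed base point a
change of charts acts linearly on p, so ∂/∂p only adds one upper index (`pd_act₂_comp_coPull`), and
Q, P, S are contractions of M-tensor fields with inverse matrices. The ingredient that is not formal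
is the transformation law of the curvature. It follows from that of the Christoffel symbols
(`Koszul.christoffel_change`, `curvatureForm_change`), which in turn holds because the change of
charts preserves the metric and the Koszul formula determines the symbols.

The connection. The Koszul formula determines ∇ on the adapted frame. The brackets are [∂/∂pᵢ,
∂/∂pⱼ] = 0, [∂/∂pᵢ, δ/δq^j] = Γⁱ_{jh} ∂/∂pₕ and [δ/δqⁱ, δ/δq^j] = R⁰_{hij} ∂/∂pₕ. The energy is
constant along δ/δqᵏ and g is parallel, so δ/δqᵏ changes the components of G by Christoffel terms
only (`fderiv_natLow_horizontal`, `fderiv_natUp_horizontal`). These cancel against the brackets or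
reassemble into Γʰ_{ij}; what is left is ∂G/∂p and R⁰, to which `H1` and `H2` are applied. Since G
and J are defined in a chart that varies with the point, `metricG_eq_dotProduct` and `vec_tensorJ`
are needed before anything can be differentiated in a fixed chart.

The space form. Constant sectional curvature forces R(u,v)w = c(g(v,w)u − g(u,w)v)
(`curvatureForm_of_constant`), so the coefficients of Q, P, S are rational in c, t, c₁, c₂, d₁, d₂
and first derivatives. Write J⁽¹⁾ for the matrix of J on the δ/δqⁱ. Three consequences of the Kähler
condition suffice. The Hermitian condition gives G⁽¹⁾ = J⁽¹⁾G₍₂₎J⁽¹⁾ (`hermitian_relations`).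
Integrability gives (a₁ + 2tb₁)a₁' − a₁b₁ = c, which for a₁ = A√t means A² = 2c
(`nijenhuis_relation`). Closedness says that in J⁽¹⁾G₍₂₎ = f δ + m p⊗p♯ one has m = f'
(`closed_relation`). Here f = λ, whence λ = c₂a₁, c₁ = λa₁, λ + 2tλ' = (c₂ + 2td₂)(a₁ + 2tb₁) and c₁
+ 2td₁ = (λ + 2tλ')(a₁ + 2tb₁). Together with their derivatives (`kaehlerRelations`) these express
everything by λ and b₁, and the formulas become identities of rational functions in s = √t and k =
√c. -/

/-! ### Charts of M, induced charts of T*M and the invertibility of their derivatives. -/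

theorem IsChart.contMDiffAt {φ : OpenPartialHomeomorph M (E n)} (hφ : IsChart φ) {x : M}
    (hx : x ∈ φ.source) : ContMDiffAt 𝓘(ℝ, E n) 𝓘(ℝ, E n) ∞ φ x :=
  contMDiffAt_of_mem_maximalAtlas hφ hx

theorem IsChart.contMDiffAt_symm {φ : OpenPartialHomeomorph M (E n)} (hφ : IsChart φ) {y : E n}
    (hy : y ∈ φ.target) : ContMDiffAt 𝓘(ℝ, E n) 𝓘(ℝ, E n) ∞ φ.symm y :=
  contMDiffAt_symm_of_mem_maximalAtlas hφ hy

theorem isChart_chartAt (x : M) : IsChart (chartAt (E n) x) :=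
  IsManifold.chart_mem_maximalAtlas x

theorem IsChart.mdifferentiable {φ : OpenPartialHomeomorph M (E n)} (hφ : IsChart φ) :
    φ.MDifferentiable 𝓘(ℝ, E n) 𝓘(ℝ, E n) :=
  ⟨fun _ hx => ((hφ.contMDiffAt hx).mdifferentiableAt (by simp)).mdifferentiableWithinAt,
    fun _ hy => ((hφ.contMDiffAt_symm hy).mdifferentiableAt (by simp)).mdifferentiableWithinAt⟩

theorem IsChart.isInvertible_mfderiv {φ : OpenPartialHomeomorph M (E n)} (hφ : IsChart φ) {x : M}
    (hx : x ∈ φ.source) : (mfderiv 𝓘(ℝ, E n) 𝓘(ℝ, E n) φ x).IsInvertible :=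
  ⟨hφ.mdifferentiable.mfderiv hx, rfl⟩

/-- The change of charts `ψ ∘ φ⁻¹`. -/
def chartChange (φ ψ : OpenPartialHomeomorph M (E n)) (y : E n) : E n := ψ (φ.symm y)

theorem contDiffAt_chartChange {φ ψ : OpenPartialHomeomorph M (E n)} (hφ : IsChart φ)
    (hψ : IsChart ψ) {y : E n} (hy : y ∈ φ.target) (hy' : φ.symm y ∈ ψ.source) :
    ContDiffAt ℝ ∞ (chartChange φ ψ) y :=
  contMDiffAt_iff_contDiffAt.1 ((hψ.contMDiffAt hy').comp y (hφ.contMDiffAt_symm hy))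

theorem mfderiv_eq_fderiv_chartChange_comp {φ ψ : OpenPartialHomeomorph M (E n)} (hφ : IsChart φ)
    (hψ : IsChart ψ) {x : M} (hx : x ∈ φ.source) (hx' : x ∈ ψ.source)
    (v : TangentSpace 𝓘(ℝ, E n) x) :
    (mfderiv 𝓘(ℝ, E n) 𝓘(ℝ, E n) ψ x v : E n) =
      fderiv ℝ (chartChange φ ψ) (φ x) (mfderiv 𝓘(ℝ, E n) 𝓘(ℝ, E n) φ x v : E n) := by
  have h1 : ψ =ᶠ[𝓝 x] chartChange φ ψ ∘ φ := by
    filter_upwards [φ.open_source.mem_nhds hx] with z hz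
    simp [chartChange, φ.left_inv hz]
  have h2 := contDiffAt_chartChange hφ hψ (φ.map_source hx) (by rwa [φ.left_inv hx])
  have h3 : MDifferentiableAt 𝓘(ℝ, E n) 𝓘(ℝ, E n) (chartChange φ ψ) (φ x) :=
    (contMDiffAt_iff_contDiffAt.2 h2).mdifferentiableAt (by simp)
  rw [h1.mfderiv_eq, mfderiv_comp x h3 ((hφ.contMDiffAt hx).mdifferentiableAt (by simp)),
    mfderiv_eq_fderiv]
  rfl

theorem mfderiv_coordVec {φ : OpenPartialHomeomorph M (E n)} (hφ : IsChart φ) {x : M}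
    (hx : x ∈ φ.source) (i : Fin n) :
    (mfderiv 𝓘(ℝ, E n) 𝓘(ℝ, E n) φ x (coordVec φ i x) : E n) = e i :=
  (hφ.isInvertible_mfderiv hx).self_apply_inverse (e i)

theorem sum_smul_e (v : E n) : ∑ i, v i • (e i : E n) = v := by
  ext j
  simp [e, Finset.sum_apply, Pi.single_apply]

theorem coordVec_eq_sum {φ ψ : OpenPartialHomeomorph M (E n)} (hφ : IsChart φ)
    (hψ : IsChart ψ) {x : M} (hx : x ∈ φ.source) (hx' : x ∈ ψ.source) (i : Fin n) :
    coordVec φ i x = ∑ a, jac φ ψ x a i • coordVec ψ a x := by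
  apply (hψ.isInvertible_mfderiv hx').injective
  rw [map_sum]
  simp_rw [map_smul]
  erw [mfderiv_eq_fderiv_chartChange_comp hφ hψ hx hx', mfderiv_coordVec hφ hx]
  refine (sum_smul_e _).symm.trans (Finset.sum_congr rfl fun a _ => ?_)
  erw [mfderiv_coordVec hψ hx']
  rfl

theorem contMDiffAt_coordVec {φ : OpenPartialHomeomorph M (E n)} (hφ : IsChart φ) {x : M}
    (hx : x ∈ φ.source) (i : Fin n) :
    ContMDiffAt 𝓘(ℝ, E n) 𝓘(ℝ, E n).tangent ∞
      (fun x => (⟨x, coordVec φ i x⟩ : TangentBundle 𝓘(ℝ, E n) M)) x :=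
  ContMDiffAt.mpullback_vectorField_preimage (n := ∞)
    (contMDiffAt_vectorSpace_iff_contDiffAt.2 contDiffAt_const) (hφ.contMDiffAt hx)
    (hφ.isInvertible_mfderiv hx) (by simp)

theorem contDiffAt_gLow (g : Metric n M) {φ : OpenPartialHomeomorph M (E n)} (hφ : IsChart φ)
    {y : E n} (hy : y ∈ φ.target) (i j : Fin n) : ContDiffAt ℝ ∞ (fun y => gLow g φ y i j) y := by
  rw [← contMDiffAt_iff_contDiffAt]
  have h1 : ContMDiffAt 𝓘(ℝ, E n) 𝓘(ℝ, ℝ) ∞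
      (fun x => g.inner x (coordVec φ i x) (coordVec φ j x)) (φ.symm y) := by
    have hs := φ.map_target hy
    have h2 : ContMDiffAt 𝓘(ℝ, E n) (𝓘(ℝ, E n).prod 𝓘(ℝ, ℝ)) ∞
        (fun x => TotalSpace.mk' ℝ (E := Trivial M ℝ) x
          (g.inner x (coordVec φ i x) (coordVec φ j x))) (φ.symm y) :=
      ContMDiffAt.clm_bundle_apply₂ (F₁ := E n) (F₂ := E n) (g.contMDiff.contMDiffAt)
        (contMDiffAt_coordVec hφ hs i) (contMDiffAt_coordVec hφ hs j)
    rw [contMDiffAt_totalSpace] at h2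
    exact h2.2
  exact h1.comp y (hφ.contMDiffAt_symm hy)

/-- The coordinate functional `v ↦ vⁱ` of `ℝⁿ`. -/
def coordCLM (i : Fin n) : E n →L[ℝ] ℝ := EuclideanSpace.proj i

@[simp] theorem coordCLM_apply (i : Fin n) (v : E n) : coordCLM i v = v i := rfl

theorem indChart_fst (φ : OpenPartialHomeomorph M (E n)) (u : TStar n M) :
    (indChart φ u).1 = φ u.1 := rfl

theorem indChart_snd (φ : OpenPartialHomeomorph M (E n)) (u : TStar n M) (i : Fin n) :
    (indChart φ u).2 i = u.2 (coordVec φ i u.1) := rfl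

theorem contMDiffAt_indChart {φ : OpenPartialHomeomorph M (E n)} (hφ : IsChart φ) {u : TStar n M}
    (hu : u.1 ∈ φ.source) : ContMDiffAt (IStar n) 𝓘(ℝ, E n × E n) ∞ (indChart φ) u := by
  have hπ : ContMDiffAt (IStar n) 𝓘(ℝ, E n) ∞ (fun v : TStar n M => v.1) u :=
    contMDiffAt_proj _
  refine ContMDiffAt.prodMk_space ((hφ.contMDiffAt hu).comp u hπ) ?_
  have h : ContMDiffAt (IStar n) 𝓘(ℝ, Fin n → ℝ) ∞
      (fun (v : TStar n M) (i : Fin n) => (show ℝ from v.2 (coordVec φ i v.1))) u := by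
    refine contMDiffAt_pi_space.2 fun i => ?_
    have h1 : ContMDiffAt (IStar n) (𝓘(ℝ, E n).prod 𝓘(ℝ, E n)) ∞
        (fun v : TStar n M => TotalSpace.mk' (E n) (E := TangentSpace 𝓘(ℝ, E n)) v.1
          (coordVec φ i v.1)) u :=
      (contMDiffAt_coordVec hφ hu i).comp u hπ
    have h2 : ContMDiffAt (IStar n) (𝓘(ℝ, E n).prod 𝓘(ℝ, ℝ)) ∞
        (fun v : TStar n M => TotalSpace.mk' ℝ (E := Trivial M ℝ) v.1
          (v.2 (coordVec φ i v.1))) u :=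
      -- The identity of T*M is read as the tautological covector, a smooth family over the
      -- projection, and is evaluated on the coordinate field.
      ContMDiffAt.clm_bundle_apply (F₁ := E n) (F₂ := ℝ) contMDiffAt_id h1
    rw [contMDiffAt_totalSpace] at h2
    exact h2.2
  exact ((EuclideanSpace.equiv (Fin n) ℝ).symm.contDiff.contMDiff).contMDiffAt.comp u h

/-- The coordinates of a tangent vector of `T*M` in the induced chart. -/
def dInd (φ : OpenPartialHomeomorph M (E n)) (u : TStar n M) (ξ : TangentSpace (IStar n) u) :
    E n × E n :=
  mfderiv (IStar n) 𝓘(ℝ, E n × E n) (indChart φ) u ξ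

theorem hasMFDerivAt_indChart {φ : OpenPartialHomeomorph M (E n)} (hφ : IsChart φ) {u : TStar n M}
    (hu : u.1 ∈ φ.source) : HasMFDerivAt (IStar n) 𝓘(ℝ, E n × E n) (indChart φ) u
      (mfderiv (IStar n) 𝓘(ℝ, E n × E n) (indChart φ) u) :=
  ((contMDiffAt_indChart hφ hu).mdifferentiableAt (by simp)).hasMFDerivAt

theorem eventually_mem_source (φ : OpenPartialHomeomorph M (E n)) {u : TStar n M}
    (hu : u.1 ∈ φ.source) : ∀ᶠ v : TStar n M in 𝓝 u, v.1 ∈ φ.source :=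
  (FiberBundle.continuous_proj (E n →L[ℝ] ℝ)
    (fun x : M => TangentSpace 𝓘(ℝ, E n) x →L[ℝ] Trivial M ℝ x)).continuousAt.eventually
    (φ.open_source.mem_nhds hu)

theorem indChart_snd_eq_sum {φ ψ : OpenPartialHomeomorph M (E n)} (hφ : IsChart φ)
    (hψ : IsChart ψ) {u : TStar n M} (hu : u.1 ∈ φ.source) (hu' : u.1 ∈ ψ.source) (i : Fin n) :
    (indChart φ u).2 i = ∑ a, jac φ ψ u.1 a i * (indChart ψ u).2 a := by
  simp only [indChart_snd, coordVec_eq_sum hφ hψ hu hu']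
  rw [map_sum]
  simp_rw [map_smul]
  rfl

theorem HasMFDerivAt.prodMk_vectorSpace {F G : Type*} [NormedAddCommGroup F] [NormedSpace ℝ F]
    [NormedAddCommGroup G] [NormedSpace ℝ G] {f : TStar n M → F} {h : TStar n M → G}
    {u : TStar n M} {f' : TangentSpace (IStar n) u →L[ℝ] F} {h' : TangentSpace (IStar n) u →L[ℝ] G}
    (hf : HasMFDerivAt (IStar n) 𝓘(ℝ, F) f u f') (hh : HasMFDerivAt (IStar n) 𝓘(ℝ, G) h u h') :
    HasMFDerivAt (IStar n) 𝓘(ℝ, F × G) (fun v => (f v, h v)) u (f'.prod h') := by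
  rw [modelWithCornersSelf_prod, ← chartedSpaceSelf_prod]
  exact HasMFDerivAt.prodMk hf hh

theorem dInd_change_fst {φ ψ : OpenPartialHomeomorph M (E n)} (hφ : IsChart φ)
    (hψ : IsChart ψ) {u : TStar n M} (hu : u.1 ∈ φ.source) (hu' : u.1 ∈ ψ.source)
    (ξ : TangentSpace (IStar n) u) :
    (dInd ψ u ξ).1 = fderiv ℝ (chartChange φ ψ) (φ u.1) (dInd φ u ξ).1 := by
  have hF := (contDiffAt_chartChange hφ hψ (φ.map_source hu)
    (by rwa [φ.left_inv hu])).differentiableAt (by simp)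
  have h1 : HasMFDerivAt (IStar n) 𝓘(ℝ, E n) (fun v : TStar n M => (indChart ψ v).1) u
      ((ContinuousLinearMap.fst ℝ (E n) (E n)).comp
        (mfderiv (IStar n) 𝓘(ℝ, E n × E n) (indChart ψ) u)) :=
    HasMFDerivAt.comp u (hasFDerivAt_fst (p := indChart ψ u)).hasMFDerivAt
      (hasMFDerivAt_indChart hψ hu')
  have hf : HasFDerivAt (fun z : E n × E n => chartChange φ ψ z.1)
      ((fderiv ℝ (chartChange φ ψ) (φ u.1)).comp (ContinuousLinearMap.fst ℝ (E n) (E n)))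
      (indChart φ u) :=
    HasFDerivAt.comp (f := Prod.fst) (g := chartChange φ ψ) (indChart φ u) hF.hasFDerivAt
      hasFDerivAt_fst
  have h2 := HasMFDerivAt.comp u hf.hasMFDerivAt (hasMFDerivAt_indChart hφ hu)
  have h3 : (fun v : TStar n M => (indChart ψ v).1) =ᶠ[𝓝 u]
      (fun z : E n × E n => chartChange φ ψ z.1) ∘ indChart φ := by
    filter_upwards [eventually_mem_source φ hu] with v hv
    simp [indChart_fst, chartChange, φ.left_inv hv]
  have h4 := hasMFDerivAt_unique h1 (h2.congr_of_eventuallyEq h3)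
  exact congrArg (fun L : TangentSpace (IStar n) u →L[ℝ] E n => L ξ) h4

/-- Differentiates p_i = (∂ψᵃ/∂φⁱ) p'_a. The Jacobian depends on the base point, so second
derivatives of the change of charts appear; the Christoffel terms of `Dpᵢ` will compensate them. -/
theorem dInd_change_snd {φ ψ : OpenPartialHomeomorph M (E n)} (hφ : IsChart φ)
    (hψ : IsChart ψ) {u : TStar n M} (hu : u.1 ∈ φ.source) (hu' : u.1 ∈ ψ.source)
    (ξ : TangentSpace (IStar n) u) (i : Fin n) :
    (dInd φ u ξ).2 i = ∑ a, ((fderiv ℝ (chartChange φ ψ) (φ u.1) (e i)) a * (dInd ψ u ξ).2 a +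
      (fderiv ℝ (fderiv ℝ (chartChange φ ψ)) (φ u.1) (dInd φ u ξ).1 (e i)) a *
        (indChart ψ u).2 a) := by
  have hF := (contDiffAt_chartChange hφ hψ (φ.map_source hu) (by rwa [φ.left_inv hu]))
  have hF' := ((hF.fderiv_right (m := 1) (by norm_cast)).differentiableAt (by simp)).hasFDerivAt
  have h1 : HasMFDerivAt (IStar n) 𝓘(ℝ, ℝ) (fun v : TStar n M => (indChart φ v).2 i) u
      (((coordCLM i).comp (ContinuousLinearMap.snd ℝ (E n) (E n))).comp
        (mfderiv (IStar n) 𝓘(ℝ, E n × E n) (indChart φ) u)) :=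
    HasMFDerivAt.comp u ((coordCLM i).comp
      (ContinuousLinearMap.snd ℝ (E n) (E n))).hasFDerivAt.hasMFDerivAt
      (hasMFDerivAt_indChart hφ hu)
  have h2 := HasMFDerivAt.prodMk_vectorSpace (hasMFDerivAt_indChart hφ hu) (hasMFDerivAt_indChart hψ hu')
  let D2 := fderiv ℝ (fderiv ℝ (chartChange φ ψ)) (φ u.1)
  let π₁ := (ContinuousLinearMap.fst ℝ (E n) (E n)).comp
    (ContinuousLinearMap.fst ℝ (E n × E n) (E n × E n))
  let π₂ := (ContinuousLinearMap.snd ℝ (E n) (E n)).comp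
    (ContinuousLinearMap.snd ℝ (E n × E n) (E n × E n))
  have hc : ∀ a, HasFDerivAt (fun z : (E n × E n) × (E n × E n) =>
      (fderiv ℝ (chartChange φ ψ) z.1.1 (e i)) a)
      ((coordCLM a).comp ((ContinuousLinearMap.apply ℝ (E n) (e i)).comp (D2.comp π₁)))
      (indChart φ u, indChart ψ u) := fun a =>
    HasFDerivAt.comp (g := coordCLM a) (indChart φ u, indChart ψ u) (coordCLM a).hasFDerivAt
      (HasFDerivAt.comp (g := ContinuousLinearMap.apply ℝ (E n) (e i))
        (indChart φ u, indChart ψ u) (ContinuousLinearMap.apply ℝ (E n) (e i)).hasFDerivAt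
        (HasFDerivAt.comp (f := π₁) (indChart φ u, indChart ψ u) hF' π₁.hasFDerivAt))
  have hd : ∀ a, HasFDerivAt (fun z : (E n × E n) × (E n × E n) => z.2.2 a)
      ((coordCLM a).comp π₂) (indChart φ u, indChart ψ u) := fun a =>
    ((coordCLM a).comp π₂).hasFDerivAt
  have hf := HasFDerivAt.fun_sum (u := Finset.univ) fun a _ => (hc a).mul (hd a)
  obtain ⟨L, hL, hL'⟩ : ∃ L : ((E n × E n) × (E n × E n)) →L[ℝ] ℝ, HasFDerivAt
      (fun z : (E n × E n) × (E n × E n) =>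
        ∑ a, (fderiv ℝ (chartChange φ ψ) z.1.1 (e i)) a * z.2.2 a) L (indChart φ u, indChart ψ u) ∧
      ∀ w, L w = ∑ a, ((fderiv ℝ (chartChange φ ψ) (φ u.1) (e i)) a * w.2.2 a +
        (D2 w.1.1 (e i)) a * (indChart ψ u).2 a) := by
    refine ⟨_, hf, fun w => ?_⟩
    simp [π₁, π₂, mul_comm, indChart_fst]
  have h4 := HasMFDerivAt.comp u hL.hasMFDerivAt h2
  have h5 : (fun v : TStar n M => (indChart φ v).2 i) =ᶠ[𝓝 u]
      (fun z : (E n × E n) × (E n × E n) =>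
      ∑ a, (fderiv ℝ (chartChange φ ψ) z.1.1 (e i)) a * z.2.2 a) ∘
      fun v => (indChart φ v, indChart ψ v) := by
    filter_upwards [eventually_mem_source φ hu, eventually_mem_source ψ hu'] with v hv hv'
    exact indChart_snd_eq_sum hφ hψ hv hv' i
  have h6 := congrArg (fun L : TangentSpace (IStar n) u →L[ℝ] ℝ => L ξ)
    (hasMFDerivAt_unique h1 (h4.congr_of_eventuallyEq h5))
  exact h6.trans (hL' (dInd φ u ξ, dInd ψ u ξ))

theorem finrank_EStar : Module.finrank ℝ (EStar n) = Module.finrank ℝ (E n × E n) := by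
  have h : Module.finrank ℝ (E n →L[ℝ] ℝ) = Module.finrank ℝ (E n) :=
    (InnerProductSpace.toDual ℝ (E n)).toLinearEquiv.finrank_eq.symm
  rw [Module.finrank_prod, Module.finrank_prod, h]

/-- The manifold chart of T*M at `u` comes from the trivialization of the hom bundle and has values
in ℝⁿ × (ℝⁿ)*. Near `u` the induced chart is this chart followed by the injective linear map `T`,
which lists the values of a functional on the basis; and the derivative of a manifold chart is
invertible. -/
theorem eq_zero_of_dInd_chartAt_eq_zero (u : TStar n M) (ξ : TangentSpace (IStar n) u)
    (h : dInd (chartAt (E n) u.1) u ξ = 0) : ξ = 0 := by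
  let T : EStar n →L[ℝ] E n × E n :=
    (ContinuousLinearMap.fst ℝ _ _).prod
      ((EuclideanSpace.equiv (Fin n) ℝ).symm.toContinuousLinearMap.comp
        ((ContinuousLinearMap.pi fun i => ContinuousLinearMap.apply ℝ ℝ (e i)).comp
          (ContinuousLinearMap.snd ℝ (E n) (E n →L[ℝ] ℝ))))
  have hT : ∀ z, T z = (z.1, WithLp.toLp 2 fun i => z.2 (e i)) := fun z => rfl
  have hTinj : ∀ z, T z = 0 → z = 0 := by
    intro z hz
    rw [hT, Prod.ext_iff] at hz
    refine Prod.ext hz.1 (ContinuousLinearMap.ext fun v => ?_)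
    rw [← sum_smul_e v, map_sum]
    refine (Finset.sum_eq_zero fun i _ => ?_).trans (by simp)
    have h1 : z.2 (e i) = 0 := congrArg (fun w : E n => w i) hz.2
    simp [h1]
  have hev : indChart (chartAt (E n) u.1) =ᶠ[𝓝 u] T ∘ extChartAt (IStar n) u := by
    filter_upwards [eventually_mem_source (chartAt (E n) u.1) (mem_chart_source (E n) u.1)]
      with v hv
    have h2 : extChartAt (IStar n) u v = chartAt (ModelProd (E n) (E n →L[ℝ] ℝ)) u v := rfl
    rw [Function.comp_apply, h2, hom_chart, hT]
    refine Prod.ext rfl ?_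
    ext i
    -- The trivialization of TM carries the basis vector to the coordinate field, so both charts
    -- record the values of the covector on the same vectors.
    have h3 : (trivializationAt (E n) (TangentSpace 𝓘(ℝ, E n)) u.1).symmL ℝ v.1 (e i) =
        coordVec (chartAt (E n) u.1) i v.1 := by
      apply ((isChart_chartAt u.1).isInvertible_mfderiv hv).injective
      have h4 := TangentBundle.continuousLinearMapAt_trivializationAt (I := 𝓘(ℝ, E n)) hv
      have h5 := Trivialization.continuousLinearMapAt_symmL (R := ℝ)
        (trivializationAt (E n) (TangentSpace 𝓘(ℝ, E n)) u.1) (b := v.1) hv (e i)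
      rw [h4] at h5
      exact h5.trans (mfderiv_coordVec (isChart_chartAt u.1) hv i).symm
    have h6 : ∀ w : TangentSpace 𝓘(ℝ, E n) v.1,
        (trivializationAt ℝ (Trivial M ℝ) u.1).continuousLinearMapAt ℝ v.1 (v.2 w) = v.2 w := by
      intro w
      exact congrArg (fun L : Trivial M ℝ v.1 →L[ℝ] ℝ => L (v.2 w))
        (Trivial.continuousLinearMapAt_trivialization ℝ M ℝ v.1)
    have h7 := h6 (coordVec (chartAt (E n) u.1) i v.1)
    rw [← h3] at h7
    rw [indChart_snd, ← h3]
    exact h7.symm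
  have hinv : (mfderiv (IStar n) 𝓘(ℝ, EStar n) (extChartAt (IStar n) u) u).IsInvertible :=
    isInvertible_mfderiv_extChartAt (mem_extChartAt_source u)
  have hcomp : HasMFDerivAt (IStar n) 𝓘(ℝ, E n × E n) (T ∘ extChartAt (IStar n) u) u _ :=
    HasMFDerivAt.comp u T.hasFDerivAt.hasMFDerivAt
      ((contMDiffAt_extChartAt (n := 1)).mdifferentiableAt (by simp)).hasMFDerivAt
  have h8 : dInd (chartAt (E n) u.1) u ξ =
      T (mfderiv (IStar n) 𝓘(ℝ, EStar n) (extChartAt (IStar n) u) u ξ) :=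
    congrArg (fun L : TangentSpace (IStar n) u →L[ℝ] E n × E n => L ξ)
      (hasMFDerivAt_unique (hasMFDerivAt_indChart (isChart_chartAt u.1) (mem_chart_source _ _))
        (hcomp.congr_of_eventuallyEq hev))
  have h9 := hTinj _ (h8.symm.trans h)
  obtain ⟨L, hL⟩ := hinv
  rw [← hL] at h9
  exact L.map_eq_zero_iff.1 h9

theorem chartChange_fderiv_comp {φ ψ : OpenPartialHomeomorph M (E n)} (hφ : IsChart φ)
    (hψ : IsChart ψ) {x : M} (hx : x ∈ φ.source) (hx' : x ∈ ψ.source) (v : E n) :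
    fderiv ℝ (chartChange ψ φ) (ψ x) (fderiv ℝ (chartChange φ ψ) (φ x) v) = v := by
  obtain ⟨w, rfl⟩ := (hφ.isInvertible_mfderiv hx).surjective v
  erw [← mfderiv_eq_fderiv_chartChange_comp hφ hψ hx hx',
    ← mfderiv_eq_fderiv_chartChange_comp hψ hφ hx' hx]

/-- Reduces to the preferred chart. When dq vanishes, the second derivatives in `dInd_change_snd`
drop out and only the transposed Jacobian, which is injective, remains. -/
theorem eq_zero_of_dInd_eq_zero {φ : OpenPartialHomeomorph M (E n)} (hφ : IsChart φ)
    {u : TStar n M} (hu : u.1 ∈ φ.source) (ξ : TangentSpace (IStar n) u)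
    (h : dInd φ u ξ = 0) : ξ = 0 := by
  apply eq_zero_of_dInd_chartAt_eq_zero
  set ψ := chartAt (E n) u.1
  have hψ : IsChart ψ := isChart_chartAt u.1
  have hu' : u.1 ∈ ψ.source := mem_chart_source _ _
  have h1 := dInd_change_fst hφ hψ hu hu' ξ
  rw [h, Prod.fst_zero, map_zero] at h1
  have h2 := dInd_change_snd hφ hψ hu hu' ξ
  simp only [h, Prod.fst_zero, Prod.snd_zero, map_zero, zero_apply,
    PiLp.zero_apply, zero_mul, add_zero] at h2
  have h3 : ∀ v : E n, ∑ a, (fderiv ℝ (chartChange φ ψ) (φ u.1) v) a * (dInd ψ u ξ).2 a = 0 := by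
    intro v
    rw [← sum_smul_e v, map_sum]
    simp only [map_smul, WithLp.ofLp_sum, Finset.sum_apply, PiLp.smul_apply, smul_eq_mul,
      Finset.sum_mul]
    rw [Finset.sum_comm]
    refine Finset.sum_eq_zero fun i _ => ?_
    simp_rw [mul_assoc, ← Finset.mul_sum, ← h2 i, mul_zero]
  refine Prod.ext h1 ?_
  ext i
  -- This is the vector that the Jacobian of the change of charts sends to the basis vector.
  have h4 := h3 (fderiv ℝ (chartChange ψ φ) (ψ u.1) (e i))
  rw [chartChange_fderiv_comp hψ hφ hu' hu] at h4
  simpa [e, Pi.single_apply] using h4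

theorem isInvertible_mfderiv_indChart {φ : OpenPartialHomeomorph M (E n)} (hφ : IsChart φ)
    {u : TStar n M} (hu : u.1 ∈ φ.source) :
    (mfderiv (IStar n) 𝓘(ℝ, E n × E n) (indChart φ) u).IsInvertible := by
  let L : EStar n →L[ℝ] E n × E n := mfderiv (IStar n) 𝓘(ℝ, E n × E n) (indChart φ) u
  have hL : Function.Injective L :=
    (injective_iff_map_eq_zero L).2 fun ξ h => eq_zero_of_dInd_eq_zero hφ hu ξ h
  exact ⟨(LinearMap.linearEquivOfInjective L.toLinearMap hL finrank_EStar).toContinuousLinearEquiv, ContinuousLinearMap.ext fun _ => rfl⟩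

/-! ### Christoffel and curvature forms on a normed space, without indices. -/

section Connection

variable {V : Type*} [NormedAddCommGroup V] [NormedSpace ℝ V]

/-- The curvature `R(u, v)w` at `y` of the connection with Christoffel form `Γ`. -/
def curvatureForm (Γ : V → V →L[ℝ] V →L[ℝ] V) (y u v w : V) : V :=
  fderiv ℝ Γ y u v w - fderiv ℝ Γ y v u w + Γ y u (Γ y v w) - Γ y v (Γ y u w)

/-- The Koszul formula at `y` for the Christoffel form `Γ` of the metric `B`. -/
def Koszul (B : V → V →L[ℝ] V →L[ℝ] ℝ) (Γ : V → V →L[ℝ] V →L[ℝ] V) (y : V) : Prop :=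
  ∀ u v w, 2 * B y (Γ y u v) w =
    fderiv ℝ B y u v w + fderiv ℝ B y v u w - fderiv ℝ B y w u v

theorem fderiv_apply_apply {W : Type*} [NormedAddCommGroup W] [NormedSpace ℝ W]
    {B : V → V →L[ℝ] V →L[ℝ] W} {y : V} (hB : DifferentiableAt ℝ B y) (u v w : V) :
    fderiv ℝ (fun z => B z v w) y u = fderiv ℝ B y u v w := by
  have h := (hB.hasFDerivAt.clm_apply (hasFDerivAt_const v y)).clm_apply (hasFDerivAt_const w y)
  rw [h.fderiv]
  simp

theorem fderiv_symm {W : Type*} [NormedAddCommGroup W] [NormedSpace ℝ W]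
    {B : V → V →L[ℝ] V →L[ℝ] W} {y : V} (hB : DifferentiableAt ℝ B y)
    (hs : ∀ᶠ z in 𝓝 y, ∀ v w, B z v w = B z w v) (u v w : V) :
    fderiv ℝ B y u v w = fderiv ℝ B y u w v := by
  rw [← fderiv_apply_apply hB, ← fderiv_apply_apply hB]
  have h : (fun z => B z v w) =ᶠ[𝓝 y] fun z => B z w v := hs.mono fun z hz => hz v w
  rw [h.fderiv_eq]

/-- The sum of the Koszul formulas for (u, v, w) and (u, w, v): the last two terms of one cancel
those of the other. -/
theorem Koszul.fderiv_metric {B : V → V →L[ℝ] V →L[ℝ] ℝ} {Γ : V → V →L[ℝ] V →L[ℝ] V} {y : V}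
    (hK : Koszul B Γ y) (hB : DifferentiableAt ℝ B y)
    (hs : ∀ᶠ z in 𝓝 y, ∀ v w, B z v w = B z w v) (u v w : V) :
    fderiv ℝ B y u v w = B y (Γ y u v) w + B y v (Γ y u w) := by
  have h1 := hK u v w
  have h2 := hK u w v
  rw [hs.self_of_nhds v (Γ y u w)]
  linarith [fderiv_symm hB hs u v w, fderiv_symm hB hs v u w, fderiv_symm hB hs w u v]

set_option synthInstance.maxHeartbeats 400000 in
/-- The transformation law of the Christoffel form under a map `F` preserving the metrics. -/
theorem Koszul.christoffel_change {B B' : V → V →L[ℝ] V →L[ℝ] ℝ} {Γ Γ' : V → V →L[ℝ] V →L[ℝ] V}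
    {F : V → V} {y : V} (hK : Koszul B Γ y) (hK' : Koszul B' Γ' (F y))
    (hB : DifferentiableAt ℝ B y) (hB' : DifferentiableAt ℝ B' (F y))
    (hF : ContDiffAt ℝ 2 F y) (hs : ∀ v w, B' (F y) v w = B' (F y) w v)
    (hpos : ∀ v, v ≠ 0 → 0 < B' (F y) v v) (hsurj : Function.Surjective (fderiv ℝ F y))
    (hBB : ∀ᶠ z in 𝓝 y, ∀ v w, B z v w = B' (F z) (fderiv ℝ F z v) (fderiv ℝ F z w)) (u v : V) :
    fderiv ℝ F y (Γ y u v) =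
      fderiv ℝ (fderiv ℝ F) y u v + Γ' (F y) (fderiv ℝ F y u) (fderiv ℝ F y v) := by
  have hF' := ((hF.fderiv_right (m := 1) (by norm_cast)).differentiableAt (by simp)).hasFDerivAt
  have hF0 := (hF.differentiableAt (by simp)).hasFDerivAt
  have hsym : ∀ a b, fderiv ℝ (fderiv ℝ F) y a b = fderiv ℝ (fderiv ℝ F) y b a :=
    fun a b => (hF.isSymmSndFDerivAt (by simp)).eq a b
  -- The isometry relation differentiated; D²F enters once for each argument.
  have hD : ∀ a b c, fderiv ℝ B y a b c =
      fderiv ℝ B' (F y) (fderiv ℝ F y a) (fderiv ℝ F y b) (fderiv ℝ F y c) +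
        B' (F y) (fderiv ℝ (fderiv ℝ F) y a b) (fderiv ℝ F y c) +
        B' (F y) (fderiv ℝ F y b) (fderiv ℝ (fderiv ℝ F) y a c) := by
    intro a b c
    have h1 : (fun z => B z b c) =ᶠ[𝓝 y]
        fun z => B' (F z) (fderiv ℝ F z b) (fderiv ℝ F z c) := hBB.mono fun z hz => hz b c
    have hBF : HasFDerivAt (fun z => B' (F z)) ((fderiv ℝ B' (F y)).comp (fderiv ℝ F y)) y :=
      HasFDerivAt.comp (G := V →L[ℝ] V →L[ℝ] ℝ) (g := B') (f := F) y hB'.hasFDerivAt hF0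
    have h2 := (hBF.clm_apply
      (hF'.clm_apply (hasFDerivAt_const b y))).clm_apply (hF'.clm_apply (hasFDerivAt_const c y))
    rw [← fderiv_apply_apply hB, h1.fderiv_eq]
    erw [h2.fderiv]
    simp
    ring
  have hBy := hBB.self_of_nhds
  -- The Koszul formulas of `B` and `B'` are compared. Of the six terms in D²F, those with D²F(u,w)
  -- and D²F(v,w) cancel and the two with D²F(u,v) remain.
  have h0 : ∀ w, B' (F y) (fderiv ℝ F y (Γ y u v) - (fderiv ℝ (fderiv ℝ F) y u v +
      Γ' (F y) (fderiv ℝ F y u) (fderiv ℝ F y v))) (fderiv ℝ F y w) = 0 := by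
    intro w
    have h1 := hK u v w
    have h2 := hK' (fderiv ℝ F y u) (fderiv ℝ F y v) (fderiv ℝ F y w)
    rw [hBy, hD, hD, hD] at h1
    simp only [map_sub, map_add, sub_apply, add_apply]
    rw [hsym v u, hsym w u, hsym w v] at h1
    have h3 := hs (fderiv ℝ F y u) (fderiv ℝ (fderiv ℝ F) y v w)
    have h4 := hs (fderiv ℝ F y v) (fderiv ℝ (fderiv ℝ F) y u w)
    linarith
  -- By surjectivity the difference of the two sides is a value of DF, so it may be paired with
  -- itself.
  by_contra hne
  obtain ⟨w, hw⟩ := hsurj (fderiv ℝ F y (Γ y u v) - (fderiv ℝ (fderiv ℝ F) y u v +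
      Γ' (F y) (fderiv ℝ F y u) (fderiv ℝ F y v)))
  have h1 := h0 w
  rw [hw] at h1
  exact (hpos _ (sub_ne_zero.2 hne)).ne' h1

set_option synthInstance.maxHeartbeats 400000 in
/-- The transformation law of the curvature. -/
theorem curvatureForm_change {Γ Γ' : V → V →L[ℝ] V →L[ℝ] V} {F : V → V} {y : V}
    (hΓ : DifferentiableAt ℝ Γ y) (hΓ' : DifferentiableAt ℝ Γ' (F y)) (hF : ContDiffAt ℝ 3 F y)
    (hc : ∀ᶠ z in 𝓝 y, ∀ u v, fderiv ℝ F z (Γ z u v) =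
      fderiv ℝ (fderiv ℝ F) z u v + Γ' (F z) (fderiv ℝ F z u) (fderiv ℝ F z v)) (u v w : V) :
    fderiv ℝ F y (curvatureForm Γ y u v w) =
      curvatureForm Γ' (F y) (fderiv ℝ F y u) (fderiv ℝ F y v) (fderiv ℝ F y w) := by
  have hF0 := (hF.differentiableAt (by simp)).hasFDerivAt
  have hF1 := hF.fderiv_right (m := 2) (by norm_cast)
  have hF' := (hF1.differentiableAt (by simp)).hasFDerivAt
  have hF'' := ((hF1.fderiv_right (m := 1) (by norm_cast)).differentiableAt (by simp)).hasFDerivAt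
  have hsym2 : ∀ a b, fderiv ℝ (fderiv ℝ F) y a b = fderiv ℝ (fderiv ℝ F) y b a :=
    fun a b => (hF.isSymmSndFDerivAt (by norm_num [minSmoothness])).eq a b
  have hsym : ∀ a b, fderiv ℝ (fderiv ℝ (fderiv ℝ F)) y a b =
      fderiv ℝ (fderiv ℝ (fderiv ℝ F)) y b a :=
    fun a b => (hF1.isSymmSndFDerivAt (by simp)).eq a b
  -- The transformation law of Γ, differentiated in the direction `a`.
  have hD : ∀ a b c, fderiv ℝ (fderiv ℝ F) y a (Γ y b c) + fderiv ℝ F y (fderiv ℝ Γ y a b c) =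
      fderiv ℝ (fderiv ℝ (fderiv ℝ F)) y a b c +
        (fderiv ℝ Γ' (F y) (fderiv ℝ F y a) (fderiv ℝ F y b) (fderiv ℝ F y c) +
        Γ' (F y) (fderiv ℝ (fderiv ℝ F) y a b) (fderiv ℝ F y c) +
        Γ' (F y) (fderiv ℝ F y b) (fderiv ℝ (fderiv ℝ F) y a c)) := by
    intro a b c
    have h1 : (fun z => fderiv ℝ F z (Γ z b c)) =ᶠ[𝓝 y] fun z =>
        fderiv ℝ (fderiv ℝ F) z b c + Γ' (F z) (fderiv ℝ F z b) (fderiv ℝ F z c) :=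
      hc.mono fun z hz => hz b c
    have hBF : HasFDerivAt (fun z => Γ' (F z)) ((fderiv ℝ Γ' (F y)).comp (fderiv ℝ F y)) y :=
      HasFDerivAt.comp (G := V →L[ℝ] V →L[ℝ] V) (g := Γ') (f := F) y hΓ'.hasFDerivAt hF0
    have h2 := (hBF.clm_apply
      (hF'.clm_apply (hasFDerivAt_const b y))).clm_apply (hF'.clm_apply (hasFDerivAt_const c y))
    have h3 := ((hF''.clm_apply (hasFDerivAt_const b y)).clm_apply (hasFDerivAt_const c y)).add h2
    have h4 := hF'.clm_apply
      ((hΓ.hasFDerivAt.clm_apply (hasFDerivAt_const b y)).clm_apply (hasFDerivAt_const c y))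
    have h5 := congrArg (fun L : V →L[ℝ] V => L a) (h4.unique (h3.congr_of_eventuallyEq h1))
    simp at h5
    rw [add_comm]
    refine h5.trans ?_
    abel
  have hy := hc.self_of_nhds
  -- Antisymmetrizing in u, v removes the third derivative of F. The products of D²F with Γ are
  -- removed by the law itself, applied to `Γ y v w` and `Γ y u w`.
  have h1 := hD u v w
  have h2 := hD v u w
  rw [hsym2 v u, hsym v u] at h2
  have e1 := hy u (Γ y v w)
  have e2 := hy v (Γ y u w)
  simp only [curvatureForm, map_sub, map_add, e1, e2, hy v w, hy u w]
  linear_combination (norm := module) h1 - h2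

set_option synthInstance.maxHeartbeats 400000 in
/-- The curvature of a metric connection is skew-adjoint. -/
theorem curvatureForm_skew {B : V → V →L[ℝ] V →L[ℝ] ℝ} {Γ : V → V →L[ℝ] V →L[ℝ] V} {y : V}
    (hΓ : DifferentiableAt ℝ Γ y) (hB : ContDiffAt ℝ 2 B y)
    (hc : ∀ᶠ z in 𝓝 y, ∀ u v w, fderiv ℝ B z u v w = B z (Γ z u v) w + B z v (Γ z u w))
    (a u v w : V) :
    B y (curvatureForm Γ y a u v) w + B y v (curvatureForm Γ y a u w) = 0 := by
  have hB0 := (hB.differentiableAt (by simp)).hasFDerivAt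
  have hb : ContDiffAt ℝ 2 (fun z => B z v w) y :=
    (hB.clm_apply contDiffAt_const).clm_apply contDiffAt_const
  have hb' := ((hb.fderiv_right (m := 1) (by norm_cast)).differentiableAt (by simp)).hasFDerivAt
  -- The second derivatives of z ↦ B(v, w) commute. Rewritten twice with metric compatibility, their
  -- commutator is the sum to be shown zero.
  have hsym : ∀ a b, fderiv ℝ (fderiv ℝ fun z => B z v w) y a b =
      fderiv ℝ (fderiv ℝ fun z => B z v w) y b a :=
    fun a b => (hb.isSymmSndFDerivAt (by simp)).eq a b
  have hd : ∀ᶠ z in 𝓝 y, DifferentiableAt ℝ B z :=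
    (hB.eventually (by simp)).mono fun z hz => hz.differentiableAt (by simp)
  have hy := hc.self_of_nhds
  have hD : ∀ a u, fderiv ℝ (fderiv ℝ fun z => B z v w) y a u =
      fderiv ℝ B y a (Γ y u v) w + B y (fderiv ℝ Γ y a u v) w +
        (fderiv ℝ B y a v (Γ y u w) + B y v (fderiv ℝ Γ y a u w)) := by
    intro a u
    have h1 : (fun z => fderiv ℝ (fun x => B x v w) z u) =ᶠ[𝓝 y] fun z =>
        B z (Γ z u v) w + B z v (Γ z u w) := by
      filter_upwards [hc, hd] with z hz hz'
      rw [fderiv_apply_apply hz', hz]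
    have hΓv : ∀ x, HasFDerivAt (fun z => Γ z u x) _ y := fun x =>
      (hΓ.hasFDerivAt.clm_apply (hasFDerivAt_const u y)).clm_apply (hasFDerivAt_const x y)
    have h2 := ((hB0.clm_apply (hΓv v)).clm_apply (hasFDerivAt_const w y)).add
      ((hB0.clm_apply (hasFDerivAt_const v y)).clm_apply (hΓv w))
    have h3 := hb'.clm_apply (hasFDerivAt_const u y)
    have h5 := congrArg (fun L : V →L[ℝ] ℝ => L a) (h3.unique (h2.congr_of_eventuallyEq h1))
    simp at h5
    rw [h5]
    ring
  have h1 := hD a u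
  have h2 := hD u a
  rw [hsym u a] at h2
  simp only [hy] at h1 h2
  simp only [curvatureForm, map_add, map_sub, add_apply, sub_apply]
  linarith

theorem curvatureForm_swap (Γ : V → V →L[ℝ] V →L[ℝ] V) (y u v w : V) :
    curvatureForm Γ y u v w = -curvatureForm Γ y v u w := by
  simp only [curvatureForm]
  abel

theorem curvatureForm_bianchi {Γ : V → V →L[ℝ] V →L[ℝ] V} {y : V} (hΓ : DifferentiableAt ℝ Γ y)
    (hs : ∀ᶠ z in 𝓝 y, ∀ u v, Γ z u v = Γ z v u) (u v w : V) :
    curvatureForm Γ y u v w + curvatureForm Γ y v w u + curvatureForm Γ y w u v = 0 := by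
  have h := fderiv_symm hΓ hs
  have h0 := hs.self_of_nhds
  simp only [curvatureForm]
  rw [h u w v, h v u w, h w v u, h0 w v, h0 u w, h0 v u]
  abel

/-- A quadrilinear form with the algebraic symmetries of a curvature tensor is zero if its
sectional curvatures are. -/
theorem eq_zero_of_sectional_eq_zero {T : V → V → V → V → ℝ}
    (hadd : ∀ a b v z w, T (a + b) v z w = T a v z w + T b v z w)
    (h12 : ∀ u v z w, T u v z w = -T v u z w) (h34 : ∀ u v z w, T u v z w = -T u v w z)
    (hb : ∀ u v z w, T u v z w + T v z u w + T z u v w = 0) (hs : ∀ u v, T u v v u = 0)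
    (u v z w : V) : T u v z w = 0 := by
  -- Pair symmetry is the classical combination of four Bianchi identities.
  have hp : ∀ u v z w, T u v z w = T z w u v := by
    intro u v z w
    linarith [hb u v z w, hb v z w u, hb z w u v, hb w u v z, h12 u v z w, h12 v z u w,
      h12 z u v w, h34 u v z w, h34 v z u w, h34 z u v w, h12 z w u v, h12 w u v z, h12 v z w u,
      h34 z w u v, h34 w u v z, h34 v z w u, h12 u w v z, h34 u w v z, h34 w v z u, h12 w v z u,
      h12 u z w v, h34 u z w v, h12 v w u z, h34 v w u z, h34 z u w v]
  have hadd4 : ∀ u v z a b, T u v z (a + b) = T u v z a + T u v z b := by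
    intro u v z a b
    rw [hp u v z (a + b), h12, hadd, hp u v z a, hp u v z b, h12 z a, h12 z b]
    ring
  -- Polarization in the outer arguments, in which `T u v v w` is symmetric by `hp`.
  have h1 : ∀ u v w, T u v v w = 0 := by
    intro u v w
    have h2 := hs (u + w) v
    rw [hadd, hadd4, hadd4, hs, hs] at h2
    have h3 := hp w v v u
    have h4 := h12 v u w v
    have h5 := h34 u v w v
    linarith
  -- Polarization in the middle arguments.
  have h2 : ∀ u v z w, T u v z w = -T u z v w := by
    intro u v z w
    have h3 := h1 (v + z) u w
    have hadd2 : ∀ u a b z w, T u (a + b) z w = T u a z w + T u b z w := by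
      intro u a b z w
      rw [h12, hadd, h12 u a, h12 u b]
      ring
    have hadd3 : ∀ u v a b w, T u v (a + b) w = T u v a w + T u v b w := by
      intro u v a b w
      rw [h34, hadd4, h34 u v a, h34 u v b]
      ring
    have h4 := h1 u (v + z) w
    rw [hadd2, hadd3, hadd3, h1, h1] at h4
    linarith
  -- By `h2` and `h12` the three terms of the Bianchi identity coincide, so 3T = 0.
  linarith [hb u v z w, h2 u v z w, h2 v z u w, h12 v u z w, h2 z u v w, h12 z v u w, h12 u z v w,
    h2 v u z w]

end Connection

/-! ### The metric, the Christoffel symbols and the curvature as forms on a chart -/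

theorem e_apply (i j : Fin n) : (e i : E n) j = if j = i then 1 else 0 := by
  simp [e]

theorem E_induction {p : E n → Prop} (h0 : p 0) (hadd : ∀ v w, p v → p w → p (v + w))
    (hsmul : ∀ (a : ℝ) v, p v → p (a • v)) (he : ∀ i, p (e i)) (v : E n) : p v := by
  rw [← sum_smul_e v]
  exact Finset.sum_induction _ p hadd h0 fun i _ => hsmul _ _ (he i)

theorem contDiffAt_smul_const {F W : Type*} [NormedAddCommGroup F] [NormedSpace ℝ F]
    [NormedAddCommGroup W] [NormedSpace ℝ W] {f : F → ℝ} {x : F} (hf : ContDiffAt ℝ ∞ f x) (c : W) :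
    ContDiffAt ℝ ∞ (fun z => f z • c) x :=
  hf.smul contDiffAt_const

/-- The metric read in the chart `φ`, as a field of bilinear forms. -/
def metricForm (g : Metric n M) (φ : OpenPartialHomeomorph M (E n)) (y : E n) :
    E n →L[ℝ] E n →L[ℝ] ℝ :=
  ∑ i, ∑ j, gLow g φ y i j • (coordCLM i).smulRight (coordCLM j)

/-- The Christoffel symbols of the chart `φ`, as a field of bilinear maps. -/
def christoffelForm (g : Metric n M) (φ : OpenPartialHomeomorph M (E n)) (y : E n) :
    E n →L[ℝ] E n →L[ℝ] E n :=
  ∑ i, ∑ j, ∑ k, christoffel g φ k i j y •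
    (coordCLM i).smulRight ((coordCLM j).smulRight (e k : E n))

theorem metricForm_apply (g : Metric n M) (φ : OpenPartialHomeomorph M (E n)) (y v w : E n) :
    metricForm g φ y v w = ∑ i, ∑ j, gLow g φ y i j * v i * w j := by
  simp [metricForm, mul_assoc]

theorem metricForm_e (g : Metric n M) (φ : OpenPartialHomeomorph M (E n)) (y : E n)
    (i j : Fin n) : metricForm g φ y (e i) (e j) = gLow g φ y i j := by
  simp [metricForm_apply, e_apply]

theorem christoffelForm_e (g : Metric n M) (φ : OpenPartialHomeomorph M (E n)) (y : E n)
    (i j k : Fin n) : christoffelForm g φ y (e i) (e j) k = christoffel g φ k i j y := by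
  simp [christoffelForm, e_apply]

theorem contDiffAt_metricForm (g : Metric n M) {φ : OpenPartialHomeomorph M (E n)}
    (hφ : IsChart φ) {y : E n} (hy : y ∈ φ.target) : ContDiffAt ℝ ∞ (metricForm g φ) y :=
  ContDiffAt.sum fun i _ => ContDiffAt.sum fun j _ =>
    contDiffAt_smul_const (contDiffAt_gLow g hφ hy i j) _

theorem gLow_symm (g : Metric n M) (φ : OpenPartialHomeomorph M (E n)) (y : E n) (i j : Fin n) :
    gLow g φ y i j = gLow g φ y j i :=
  g.symm _ _ _

theorem metricForm_symm (g : Metric n M) (φ : OpenPartialHomeomorph M (E n)) (y v w : E n) :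
    metricForm g φ y v w = metricForm g φ y w v := by
  rw [metricForm_apply, metricForm_apply, Finset.sum_comm]
  refine Finset.sum_congr rfl fun i _ => Finset.sum_congr rfl fun j _ => ?_
  rw [gLow_symm]
  ring

theorem metricForm_eq_inner (g : Metric n M) {φ : OpenPartialHomeomorph M (E n)}
    (y v w : E n) :
    metricForm g φ y v w = g.inner (φ.symm y) (∑ i, v i • coordVec φ i (φ.symm y))
      (∑ i, w i • coordVec φ i (φ.symm y)) := by
  rw [metricForm_apply, map_sum]
  simp only [map_smul]
  rw [Finset.sum_comm]
  refine Finset.sum_congr rfl fun j _ => ?_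
  rw [map_sum, sum_apply, Finset.smul_sum]
  refine Finset.sum_congr rfl fun i _ => ?_
  simp only [map_smul, smul_apply, smul_eq_mul, gLow, Matrix.of_apply]
  ring

theorem metricForm_pos (g : Metric n M) {φ : OpenPartialHomeomorph M (E n)} (hφ : IsChart φ)
    {y : E n} (hy : y ∈ φ.target) (v : E n) (hv : v ≠ 0) : 0 < metricForm g φ y v v := by
  rw [metricForm_eq_inner]
  refine g.pos _ _ fun h => hv ?_
  have h1 := congrArg (fun w => (mfderiv 𝓘(ℝ, E n) 𝓘(ℝ, E n) φ (φ.symm y) w : E n)) h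
  simp only [map_zero, map_sum, map_smul] at h1
  rw [← sum_smul_e v]
  refine Eq.trans (Finset.sum_congr rfl fun i _ => ?_) h1
  exact congrArg (v i • ·) (mfderiv_coordVec hφ (φ.map_target hy) i).symm

theorem posDef_gLow (g : Metric n M) {φ : OpenPartialHomeomorph M (E n)} (hφ : IsChart φ)
    {y : E n} (hy : y ∈ φ.target) : (gLow g φ y).PosDef := by
  refine Matrix.PosDef.of_dotProduct_mulVec_pos ?_ fun x hx => ?_
  · ext i j
    exact gLow_symm g φ y j i
  · have h := metricForm_pos g hφ hy (WithLp.toLp 2 x) (by simpa using hx)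
    rw [metricForm_apply] at h
    refine h.trans_eq ?_
    simp only [dotProduct, Matrix.mulVec, Finset.mul_sum]
    refine Finset.sum_congr rfl fun i _ => Finset.sum_congr rfl fun j _ => ?_
    simp
    ring

theorem gUp_mul_gLow (g : Metric n M) {φ : OpenPartialHomeomorph M (E n)} (hφ : IsChart φ)
    {y : E n} (hy : y ∈ φ.target) : gUp g φ y * gLow g φ y = 1 :=
  Matrix.nonsing_inv_mul _ (Matrix.isUnit_iff_isUnit_det _ |>.1 (posDef_gLow g hφ hy).isUnit)

theorem gLow_mul_gUp (g : Metric n M) {φ : OpenPartialHomeomorph M (E n)} (hφ : IsChart φ)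
    {y : E n} (hy : y ∈ φ.target) : gLow g φ y * gUp g φ y = 1 :=
  Matrix.mul_nonsing_inv _ (Matrix.isUnit_iff_isUnit_det _ |>.1 (posDef_gLow g hφ hy).isUnit)

theorem gUp_symm (g : Metric n M) (φ : OpenPartialHomeomorph M (E n)) (y : E n) (i j : Fin n) :
    gUp g φ y i j = gUp g φ y j i := by
  have h : (gLow g φ y).transpose = gLow g φ y := by
    ext i j
    exact gLow_symm g φ y j i
  have h1 := congrFun (congrFun (Matrix.transpose_nonsing_inv (gLow g φ y)) j) i
  rw [h] at h1
  exact h1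

theorem contDiffAt_det {F ι : Type*} [NormedAddCommGroup F] [NormedSpace ℝ F] [Fintype ι]
    [DecidableEq ι] {A : F → Matrix ι ι ℝ} {x : F}
    (hA : ∀ i j, ContDiffAt ℝ ∞ (fun z => A z i j) x) : ContDiffAt ℝ ∞ (fun z => (A z).det) x := by
  simp only [Matrix.det_apply']
  exact ContDiffAt.sum fun σ _ => contDiffAt_const.mul (contDiffAt_prod fun i _ => hA _ _)

/-- Cramer's rule: an entry of the inverse is a cofactor, again a determinant, divided by the
determinant. -/
theorem contDiffAt_inv_apply {F ι : Type*} [NormedAddCommGroup F] [NormedSpace ℝ F] [Fintype ι]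
    [DecidableEq ι] {A : F → Matrix ι ι ℝ} {x : F}
    (hA : ∀ i j, ContDiffAt ℝ ∞ (fun z => A z i j) x) (h0 : (A x).det ≠ 0) (i j : ι) :
    ContDiffAt ℝ ∞ (fun z => (A z)⁻¹ i j) x := by
  simp only [Matrix.inv_def, Matrix.smul_apply, Ring.inverse_eq_inv', smul_eq_mul,
    Matrix.adjugate_apply]
  refine ((contDiffAt_det hA).inv h0).mul (contDiffAt_det fun k l => ?_)
  by_cases hk : k = j
  · subst hk
    simpa using contDiffAt_const
  · simpa [Matrix.updateRow_ne hk] using hA k l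

theorem contDiffAt_gUp (g : Metric n M) {φ : OpenPartialHomeomorph M (E n)} (hφ : IsChart φ)
    {y : E n} (hy : y ∈ φ.target) (i j : Fin n) : ContDiffAt ℝ ∞ (fun y => gUp g φ y i j) y :=
  contDiffAt_inv_apply (contDiffAt_gLow g hφ hy) (posDef_gLow g hφ hy).det_pos.ne' i j

theorem contDiffAt_pd {f : E n → ℝ} {y : E n} (hf : ContDiffAt ℝ ∞ f y) (i : Fin n) :
    ContDiffAt ℝ ∞ (pd i f) y :=
  (hf.fderiv_right (m := ∞) (by norm_cast)).clm_apply contDiffAt_const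

theorem contDiffAt_christoffel (g : Metric n M) {φ : OpenPartialHomeomorph M (E n)}
    (hφ : IsChart φ) {y : E n} (hy : y ∈ φ.target) (k i j : Fin n) :
    ContDiffAt ℝ ∞ (christoffel g φ k i j) y := by
  have h := fun i j k => contDiffAt_pd (contDiffAt_gLow g hφ hy i j) k
  exact contDiffAt_const.mul (ContDiffAt.sum fun l _ => (contDiffAt_gUp g hφ hy k l).mul
    (((h j l i).add (h i l j)).sub (h i j l)))

theorem contDiffAt_christoffelForm (g : Metric n M) {φ : OpenPartialHomeomorph M (E n)}
    (hφ : IsChart φ) {y : E n} (hy : y ∈ φ.target) : ContDiffAt ℝ ∞ (christoffelForm g φ) y :=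
  ContDiffAt.sum fun i _ => ContDiffAt.sum fun j _ => ContDiffAt.sum fun k _ =>
    contDiffAt_smul_const (contDiffAt_christoffel g hφ hy k i j) _

theorem christoffel_symm (g : Metric n M) (φ : OpenPartialHomeomorph M (E n)) (k i j : Fin n)
    (y : E n) : christoffel g φ k i j y = christoffel g φ k j i y := by
  simp only [christoffel, gLow_symm g φ _ i j]
  congr 1
  exact Finset.sum_congr rfl fun l _ => by ring

theorem christoffelForm_symm (g : Metric n M) (φ : OpenPartialHomeomorph M (E n)) (y u v : E n) :
    christoffelForm g φ y u v = christoffelForm g φ y v u := by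
  simp only [christoffelForm, sum_apply, smul_apply, ContinuousLinearMap.smulRight_apply,
    coordCLM_apply]
  rw [Finset.sum_comm]
  refine Finset.sum_congr rfl fun i _ => Finset.sum_congr rfl fun j _ =>
    Finset.sum_congr rfl fun k _ => ?_
  rw [christoffel_symm]
  module

theorem pd_gLow (g : Metric n M) {φ : OpenPartialHomeomorph M (E n)} (hφ : IsChart φ) {y : E n}
    (hy : y ∈ φ.target) (k i j : Fin n) : pd k (fun z => gLow g φ z i j) y =
      fderiv ℝ (metricForm g φ) y (e k) (e i) (e j) := by
  rw [← fderiv_apply_apply ((contDiffAt_metricForm g hφ hy).differentiableAt (by simp)), pd]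
  simp only [metricForm_e]

section Trilinear

variable {V W : Type*} [NormedAddCommGroup V] [NormedSpace ℝ V] [NormedAddCommGroup W]
  [NormedSpace ℝ W]

theorem clm_add_apply (A : V →L[ℝ] V →L[ℝ] W) (a b v : V) : A (a + b) v = A a v + A b v := by
  rw [map_add, add_apply]

theorem clm_smul_apply (A : V →L[ℝ] V →L[ℝ] W) (t : ℝ) (a v : V) : A (t • a) v = t • A a v := by
  rw [map_smul, smul_apply]

/-- `hf` is the induction principle expressing that the `f i` span; a trilinear identity then needs
checking on them only. -/
theorem trilinear_ext {ι : Type*} {f : ι → V}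
    (hf : ∀ p : V → Prop, p 0 → (∀ v w, p v → p w → p (v + w)) →
      (∀ (a : ℝ) v, p v → p (a • v)) → (∀ i, p (f i)) → ∀ v, p v)
    {T : V → V → V → ℝ} (add₁ : ∀ a b v w, T (a + b) v w = T a v w + T b v w)
    (add₂ : ∀ u a b w, T u (a + b) w = T u a w + T u b w)
    (add₃ : ∀ u v a b, T u v (a + b) = T u v a + T u v b)
    (smul₁ : ∀ (t : ℝ) a v w, T (t • a) v w = t * T a v w)
    (smul₂ : ∀ (t : ℝ) u a w, T u (t • a) w = t * T u a w)
    (smul₃ : ∀ (t : ℝ) u v a, T u v (t • a) = t * T u v a)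
    (h : ∀ i j k, T (f i) (f j) (f k) = 0) (u v w : V) : T u v w = 0 := by
  refine hf (fun u => T u v w = 0) ?_ (fun a b ha hb => ?_) (fun t a ha => ?_) (fun i => ?_) u
  · simpa using smul₁ 0 0 v w
  · simp only [add₁, ha, hb, add_zero]
  · simp only [smul₁, ha, mul_zero]
  refine hf (fun v => T (f i) v w = 0) ?_ (fun a b ha hb => ?_) (fun t a ha => ?_) (fun j => ?_) v
  · simpa using smul₂ 0 (f i) 0 w
  · simp only [add₂, ha, hb, add_zero]
  · simp only [smul₂, ha, mul_zero]
  refine hf (fun w => T (f i) (f j) w = 0) ?_ (fun a b ha hb => ?_) (fun t a ha => ?_) (h i j) w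
  · simpa using smul₃ 0 (f i) (f j) 0
  · simp only [add₃, ha, hb, add_zero]
  · simp only [smul₃, ha, mul_zero]

theorem koszul_ext {ι : Type*} {f : ι → V}
    (hf : ∀ p : V → Prop, p 0 → (∀ v w, p v → p w → p (v + w)) →
      (∀ (a : ℝ) v, p v → p (a • v)) → (∀ i, p (f i)) → ∀ v, p v)
    {D : V →L[ℝ] V →L[ℝ] V →L[ℝ] ℝ} {b : V →L[ℝ] V →L[ℝ] ℝ}
    {G : V →L[ℝ] V →L[ℝ] V} (h : ∀ i j k, 2 * b (G (f i) (f j)) (f k) =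
      D (f i) (f j) (f k) + D (f j) (f i) (f k) - D (f k) (f i) (f j)) (u v w : V) :
    2 * b (G u v) w = D u v w + D v u w - D w u v := by
  have key := trilinear_ext hf (T := fun u v w => 2 * b (G u v) w - (D u v w + D v u w - D w u v))
    (fun a b v w => by
      simp only [clm_add_apply, (D _).map_add, add_apply]; ring)
    (fun u a b w => by
      simp only [clm_add_apply, (D _).map_add, (D _ _).map_add,
        (G _).map_add, add_apply]; ring)
    (fun u v a c => by
      simp only [clm_add_apply, add_apply, (D _ _).map_add, (b _).map_add]; ring)
    (fun t a v w => by
      simp only [clm_smul_apply, (D _).map_smul, smul_apply, smul_eq_mul]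
      ring)
    (fun t u a w => by
      simp only [clm_smul_apply, (D _).map_smul, (D _ _).map_smul,
        (G _).map_smul, smul_apply, smul_eq_mul]
      ring)
    (fun t u v a => by
      simp only [clm_smul_apply, smul_apply, (D _ _).map_smul, (b _).map_smul, smul_eq_mul]; ring)
    (fun i j k => sub_eq_zero.2 (h i j k)) u v w
  exact sub_eq_zero.1 key

end Trilinear

/-- On basis vectors this is the definition of the Christoffel symbols with the upper index lowered.
It connects the index formulas with the abstract results on Christoffel and curvature forms. -/
theorem koszul_metricForm (g : Metric n M) {φ : OpenPartialHomeomorph M (E n)} (hφ : IsChart φ)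
    {y : E n} (hy : y ∈ φ.target) : Koszul (metricForm g φ) (christoffelForm g φ) y := by
  have hbase : ∀ i j m, 2 * metricForm g φ y (christoffelForm g φ y (e i) (e j)) (e m) =
      fderiv ℝ (metricForm g φ) y (e i) (e j) (e m) +
        fderiv ℝ (metricForm g φ) y (e j) (e i) (e m) -
        fderiv ℝ (metricForm g φ) y (e m) (e i) (e j) := by
    intro i j m
    simp only [← pd_gLow g hφ hy]
    rw [metricForm_apply]
    simp only [e_apply, christoffelForm_e, mul_ite, mul_one, mul_zero, Finset.sum_ite_eq',
      Finset.mem_univ, if_true, christoffel]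
    simp only [Finset.mul_sum]
    rw [Finset.sum_comm]
    have h1 : ∀ l, ∑ k, gLow g φ y k m * gUp g φ y k l = if m = l then 1 else 0 := by
      intro l
      have := congrFun (congrFun (gLow_mul_gUp g hφ hy) m) l
      rw [Matrix.mul_apply, Matrix.one_apply] at this
      rw [← this]
      exact Finset.sum_congr rfl fun k _ => by rw [gLow_symm]
    have h2 : ∀ l (D : ℝ), ∑ k, 2 * (gLow g φ y k m * (1 / 2 * (gUp g φ y k l * D))) =
        (if m = l then 1 else 0) * D := by
      intro l D
      rw [← h1, Finset.sum_mul]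
      exact Finset.sum_congr rfl fun k _ => by ring
    rw [Finset.sum_congr rfl fun l _ => h2 l _]
    simp
  exact koszul_ext (fun _ => E_induction) hbase

theorem fderiv_metricForm (g : Metric n M) {φ : OpenPartialHomeomorph M (E n)} (hφ : IsChart φ)
    {y : E n} (hy : y ∈ φ.target) (u v w : E n) : fderiv ℝ (metricForm g φ) y u v w =
      metricForm g φ y (christoffelForm g φ y u v) w +
        metricForm g φ y v (christoffelForm g φ y u w) :=
  (koszul_metricForm g hφ hy).fderiv_metric
    ((contDiffAt_metricForm g hφ hy).differentiableAt (by simp))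
    (Filter.Eventually.of_forall fun z => metricForm_symm g φ z) u v w

theorem eventually_mem_target_and_source {φ ψ : OpenPartialHomeomorph M (E n)} {x : M}
    (hx : x ∈ φ.source) (hx' : x ∈ ψ.source) :
    ∀ᶠ z in 𝓝 (φ x), z ∈ φ.target ∧ φ.symm z ∈ ψ.source := by
  have h := φ.symm.continuousAt (φ.map_source hx)
  rw [ContinuousAt, φ.left_inv hx] at h
  exact Filter.inter_mem (φ.open_target.mem_nhds (φ.map_source hx)) (h (ψ.open_source.mem_nhds hx'))

/-- Both sides are the metric of M at the same point on the same tangent vectors, expanded in the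
coordinate fields of the two charts. -/
theorem metricForm_change (g : Metric n M) {φ ψ : OpenPartialHomeomorph M (E n)} (hφ : IsChart φ)
    (hψ : IsChart ψ) {y : E n} (hy : y ∈ φ.target) (hy' : φ.symm y ∈ ψ.source) (v w : E n) :
    metricForm g φ y v w = metricForm g ψ (chartChange φ ψ y)
      (fderiv ℝ (chartChange φ ψ) y v) (fderiv ℝ (chartChange φ ψ) y w) := by
  have h0 : ψ.symm (chartChange φ ψ y) = φ.symm y := ψ.left_inv hy'
  have h1 : ∀ v : E n, ∑ i, v i • coordVec φ i (φ.symm y) =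
      ∑ a, (fderiv ℝ (chartChange φ ψ) y v) a • coordVec ψ a (φ.symm y) := by
    intro v
    have h2 : ∀ a, (fderiv ℝ (chartChange φ ψ) y v) a =
        ∑ i, v i * jac φ ψ (φ.symm y) a i := by
      intro a
      conv_lhs => rw [← sum_smul_e v]
      simp only [map_sum, map_smul, WithLp.ofLp_sum, Finset.sum_apply, PiLp.smul_apply,
        smul_eq_mul, jac, φ.right_inv hy]
      rfl
    simp only [coordVec_eq_sum hφ hψ (φ.map_target hy) hy', h2, Finset.smul_sum, Finset.sum_smul,
      smul_smul]
    exact Finset.sum_comm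
  rw [metricForm_eq_inner, metricForm_eq_inner, h1, h1, h0]

theorem surjective_fderiv_chartChange {φ ψ : OpenPartialHomeomorph M (E n)} (hφ : IsChart φ)
    (hψ : IsChart ψ) {x : M} (hx : x ∈ φ.source) (hx' : x ∈ ψ.source) :
    Function.Surjective (fderiv ℝ (chartChange φ ψ) (φ x)) :=
  fun v => ⟨_, chartChange_fderiv_comp hψ hφ hx' hx v⟩

theorem christoffelForm_change (g : Metric n M) {φ ψ : OpenPartialHomeomorph M (E n)}
    (hφ : IsChart φ) (hψ : IsChart ψ) {x : M} (hx : x ∈ φ.source) (hx' : x ∈ ψ.source)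
    (u v : E n) :
    fderiv ℝ (chartChange φ ψ) (φ x) (christoffelForm g φ (φ x) u v) =
      fderiv ℝ (fderiv ℝ (chartChange φ ψ)) (φ x) u v + christoffelForm g ψ (ψ x)
        (fderiv ℝ (chartChange φ ψ) (φ x) u) (fderiv ℝ (chartChange φ ψ) (φ x) v) := by
  have hx2 : chartChange φ ψ (φ x) = ψ x := by rw [chartChange, φ.left_inv hx]
  have hψx := ψ.map_source hx'
  have h := Koszul.christoffel_change (F := chartChange φ ψ)
    (koszul_metricForm g hφ (φ.map_source hx)) (hx2 ▸ koszul_metricForm g hψ hψx)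
    ((contDiffAt_metricForm g hφ (φ.map_source hx)).differentiableAt (by simp))
    (hx2 ▸ (contDiffAt_metricForm g hψ hψx).differentiableAt (by simp))
    ((contDiffAt_chartChange hφ hψ (φ.map_source hx) (by rwa [φ.left_inv hx])).of_le (by norm_cast))
    (metricForm_symm g ψ _) (hx2 ▸ metricForm_pos g hψ hψx)
    (surjective_fderiv_chartChange hφ hψ hx hx')
    ((eventually_mem_target_and_source hx hx').mono fun z hz =>
      metricForm_change g hφ hψ hz.1 hz.2) u v
  rwa [hx2] at h

theorem curvatureForm_chartChange (g : Metric n M) {φ ψ : OpenPartialHomeomorph M (E n)}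
    (hφ : IsChart φ) (hψ : IsChart ψ) {x : M} (hx : x ∈ φ.source) (hx' : x ∈ ψ.source)
    (u v w : E n) :
    fderiv ℝ (chartChange φ ψ) (φ x) (curvatureForm (christoffelForm g φ) (φ x) u v w) =
      curvatureForm (christoffelForm g ψ) (ψ x) (fderiv ℝ (chartChange φ ψ) (φ x) u)
        (fderiv ℝ (chartChange φ ψ) (φ x) v) (fderiv ℝ (chartChange φ ψ) (φ x) w) := by
  have hx2 : chartChange φ ψ (φ x) = ψ x := by rw [chartChange, φ.left_inv hx]
  have h := curvatureForm_change (F := chartChange φ ψ)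
    ((contDiffAt_christoffelForm g hφ (φ.map_source hx)).differentiableAt (by simp))
    (hx2 ▸ (contDiffAt_christoffelForm g hψ (ψ.map_source hx')).differentiableAt (by simp))
    ((contDiffAt_chartChange hφ hψ (φ.map_source hx) (by rwa [φ.left_inv hx])).of_le (by norm_cast))
    (by
      filter_upwards [eventually_mem_target_and_source hx hx'] with z hz u v
      have h1 := christoffelForm_change g hφ hψ (φ.map_target hz.1) hz.2 u v
      rwa [φ.right_inv hz.1] at h1) u v w
  rwa [hx2] at h

theorem curvature_eq (g : Metric n M) {φ : OpenPartialHomeomorph M (E n)} (hφ : IsChart φ)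
    {y : E n} (hy : y ∈ φ.target) (h k i j : Fin n) : curvature g φ h k i j y =
      curvatureForm (christoffelForm g φ) y (e i) (e j) (e k) h := by
  have hd := (contDiffAt_christoffelForm g hφ hy).differentiableAt (by simp)
  have h1 : ∀ i j k, pd i (christoffel g φ h j k) y =
      fderiv ℝ (christoffelForm g φ) y (e i) (e j) (e k) h := by
    intro i j k
    have h2 : christoffel g φ h j k = fun z => coordCLM h (christoffelForm g φ z (e j) (e k)) := by
      ext z
      exact (christoffelForm_e g φ z j k h).symm
    have h3 := (coordCLM h).hasFDerivAt.comp y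
      ((hd.hasFDerivAt.clm_apply (hasFDerivAt_const (e j : E n) y)).clm_apply
        (hasFDerivAt_const (e k : E n) y))
    rw [pd, h2]
    erw [h3.fderiv]
    simp
  have h4 : ∀ i j k, christoffelForm g φ y (e i) (christoffelForm g φ y (e j) (e k)) h =
      ∑ l, christoffel g φ h i l y * christoffel g φ l j k y := by
    intro i j k
    conv_lhs => rw [← sum_smul_e (christoffelForm g φ y (e j) (e k))]
    simp [christoffelForm_e, mul_comm]
  simp only [curvature, curvatureForm, h1, PiLp.add_apply, PiLp.sub_apply, h4,
    Finset.sum_sub_distrib]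
  ring

/-! ### Spaces of constant curvature -/

section CurvatureForm

variable {V : Type*} [NormedAddCommGroup V] [NormedSpace ℝ V]

theorem curvatureForm_add_left (Γ : V → V →L[ℝ] V →L[ℝ] V) (y a b v w : V) :
    curvatureForm Γ y (a + b) v w = curvatureForm Γ y a v w + curvatureForm Γ y b v w := by
  simp only [curvatureForm, clm_add_apply, (fderiv ℝ Γ y _).map_add, (Γ y _).map_add, add_apply]
  abel

theorem curvatureForm_add_right (Γ : V → V →L[ℝ] V →L[ℝ] V) (y u v a b : V) :
    curvatureForm Γ y u v (a + b) = curvatureForm Γ y u v a + curvatureForm Γ y u v b := by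
  simp only [curvatureForm, (fderiv ℝ Γ y _ _).map_add, (Γ y _).map_add]
  abel

theorem curvatureForm_add_middle (Γ : V → V →L[ℝ] V →L[ℝ] V) (y u a b w : V) :
    curvatureForm Γ y u (a + b) w = curvatureForm Γ y u a w + curvatureForm Γ y u b w := by
  rw [curvatureForm_swap, curvatureForm_add_left, curvatureForm_swap Γ y u a,
    curvatureForm_swap Γ y u b]
  abel

theorem curvatureForm_smul_left (Γ : V → V →L[ℝ] V →L[ℝ] V) (y : V) (t : ℝ) (a v w : V) :
    curvatureForm Γ y (t • a) v w = t • curvatureForm Γ y a v w := by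
  simp only [curvatureForm, clm_smul_apply, (fderiv ℝ Γ y _).map_smul, (Γ y _).map_smul, smul_apply]
  module

theorem curvatureForm_smul_right (Γ : V → V →L[ℝ] V →L[ℝ] V) (y : V) (t : ℝ) (u v a : V) :
    curvatureForm Γ y u v (t • a) = t • curvatureForm Γ y u v a := by
  simp only [curvatureForm, (fderiv ℝ Γ y _ _).map_smul, (Γ y _).map_smul]
  module

theorem curvatureForm_smul_middle (Γ : V → V →L[ℝ] V →L[ℝ] V) (y : V) (t : ℝ) (u a w : V) :
    curvatureForm Γ y u (t • a) w = t • curvatureForm Γ y u a w := by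
  rw [curvatureForm_swap, curvatureForm_smul_left, curvatureForm_swap Γ y u a, smul_neg]

end CurvatureForm

theorem curvatureForm_apply (g : Metric n M) {φ : OpenPartialHomeomorph M (E n)} (hφ : IsChart φ)
    {y : E n} (hy : y ∈ φ.target) (h : Fin n) (u v w : E n) :
    curvatureForm (christoffelForm g φ) y u v w h =
      ∑ k, ∑ i, ∑ j, curvature g φ h k i j y * w k * u i * v j := by
  have key := trilinear_ext (fun _ => E_induction (n := n))
    (T := fun u v w => curvatureForm (christoffelForm g φ) y u v w h -
      ∑ k, ∑ i, ∑ j, curvature g φ h k i j y * w k * u i * v j)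
    (fun a b v w => by
      simp only [curvatureForm_add_left, PiLp.add_apply, mul_add, add_mul, Finset.sum_add_distrib]
      ring)
    (fun u a b w => by
      simp only [curvatureForm_add_middle, PiLp.add_apply, mul_add, Finset.sum_add_distrib]
      ring)
    (fun u v a b => by
      simp only [curvatureForm_add_right, PiLp.add_apply, mul_add, add_mul, Finset.sum_add_distrib]
      ring)
    (fun t a v w => by
      simp only [curvatureForm_smul_left, PiLp.smul_apply, smul_eq_mul, mul_sub, Finset.mul_sum]
      exact congrArg (_ - ·) (Finset.sum_congr rfl fun k _ => Finset.sum_congr rfl fun i _ =>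
        Finset.sum_congr rfl fun j _ => by ring))
    (fun t u a w => by
      simp only [curvatureForm_smul_middle, PiLp.smul_apply, smul_eq_mul, mul_sub, Finset.mul_sum]
      exact congrArg (_ - ·) (Finset.sum_congr rfl fun k _ => Finset.sum_congr rfl fun i _ =>
        Finset.sum_congr rfl fun j _ => by ring))
    (fun t u v a => by
      simp only [curvatureForm_smul_right, PiLp.smul_apply, smul_eq_mul, mul_sub, Finset.mul_sum]
      exact congrArg (_ - ·) (Finset.sum_congr rfl fun k _ => Finset.sum_congr rfl fun i _ =>
        Finset.sum_congr rfl fun j _ => by ring))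
    (fun i j k => by
      rw [← curvature_eq g hφ hy]
      simp [e_apply]) u v w
  exact sub_eq_zero.1 key

theorem eventually_mem_target {φ : OpenPartialHomeomorph M (E n)} {y : E n} (hy : y ∈ φ.target) :
    ∀ᶠ z in 𝓝 y, z ∈ φ.target :=
  φ.open_target.mem_nhds hy

theorem ip_eq (g : Metric n M) (φ : OpenPartialHomeomorph M (E n)) (y v w : E n) :
    ip g φ y v w = metricForm g φ y v w :=
  (metricForm_apply g φ y v w).symm

theorem curvatureForm_sectional (g : Metric n M) {c : ℝ} (hg : HasConstantSectionalCurvature g c)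
    {φ : OpenPartialHomeomorph M (E n)} (hφ : IsChart φ) {y : E n} (hy : y ∈ φ.target) (u v : E n) :
    metricForm g φ y (curvatureForm (christoffelForm g φ) y u v v) u =
      c * (metricForm g φ y u u * metricForm g φ y v v - metricForm g φ y u v ^ 2) := by
  set R := curvatureForm (christoffelForm g φ) y with hR
  set B := metricForm g φ y with hB
  have hskew : ∀ a u v w, B (R a u v) w + B v (R a u w) = 0 := fun a u v w =>
    curvatureForm_skew ((contDiffAt_christoffelForm g hφ hy).differentiableAt (by simp))
      ((contDiffAt_metricForm g hφ hy).of_le (by norm_cast))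
      ((eventually_mem_target hy).mono fun z hz =>
        fderiv_metricForm g hφ hz) a u v w
  have hBs : ∀ v w, B v w = B w v := metricForm_symm g φ y
  by_cases hli : LinearIndependent ℝ ![u, v]
  -- `B v v` times the Gram determinant is the squared length of `B v v • u - B u v • v`, a nonzero
  -- vector orthogonal to `v`.
  · have hne : B u u * B v v - B u v ^ 2 ≠ 0 := by
      have hv : v ≠ 0 := hli.ne_zero 1
      have hvv := metricForm_pos g hφ hy v hv
      have hw : B v v • u - B u v • v ≠ 0 := by
        intro h0
        have := LinearIndependent.pair_iff.1 hli (B v v) (-(B u v)) (by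
          rw [neg_smul, ← sub_eq_add_neg, h0])
        exact hvv.ne' this.1
      have h1 := metricForm_pos g hφ hy _ hw
      have h2 : B (B v v • u - B u v • v) (B v v • u - B u v • v) =
          B v v * (B u u * B v v - B u v ^ 2) := by
        simp only [B.map_sub, B.map_smul, sub_apply, smul_apply, (B _).map_sub, (B _).map_smul,
          smul_eq_mul, hBs v u]
        ring
      rw [← hB, h2] at h1
      exact (pos_of_mul_pos_right h1 hvv.le).ne'
    have hli' : LinearIndependent ℝ ![(u : Fin n → ℝ), (v : Fin n → ℝ)] := by
      rw [LinearIndependent.pair_iff] at hli ⊢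
      intro s t hst
      refine hli s t ?_
      ext i
      exact congrFun hst i
    have h1 := hg φ hφ y hy u v hli'
    rw [sectionalCurvature, ip_eq, ip_eq, ip_eq] at h1
    have h2 : (fun h => ∑ k, ∑ i, ∑ j, curvature g φ h k i j y * v k * u i * v j) =
        (R u v v : Fin n → ℝ) := by
      ext h
      exact (curvatureForm_apply g hφ hy h u v v).symm
    rw [h2, ip_eq, div_eq_iff hne] at h1
    exact h1
  -- Dependent vectors are multiples of a single one, and then both sides vanish, the curvature by
  -- its antisymmetry.
  · have hzero : ∀ s t : ℝ, ∀ z : E n, B (R (s • z) (t • z) (t • z)) (s • z) =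
        c * (B (s • z) (s • z) * B (t • z) (t • z) - B (s • z) (t • z) ^ 2) := by
      intro s t z
      have h3 : R z z = 0 := by
        ext w : 1
        have := curvatureForm_swap (christoffelForm g φ) y z z w
        ext i
        have h4 := congrArg (fun x : E n => x i) this
        exact self_eq_neg.1 h4
      have h4 : R (s • z) (t • z) (t • z) = 0 := by
        rw [hR, curvatureForm_smul_left, curvatureForm_smul_middle, ← hR, h3]
        simp
      rw [h4, map_zero]
      simp only [B.map_smul, smul_apply, (B _).map_smul, smul_eq_mul, zero_apply]
      ring
    rw [LinearIndependent.pair_iff] at hli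
    push Not at hli
    obtain ⟨s, t, hst, hne⟩ := hli
    by_cases hs : s = 0
    · have ht : t ≠ 0 := hne hs
      have hv : v = 0 := by
        rw [hs, zero_smul, zero_add] at hst
        exact (smul_eq_zero.1 hst).resolve_left ht
      simpa [hv] using hzero 1 0 u
    · have hu : u = (-(t / s)) • v := by
        have h5 : s • u = -(t • v) := eq_neg_of_add_eq_zero_left hst
        rw [neg_smul, div_eq_inv_mul, mul_smul, ← smul_neg, ← h5, inv_smul_smul₀ hs]
      have := hzero (-(t / s)) 1 v
      rwa [one_smul, ← hu] at this

/-- The curvature tensor of a space of constant sectional curvature. -/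
theorem curvatureForm_of_constant (g : Metric n M) {c : ℝ}
    (hg : HasConstantSectionalCurvature g c) {φ : OpenPartialHomeomorph M (E n)} (hφ : IsChart φ)
    {y : E n} (hy : y ∈ φ.target) (u v w : E n) :
    curvatureForm (christoffelForm g φ) y u v w =
      c • (metricForm g φ y v w • u - metricForm g φ y u w • v) := by
  have hsec := curvatureForm_sectional g hg hφ hy
  have hd := (contDiffAt_christoffelForm g hφ hy).differentiableAt (by simp)
  set R := curvatureForm (christoffelForm g φ) y with hR
  set B := metricForm g φ y with hB
  have hskew : ∀ a u v w, B (R a u v) w + B v (R a u w) = 0 := fun a u v w =>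
    curvatureForm_skew hd ((contDiffAt_metricForm g hφ hy).of_le (by norm_cast))
      ((eventually_mem_target hy).mono fun z hz =>
        fderiv_metricForm g hφ hz) a u v w
  have hBs : ∀ v w, B v w = B w v := metricForm_symm g φ y
  -- The difference from the model curvature keeps the algebraic symmetries and has vanishing
  -- sectional curvatures.
  have key := eq_zero_of_sectional_eq_zero
    (T := fun u v z w => B (R u v z) w - c * (B v z * B u w - B u z * B v w))
    (fun a b v z w => by
      simp only [hR, curvatureForm_add_left, B.map_add, add_apply]
      ring)
    (fun u v z w => by
      simp only [hR, curvatureForm_swap _ y u v, B.map_neg, neg_apply]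
      ring)
    (fun u v z w => by
      have h1 := hskew u v z w
      rw [hBs z] at h1
      linear_combination h1)
    (fun u v z w => by
      have h1 := congrArg (fun x => B x w) (curvatureForm_bianchi hd
        (Filter.Eventually.of_forall fun z => christoffelForm_symm g φ z) u v z)
      simp only [B.map_add, add_apply, B.map_zero, zero_apply] at h1
      rw [hBs z u, hBs z v, hBs v u]
      linear_combination h1)
    (fun u v => by
      rw [hsec, hBs v u]
      ring)
  by_contra hne
  have hx := sub_ne_zero.2 hne
  have h1 := metricForm_pos g hφ hy _ hx
  set x := R u v w - c • (B v w • u - B u w • v) with hxdef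
  refine h1.ne' ?_
  have h2 := key u v w x
  rw [← hB]
  nth_rewrite 1 [hxdef]
  simp only [B.map_sub, B.map_smul, sub_apply, smul_apply, smul_eq_mul]
  linear_combination h2

theorem curvatureZero_of_constant (g : Metric n M) {c : ℝ}
    (hg : HasConstantSectionalCurvature g c) {φ : OpenPartialHomeomorph M (E n)} (hφ : IsChart φ)
    {y : E n} (hy : y ∈ φ.target) (p : E n) (k i j : Fin n) :
    curvatureZero g φ k i j y p = c * (p i * gLow g φ y k j - p j * gLow g φ y k i) := by
  simp only [curvatureZero, curvature_eq g hφ hy, curvatureForm_of_constant g hg hφ hy,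
    metricForm_e, PiLp.smul_apply, PiLp.sub_apply, e_apply, smul_eq_mul]
  simp only [mul_sub, Finset.sum_sub_distrib]
  simp [gLow_symm g φ y _ k]
  ring

/-! ### Change of charts -/

section TensorAction

variable {ι : Type*} [Fintype ι]

/-- The action of the matrices `A`, `B` on a tensor with two indices. -/
def act₂ (A B X : Matrix ι ι ℝ) (a b : ι) : ℝ :=
  ∑ i, ∑ j, A a i * B b j * X i j

/-- The action of the matrices `A`, `B`, `C` on a tensor with three indices. -/
def act₃ (A B C : Matrix ι ι ℝ) (X : ι → ι → ι → ℝ) (a b c : ι) : ℝ :=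
  ∑ i, ∑ j, ∑ k, A a i * B b j * C c k * X i j k

theorem act₂_eq (A B X : Matrix ι ι ℝ) (a b : ι) :
    act₂ A B X a b = (A * X * B.transpose) a b := by
  simp only [act₂, Matrix.mul_apply, Matrix.transpose_apply, Finset.sum_mul]
  rw [Finset.sum_comm]
  exact Finset.sum_congr rfl fun i _ => Finset.sum_congr rfl fun j _ => by ring

theorem act₃_swap₁₂ (A B C : Matrix ι ι ℝ) (X : ι → ι → ι → ℝ) (a b c : ι) :
    act₃ A B C X a b c = act₃ B A C (fun i j k => X j i k) b a c := by
  simp only [act₃]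
  rw [Finset.sum_comm]
  exact Finset.sum_congr rfl fun i _ => Finset.sum_congr rfl fun j _ =>
    Finset.sum_congr rfl fun k _ => by ring

theorem act₃_swap₂₃ (A B C : Matrix ι ι ℝ) (X : ι → ι → ι → ℝ) (a b c : ι) :
    act₃ A B C X a b c = act₃ A C B (fun i j k => X i k j) a c b := by
  simp only [act₃]
  refine Finset.sum_congr rfl fun i _ => ?_
  rw [Finset.sum_comm]
  exact Finset.sum_congr rfl fun j _ => Finset.sum_congr rfl fun k _ => by ring

theorem act₃_add (A B C : Matrix ι ι ℝ) (X Y : ι → ι → ι → ℝ) (a b c : ι) :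
    act₃ A B C X a b c + act₃ A B C Y a b c = act₃ A B C (fun i j k => X i j k + Y i j k) a b c := by
  simp only [act₃, ← Finset.sum_add_distrib, mul_add]

theorem act₃_smul (A B C : Matrix ι ι ℝ) (t : ℝ) (X : ι → ι → ι → ℝ) (a b c : ι) :
    t * act₃ A B C X a b c = act₃ A B C (fun i j k => t * X i j k) a b c := by
  simp only [act₃, Finset.mul_sum]
  exact Finset.sum_congr rfl fun i _ => Finset.sum_congr rfl fun j _ =>
    Finset.sum_congr rfl fun k _ => by ring

theorem act₃_sub (A B C : Matrix ι ι ℝ) (X Y : ι → ι → ι → ℝ) (a b c : ι) :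
    act₃ A B C X a b c - act₃ A B C Y a b c = act₃ A B C (fun i j k => X i j k - Y i j k) a b c := by
  simp only [act₃, ← Finset.sum_sub_distrib, mul_sub]

/-- `N` and `N'` act contragrediently on the two copies of the contracted index. -/
theorem sum_contract [DecidableEq ι] {N N' : Matrix ι ι ℝ} (h : N.transpose * N' = 1)
    (x y : ι → ℝ) : ∑ c, (∑ k, N c k * x k) * (∑ l, N' c l * y l) = ∑ k, x k * y k := by
  have h1 : ∀ k l, ∑ c, N c k * N' c l = if k = l then 1 else 0 := fun k l => by
    rw [← Matrix.one_apply, ← h, Matrix.mul_apply]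
    rfl
  simp only [Finset.sum_mul_sum]
  rw [Finset.sum_comm]
  refine Finset.sum_congr rfl fun k _ => ?_
  rw [Finset.sum_comm]
  have h2 : ∀ l, ∑ c, N c k * x k * (N' c l * y l) = (if k = l then 1 else 0) * (x k * y l) := by
    intro l
    rw [← h1, Finset.sum_mul]
    exact Finset.sum_congr rfl fun c _ => by ring
  simp [h2]

/-- The actions on the two sides of a contracted index cancel. -/
theorem act₂_contract_act₃ [DecidableEq ι] {N N' : Matrix ι ι ℝ} (h : N.transpose * N' = 1)
    (A B C H : Matrix ι ι ℝ) (X : ι → ι → ι → ℝ) (a b d : ι) :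
    ∑ c, act₂ A N H a c * act₃ N' B C X c b d =
      act₃ A B C (fun i j k => ∑ m, H i m * X m j k) a b d := by
  have h1 : ∀ c, act₂ A N H a c = ∑ m, N c m * ∑ i, A a i * H i m := fun c => by
    simp only [act₂, Finset.mul_sum]
    rw [Finset.sum_comm]
    exact Finset.sum_congr rfl fun i _ => Finset.sum_congr rfl fun j _ => by ring
  have h2 : ∀ c, act₃ N' B C X c b d = ∑ m, N' c m * ∑ j, ∑ k, B b j * C d k * X m j k := by
    intro c
    simp only [act₃, Finset.mul_sum]
    exact Finset.sum_congr rfl fun i _ => Finset.sum_congr rfl fun j _ =>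
      Finset.sum_congr rfl fun k _ => by ring
  simp only [h1, h2]
  rw [sum_contract h]
  simp only [act₃, Finset.sum_mul]
  rw [Finset.sum_comm]
  refine Finset.sum_congr rfl fun i _ => ?_
  simp only [Finset.mul_sum]
  rw [Finset.sum_comm]
  refine Finset.sum_congr rfl fun j _ => ?_
  rw [Finset.sum_comm]
  exact Finset.sum_congr rfl fun k _ => Finset.sum_congr rfl fun m _ => by ring

end TensorAction

theorem jac_eq (φ ψ : OpenPartialHomeomorph M (E n)) (x : M) (a i : Fin n) :
    jac φ ψ x a i = fderiv ℝ (chartChange φ ψ) (φ x) (e i) a := rfl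

theorem jac_mul_jac {φ ψ : OpenPartialHomeomorph M (E n)} (hφ : IsChart φ)
    (hψ : IsChart ψ) {x : M} (hx : x ∈ φ.source) (hx' : x ∈ ψ.source) :
    Matrix.of (jac ψ φ x) * Matrix.of (jac φ ψ x) = 1 := by
  ext i j
  have h := congrArg (fun v : E n => v i) (chartChange_fderiv_comp hφ hψ hx hx' (e j))
  rw [← sum_smul_e (fderiv ℝ (chartChange φ ψ) (φ x) (e j))] at h
  simp only [map_sum, map_smul, WithLp.ofLp_sum, Finset.sum_apply, PiLp.smul_apply,
    smul_eq_mul, e_apply] at h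
  rw [Matrix.mul_apply, Matrix.one_apply, ← h]
  exact Finset.sum_congr rfl fun a _ => mul_comm _ _

theorem fderiv_chartChange_apply (φ ψ : OpenPartialHomeomorph M (E n)) (x : M) (v : E n)
    (a : Fin n) : fderiv ℝ (chartChange φ ψ) (φ x) v a = ∑ i, jac φ ψ x a i * v i := by
  conv_lhs => rw [← sum_smul_e v]
  simp only [map_sum, map_smul, WithLp.ofLp_sum, Finset.sum_apply, PiLp.smul_apply, smul_eq_mul]
  exact Finset.sum_congr rfl fun i _ => mul_comm _ _

theorem gLow_change (g : Metric n M) {φ ψ : OpenPartialHomeomorph M (E n)} (hφ : IsChart φ)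
    (hψ : IsChart ψ) {x : M} (hx : x ∈ φ.source) (hx' : x ∈ ψ.source) :
    gLow g φ (φ x) = (Matrix.of (jac φ ψ x)).transpose * gLow g ψ (ψ x) *
      Matrix.of (jac φ ψ x) := by
  ext i j
  have h := metricForm_change g hφ hψ (φ.map_source hx) (by rwa [φ.left_inv hx]) (e i) (e j)
  rw [metricForm_e, metricForm_apply] at h
  rw [h]
  have hx2 : chartChange φ ψ (φ x) = ψ x := by rw [chartChange, φ.left_inv hx]
  simp only [Matrix.mul_apply, Finset.sum_mul, hx2]
  rw [Finset.sum_comm]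
  refine Finset.sum_congr rfl fun a _ => Finset.sum_congr rfl fun b _ => ?_
  simp only [Matrix.transpose_apply, Matrix.of_apply, jac]
  exact congrArg (· * _) (mul_comm _ _)

/-- The components `∑ₐ (∂ψᵃ/∂φⁱ) rₐ` in the chart `φ` of the covector with components `r` in the
chart `ψ`. -/
def coPull (φ ψ : OpenPartialHomeomorph M (E n)) (x : M) : E n →L[ℝ] E n :=
  (EuclideanSpace.equiv (Fin n) ℝ).symm.toContinuousLinearMap.comp
    (ContinuousLinearMap.pi fun i => ∑ a, jac φ ψ x a i • coordCLM a)

theorem coPull_apply (φ ψ : OpenPartialHomeomorph M (E n)) (x : M) (r : E n) (i : Fin n) :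
    coPull φ ψ x r i = ∑ a, jac φ ψ x a i * r a := by
  simp [coPull]

theorem coPull_indChart {φ ψ : OpenPartialHomeomorph M (E n)} (hφ : IsChart φ)
    (hψ : IsChart ψ) {u : TStar n M} (hu : u.1 ∈ φ.source) (hu' : u.1 ∈ ψ.source) :
    coPull φ ψ u.1 (indChart ψ u).2 = (indChart φ u).2 := by
  ext i
  rw [coPull_apply, indChart_snd_eq_sum hφ hψ hu hu']

theorem eq_inv_conj {ι : Type*} [Fintype ι] [DecidableEq ι] {A B J K : Matrix ι ι ℝ}
    (hJK : J * K = 1) (h : B = K.transpose * A * K) : B⁻¹ = J * A⁻¹ * J.transpose := by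
  have hK : K⁻¹ = J := Matrix.inv_eq_left_inv hJK
  rw [h, Matrix.mul_inv_rev, Matrix.mul_inv_rev, ← Matrix.transpose_nonsing_inv, hK,
    Matrix.mul_assoc]

theorem gUp_change (g : Metric n M) {φ ψ : OpenPartialHomeomorph M (E n)} (hφ : IsChart φ)
    (hψ : IsChart ψ) {x : M} (hx : x ∈ φ.source) (hx' : x ∈ ψ.source) :
    gUp g ψ (ψ x) = Matrix.of (jac φ ψ x) * gUp g φ (φ x) * (Matrix.of (jac φ ψ x)).transpose :=
  eq_inv_conj (jac_mul_jac hψ hφ hx' hx) (gLow_change g hψ hφ hx' hx)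

theorem pUp_eq (g : Metric n M) (φ : OpenPartialHomeomorph M (E n)) (y p : E n) :
    pUp g φ y p = Matrix.mulVec (gUp g φ y) p := by
  ext i
  simp only [pUp, Matrix.mulVec, dotProduct, gUp_symm g φ y i, mul_comm]

theorem energy_eq (g : Metric n M) (φ : OpenPartialHomeomorph M (E n)) (y p : E n) :
    energy g φ y p = 1 / 2 * ∑ i, p i * pUp g φ y p i := by
  simp only [energy, pUp_eq, Matrix.mulVec, dotProduct, Finset.mul_sum]
  exact Finset.sum_congr rfl fun i _ => Finset.sum_congr rfl fun j _ => by ring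

theorem coPull_eq (φ ψ : OpenPartialHomeomorph M (E n)) (x : M) (r : E n) :
    (coPull φ ψ x r : Fin n → ℝ) = Matrix.mulVec (Matrix.of (jac φ ψ x)).transpose r := by
  ext i
  rw [coPull_apply]
  rfl

theorem pUp_change (g : Metric n M) {φ ψ : OpenPartialHomeomorph M (E n)} (hφ : IsChart φ)
    (hψ : IsChart ψ) {x : M} (hx : x ∈ φ.source) (hx' : x ∈ ψ.source) (r : E n) :
    pUp g ψ (ψ x) r = Matrix.mulVec (Matrix.of (jac φ ψ x)) (pUp g φ (φ x) (coPull φ ψ x r)) := by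
  rw [pUp_eq, pUp_eq, coPull_eq, gUp_change g hφ hψ hx hx', Matrix.mulVec_mulVec,
    Matrix.mulVec_mulVec]

theorem energy_change (g : Metric n M) {φ ψ : OpenPartialHomeomorph M (E n)} (hφ : IsChart φ)
    (hψ : IsChart ψ) {x : M} (hx : x ∈ φ.source) (hx' : x ∈ ψ.source) (r : E n) :
    energy g ψ (ψ x) r = energy g φ (φ x) (coPull φ ψ x r) := by
  have h : ∀ (J : Matrix (Fin n) (Fin n) ℝ) (a b : Fin n → ℝ),
      ∑ i, a i * (J.mulVec b) i = ∑ i, (J.transpose.mulVec a) i * b i := by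
    intro J a b
    have := Matrix.dotProduct_mulVec a J b
    rw [← Matrix.mulVec_transpose] at this
    exact this
  rw [energy_eq, energy_eq, pUp_change g hφ hψ hx hx', h, ← coPull_eq]

theorem coPull_coPull {φ ψ : OpenPartialHomeomorph M (E n)} (hφ : IsChart φ)
    (hψ : IsChart ψ) {x : M} (hx : x ∈ φ.source) (hx' : x ∈ ψ.source) (r : E n) :
    coPull ψ φ x (coPull φ ψ x r) = r := by
  have h : ((coPull ψ φ x (coPull φ ψ x r) : E n) : Fin n → ℝ) = r := by
    rw [coPull_eq, coPull_eq, Matrix.mulVec_mulVec, ← Matrix.transpose_mul,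
      jac_mul_jac hψ hφ hx' hx, Matrix.transpose_one, Matrix.one_mulVec]
  ext i
  exact congrFun h i

theorem natLow_eq (g : Metric n M) (u v : ℝ → ℝ) (φ : OpenPartialHomeomorph M (E n)) (y p : E n) :
    natLow g u v φ y p = u (energy g φ y p) • gLow g φ y +
      v (energy g φ y p) • Matrix.vecMulVec p p := by
  ext i j
  simp [natLow, Matrix.vecMulVec_apply, mul_assoc]

theorem natUp_eq (g : Metric n M) (u v : ℝ → ℝ) (φ : OpenPartialHomeomorph M (E n)) (y p : E n) :
    natUp g u v φ y p = u (energy g φ y p) • gUp g φ y +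
      v (energy g φ y p) • Matrix.vecMulVec (pUp g φ y p) (pUp g φ y p) := by
  ext i j
  simp [natUp, Matrix.vecMulVec_apply, mul_assoc]

theorem natUp_change (g : Metric n M) (u v : ℝ → ℝ) {φ ψ : OpenPartialHomeomorph M (E n)}
    (hφ : IsChart φ) (hψ : IsChart ψ) {x : M} (hx : x ∈ φ.source) (hx' : x ∈ ψ.source) (r : E n) :
    natUp g u v ψ (ψ x) r = Matrix.of (jac φ ψ x) * natUp g u v φ (φ x) (coPull φ ψ x r) *
      (Matrix.of (jac φ ψ x)).transpose := by
  rw [natUp_eq, natUp_eq, energy_change g hφ hψ hx hx', pUp_change g hφ hψ hx hx',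
    gUp_change g hφ hψ hx hx']
  simp only [Matrix.mul_add, Matrix.add_mul, Matrix.mul_smul, Matrix.smul_mul,
    Matrix.mul_vecMulVec, Matrix.vecMulVec_mul, Matrix.vecMul_transpose]

theorem natLow_change (g : Metric n M) (u v : ℝ → ℝ) {φ ψ : OpenPartialHomeomorph M (E n)}
    (hφ : IsChart φ) (hψ : IsChart ψ) {x : M} (hx : x ∈ φ.source) (hx' : x ∈ ψ.source) (r : E n) :
    natLow g u v ψ (ψ x) r = (Matrix.of (jac ψ φ x)).transpose *
      natLow g u v φ (φ x) (coPull φ ψ x r) * Matrix.of (jac ψ φ x) := by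
  have hr : (r : Fin n → ℝ) =
      Matrix.mulVec (Matrix.of (jac ψ φ x)).transpose (coPull φ ψ x r) := by
    rw [← coPull_eq, coPull_coPull hφ hψ hx hx']
  rw [natLow_eq, natLow_eq, energy_change g hφ hψ hx hx', gLow_change g hψ hφ hx' hx]
  conv_lhs => rw [hr]
  simp only [Matrix.mul_add, Matrix.add_mul, Matrix.mul_smul, Matrix.smul_mul,
    Matrix.mul_vecMulVec, Matrix.vecMulVec_mul, ← Matrix.mulVec_transpose]

theorem curvatureZero_eq (g : Metric n M) {φ : OpenPartialHomeomorph M (E n)} (hφ : IsChart φ)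
    {y : E n} (hy : y ∈ φ.target) (k i j : Fin n) (p : E n) : curvatureZero g φ k i j y p =
      ∑ h, p h * curvatureForm (christoffelForm g φ) y (e i) (e j) (e k) h := by
  simp only [curvatureZero, curvature_eq g hφ hy]

/-- R⁰ pairs the covector p with the vector R(eᵢ, eⱼ)eₖ. The pairing is invariant, and
`curvatureForm_chartChange` moves the three arguments. -/
theorem curvatureZero_change (g : Metric n M) {φ ψ : OpenPartialHomeomorph M (E n)}
    (hφ : IsChart φ) (hψ : IsChart ψ) {x : M} (hx : x ∈ φ.source) (hx' : x ∈ ψ.source) (r : E n)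
    (k i j : Fin n) : curvatureZero g ψ k i j (ψ x) r =
      act₃ (Matrix.of (jac ψ φ x)).transpose (Matrix.of (jac ψ φ x)).transpose
        (Matrix.of (jac ψ φ x)).transpose
        (fun k i j => curvatureZero g φ k i j (φ x) (coPull φ ψ x r)) k i j := by
  have hr := coPull_coPull hφ hψ hx hx' r
  rw [curvatureZero_eq g hψ (ψ.map_source hx')]
  have h1 : ∀ h, r h = ∑ b, jac ψ φ x b h * (coPull φ ψ x r) b := fun h => by
    rw [← coPull_apply, hr]
  have h2 : ∀ b, ∑ h, jac ψ φ x b h *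
      curvatureForm (christoffelForm g ψ) (ψ x) (e i) (e j) (e k) h =
      curvatureForm (christoffelForm g φ) (φ x) (fderiv ℝ (chartChange ψ φ) (ψ x) (e i))
        (fderiv ℝ (chartChange ψ φ) (ψ x) (e j)) (fderiv ℝ (chartChange ψ φ) (ψ x) (e k)) b := by
    intro b
    rw [← curvatureForm_chartChange g hψ hφ hx' hx, fderiv_chartChange_apply]
  have h3 : ∑ h, r h * curvatureForm (christoffelForm g ψ) (ψ x) (e i) (e j) (e k) h =
      ∑ b, (coPull φ ψ x r) b * ∑ h, jac ψ φ x b h *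
      curvatureForm (christoffelForm g ψ) (ψ x) (e i) (e j) (e k) h := by
    simp only [h1, Finset.mul_sum, Finset.sum_mul]
    rw [Finset.sum_comm]
    exact Finset.sum_congr rfl fun i _ => Finset.sum_congr rfl fun j _ => by ring
  rw [h3]
  simp only [h2, curvatureForm_apply g hφ (φ.map_source hx), act₃, curvatureZero, Finset.mul_sum]
  rw [Finset.sum_comm]
  refine Finset.sum_congr rfl fun a _ => ?_
  rw [Finset.sum_comm]
  refine Finset.sum_congr rfl fun b _ => ?_
  rw [Finset.sum_comm]
  refine Finset.sum_congr rfl fun c _ => Finset.sum_congr rfl fun d _ => ?_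
  simp only [Matrix.transpose_apply, Matrix.of_apply, jac_eq]
  ring

/-! ### `M`-tensor fields -/

theorem energy_pos (g : Metric n M) {φ : OpenPartialHomeomorph M (E n)} (hφ : IsChart φ)
    {y : E n} (hy : y ∈ φ.target) {p : E n} (hp : p ≠ 0) : 0 < energy g φ y p := by
  have h := (posDef_gLow g hφ hy).inv.dotProduct_mulVec_pos (x := (p : Fin n → ℝ)) (by
    intro h0
    apply hp
    ext i
    exact congrFun h0 i)
  rw [energy_eq, pUp_eq]
  exact mul_pos (by norm_num) h

theorem sum_mul_pUp (g : Metric n M) (φ : OpenPartialHomeomorph M (E n)) (y p : E n) :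
    ∑ i, p i * pUp g φ y p i = 2 * energy g φ y p := by
  rw [energy_eq]
  ring

theorem gLow_mulVec_pUp (g : Metric n M) {φ : OpenPartialHomeomorph M (E n)} (hφ : IsChart φ)
    {y : E n} (hy : y ∈ φ.target) (p : E n) :
    Matrix.mulVec (gLow g φ y) (pUp g φ y p) = (p : Fin n → ℝ) := by
  rw [pUp_eq, Matrix.mulVec_mulVec, gLow_mul_gUp g hφ hy, Matrix.one_mulVec]

/-- The products close up because g_{ik} g^{0k} = p_i and p_i g^{0i} = 2t. The same computation
serves for the inverses of G⁽¹⁾, G₍₂₎ and for the fundamental form. -/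
theorem natLow_mul_natUp (g : Metric n M) (u v u' v' : ℝ → ℝ) {φ : OpenPartialHomeomorph M (E n)}
    (hφ : IsChart φ) {y : E n} (hy : y ∈ φ.target) (p : E n) :
    natLow g u v φ y p * natUp g u' v' φ y p =
      (u (energy g φ y p) * u' (energy g φ y p)) • (1 : Matrix (Fin n) (Fin n) ℝ) +
      (u (energy g φ y p) * v' (energy g φ y p) + v (energy g φ y p) * u' (energy g φ y p) +
        2 * energy g φ y p * v (energy g φ y p) * v' (energy g φ y p)) •
        Matrix.vecMulVec p (pUp g φ y p) := by
  have h1 : Matrix.vecMul (p : Fin n → ℝ) (gUp g φ y) = pUp g φ y p := rfl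
  have h2 : (p : Fin n → ℝ) ⬝ᵥ pUp g φ y p = 2 * energy g φ y p := sum_mul_pUp g φ y p
  rw [natLow_eq, natUp_eq]
  simp only [Matrix.add_mul, Matrix.mul_add, Matrix.smul_mul, Matrix.mul_smul]
  simp only [Matrix.vecMulVec_mul_vecMulVec, h2]
  simp only [Matrix.mul_vecMulVec, Matrix.vecMulVec_mul, gLow_mul_gUp g hφ hy,
    gLow_mulVec_pUp g hφ hy, h1]
  ext i j
  simp [Matrix.vecMulVec_apply]
  ring

/-- The first coefficient of the inverse of `u g + v p ⊗ p`. -/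
def invFst (u : ℝ → ℝ) (t : ℝ) : ℝ := 1 / u t

/-- The second coefficient of the inverse of `u g + v p ⊗ p`. -/
def invSnd (u v : ℝ → ℝ) (t : ℝ) : ℝ := -v t / (u t * (u t + 2 * t * v t))

theorem neg_div_mul_mul_self {a b d : ℝ} (ha : a ≠ 0) (hd : d ≠ 0) :
    -b / (a * d) * d = -b / a := by
  field_simp

/-- The Sherman–Morrison formula; its denominators are u, the factor on the directions annihilated
by p, and u + 2tv, the factor in the direction of p. -/
theorem natLow_mul_natUp_inv (g : Metric n M) {u v : ℝ → ℝ} (hu : ∀ t > 0, 0 < u t)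
    (hv : ∀ t > 0, 0 < u t + 2 * t * v t) {φ : OpenPartialHomeomorph M (E n)}
    (hφ : IsChart φ) {y : E n} (hy : y ∈ φ.target) {p : E n} (hp : p ≠ 0) :
    natLow g u v φ y p * natUp g (invFst u) (invSnd u v) φ y p = 1 := by
  have ht := energy_pos g hφ hy hp
  have h1 := (hu _ ht).ne'
  have h2 := (hv _ ht).ne'
  rw [natLow_mul_natUp g _ _ _ _ hφ hy, invFst, invSnd]
  set t := energy g φ y p
  have h3 : u t * (1 / u t) = 1 := by field_simp
  have h4 : u t * (-v t / (u t * (u t + 2 * t * v t))) + v t * (1 / u t) +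
      2 * t * v t * (-v t / (u t * (u t + 2 * t * v t))) = 0 := by
    linear_combination neg_div_mul_mul_self (b := v t) h1 h2
  rw [h3, h4, one_smul, zero_smul, add_zero]

theorem natLow_inv_mul_natUp (g : Metric n M) {u v : ℝ → ℝ} (hu : ∀ t > 0, 0 < u t)
    (hv : ∀ t > 0, 0 < u t + 2 * t * v t) {φ : OpenPartialHomeomorph M (E n)}
    (hφ : IsChart φ) {y : E n} (hy : y ∈ φ.target) {p : E n} (hp : p ≠ 0) :
    natLow g (invFst u) (invSnd u v) φ y p * natUp g u v φ y p = 1 := by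
  have ht := energy_pos g hφ hy hp
  have h1 := (hu _ ht).ne'
  have h2 := (hv _ ht).ne'
  rw [natLow_mul_natUp g _ _ _ _ hφ hy, invFst, invSnd]
  set t := energy g φ y p
  have h3 : (1 / u t) * u t = 1 := by field_simp
  have h4 : 1 / u t * v t + (-v t / (u t * (u t + 2 * t * v t))) * u t +
      2 * t * (-v t / (u t * (u t + 2 * t * v t))) * v t = 0 := by
    linear_combination neg_div_mul_mul_self (b := v t) h1 h2
  rw [h3, h4, one_smul, zero_smul, add_zero]

theorem H1_eq (g : Metric n M) (w : MetricCoeffs) {φ : OpenPartialHomeomorph M (E n)}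
    (hφ : IsChart φ) {y : E n} (hy : y ∈ φ.target) {p : E n} (hp : p ≠ 0) :
    H1 g w φ y p = natUp g (invFst w.c₁) (invSnd w.c₁ w.d₁) φ y p :=
  Matrix.inv_eq_right_inv (natLow_mul_natUp_inv g w.pos_c₁ w.pos_d₁ hφ hy hp)

theorem H2_eq (g : Metric n M) (w : MetricCoeffs) {φ : OpenPartialHomeomorph M (E n)}
    (hφ : IsChart φ) {y : E n} (hy : y ∈ φ.target) {p : E n} (hp : p ≠ 0) :
    H2 g w φ y p = natLow g (invFst w.c₂) (invSnd w.c₂ w.d₂) φ y p :=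
  Matrix.inv_eq_left_inv (natLow_inv_mul_natUp g w.pos_c₂ w.pos_d₂ hφ hy hp)

theorem contDiffOn_invFst {u : ℝ → ℝ} (hu : ContDiffOn ℝ ∞ u (Set.Ioi 0)) (h : ∀ t > 0, 0 < u t) :
    ContDiffOn ℝ ∞ (invFst u) (Set.Ioi 0) :=
  contDiffOn_const.div hu fun t ht => (h t ht).ne'

theorem contDiffOn_invSnd {u v : ℝ → ℝ} (hu : ContDiffOn ℝ ∞ u (Set.Ioi 0))
    (hv : ContDiffOn ℝ ∞ v (Set.Ioi 0)) (h : ∀ t > 0, 0 < u t)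
    (h' : ∀ t > 0, 0 < u t + 2 * t * v t) : ContDiffOn ℝ ∞ (invSnd u v) (Set.Ioi 0) :=
  hv.neg.div (hu.mul (hu.add ((contDiffOn_const.mul contDiffOn_id).mul hv))) fun t ht =>
    (mul_pos (h t ht) (h' t ht)).ne'

/-! ### Smoothness of the components as functions of (q, p). -/

section Smooth

variable (g : Metric n M) {φ : OpenPartialHomeomorph M (E n)} {z : E n × E n}

theorem contDiffAt_snd_apply (i : Fin n) : ContDiffAt ℝ ∞ (fun z : E n × E n => z.2 i) z :=
  (coordCLM i).contDiff.contDiffAt.comp z contDiffAt_snd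

theorem contDiffAt_gLow_fst (hφ : IsChart φ) (hz : z.1 ∈ φ.target) (i j : Fin n) :
    ContDiffAt ℝ ∞ (fun z : E n × E n => gLow g φ z.1 i j) z :=
  ContDiffAt.comp (g := fun y => gLow g φ y i j) z (contDiffAt_gLow g hφ hz i j) contDiffAt_fst

theorem contDiffAt_gUp_fst (hφ : IsChart φ) (hz : z.1 ∈ φ.target) (i j : Fin n) :
    ContDiffAt ℝ ∞ (fun z : E n × E n => gUp g φ z.1 i j) z :=
  ContDiffAt.comp (g := fun y => gUp g φ y i j) z (contDiffAt_gUp g hφ hz i j) contDiffAt_fst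

theorem contDiffAt_energy (hφ : IsChart φ) (hz : z.1 ∈ φ.target) : ContDiffAt ℝ ∞ (fun z : E n × E n => energy g φ z.1 z.2) z :=
  contDiffAt_const.mul (ContDiffAt.sum fun i _ => ContDiffAt.sum fun j _ =>
    ((contDiffAt_gUp_fst g hφ hz i j).mul (contDiffAt_snd_apply i)).mul (contDiffAt_snd_apply j))

theorem contDiffAt_pUp (hφ : IsChart φ) (hz : z.1 ∈ φ.target) (i : Fin n) : ContDiffAt ℝ ∞ (fun z : E n × E n => pUp g φ z.1 z.2 i) z :=
  ContDiffAt.sum fun h _ => (contDiffAt_snd_apply h).mul (contDiffAt_gUp_fst g hφ hz h i)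

theorem contDiffAt_comp_energy (hφ : IsChart φ) (hz : z.1 ∈ φ.target) (hp : z.2 ≠ 0) {u : ℝ → ℝ} (hu : ContDiffOn ℝ ∞ u (Set.Ioi 0)) :
    ContDiffAt ℝ ∞ (fun z : E n × E n => u (energy g φ z.1 z.2)) z :=
  ContDiffAt.comp (g := u) z (hu.contDiffAt (Ioi_mem_nhds (energy_pos g hφ hz hp)))
    (contDiffAt_energy g hφ hz)

theorem contDiffAt_natLow (hφ : IsChart φ) (hz : z.1 ∈ φ.target) (hp : z.2 ≠ 0) {u v : ℝ → ℝ} (hu : ContDiffOn ℝ ∞ u (Set.Ioi 0))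
    (hv : ContDiffOn ℝ ∞ v (Set.Ioi 0)) (i j : Fin n) :
    ContDiffAt ℝ ∞ (fun z : E n × E n => natLow g u v φ z.1 z.2 i j) z :=
  ((contDiffAt_comp_energy g hφ hz hp hu).mul (contDiffAt_gLow_fst g hφ hz i j)).add
    (((contDiffAt_comp_energy g hφ hz hp hv).mul (contDiffAt_snd_apply i)).mul
      (contDiffAt_snd_apply j))

theorem contDiffAt_natUp (hφ : IsChart φ) (hz : z.1 ∈ φ.target) (hp : z.2 ≠ 0) {u v : ℝ → ℝ} (hu : ContDiffOn ℝ ∞ u (Set.Ioi 0))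
    (hv : ContDiffOn ℝ ∞ v (Set.Ioi 0)) (i j : Fin n) :
    ContDiffAt ℝ ∞ (fun z : E n × E n => natUp g u v φ z.1 z.2 i j) z :=
  ((contDiffAt_comp_energy g hφ hz hp hu).mul (contDiffAt_gUp_fst g hφ hz i j)).add
    (((contDiffAt_comp_energy g hφ hz hp hv).mul (contDiffAt_pUp g hφ hz i)).mul
      (contDiffAt_pUp g hφ hz j))

theorem eventually_mem_target_and_ne (hz : z.1 ∈ φ.target) (hp : z.2 ≠ 0) :
    ∀ᶠ z' : E n × E n in 𝓝 z, z'.1 ∈ φ.target ∧ z'.2 ≠ 0 :=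
  Filter.inter_mem (continuousAt_fst.eventually (eventually_mem_target hz))
    (continuousAt_snd.eventually (isOpen_ne.mem_nhds hp))

/-- A derivative in p alone becomes a directional derivative in both variables, and this form shows
that it depends smoothly on q as well. -/
theorem pd_eq_fderiv_snd {f : E n → E n → ℝ}
    (hf : DifferentiableAt ℝ (fun z : E n × E n => f z.1 z.2) z) (i : Fin n) :
    pd i (f z.1) z.2 = fderiv ℝ (fun z : E n × E n => f z.1 z.2) z (0, e i) := by
  have h1 : HasFDerivAt (fun r : E n => (z.1, r)) (ContinuousLinearMap.inr ℝ (E n) (E n)) z.2 :=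
    hasFDerivAt_prodMk_right z.1 z.2
  have h2 := HasFDerivAt.comp (g := fun z : E n × E n => f z.1 z.2) z.2 hf.hasFDerivAt h1
  rw [pd]
  erw [h2.fderiv]
  rfl

theorem contDiffAt_pd_snd {f : E n → E n → ℝ}
    (hf : ContDiffAt ℝ ∞ (fun z : E n × E n => f z.1 z.2) z) (i : Fin n) :
    ContDiffAt ℝ ∞ (fun z : E n × E n => pd i (f z.1) z.2) z := by
  have h1 : ContDiffAt ℝ ∞ (fun z' => fderiv ℝ (fun z : E n × E n => f z.1 z.2) z'
      ((0 : E n), (e i : E n))) z :=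
    (hf.fderiv_right (m := ∞) (by norm_cast)).clm_apply contDiffAt_const
  refine h1.congr_of_eventuallyEq ?_
  have h2 := (hf.of_le (m := 1) (by norm_cast)).eventually (by simp)
  filter_upwards [h2] with z' hz'
  exact pd_eq_fderiv_snd (hz'.differentiableAt (by simp)) i

theorem contDiffAt_curvatureZero (hφ : IsChart φ) (hz : z.1 ∈ φ.target) (k i j : Fin n) :
    ContDiffAt ℝ ∞ (fun z : E n × E n => curvatureZero g φ k i j z.1 z.2) z := by
  have hΓ := fun a b c => contDiffAt_christoffel g hφ hz a b c
  have h : ∀ h, ContDiffAt ℝ ∞ (curvature g φ h k i j) z.1 := fun h =>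
    ((contDiffAt_pd (hΓ h j k) i).sub (contDiffAt_pd (hΓ h i k) j)).add
      (ContDiffAt.sum fun l _ => ((hΓ h i l).mul (hΓ l j k)).sub ((hΓ h j l).mul (hΓ l i k)))
  exact ContDiffAt.sum fun h' _ => (contDiffAt_snd_apply h').mul
    (ContDiffAt.comp (g := curvature g φ h' k i j) z (h h') contDiffAt_fst)

variable (w : MetricCoeffs)

theorem contDiffAt_G1 (hφ : IsChart φ) (hz : z.1 ∈ φ.target) (hp : z.2 ≠ 0) (i j : Fin n) :
    ContDiffAt ℝ ∞ (fun z : E n × E n => G1 g w φ z.1 z.2 i j) z :=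
  contDiffAt_natLow g hφ hz hp w.smooth_c₁ w.smooth_d₁ i j

theorem contDiffAt_G2 (hφ : IsChart φ) (hz : z.1 ∈ φ.target) (hp : z.2 ≠ 0) (i j : Fin n) :
    ContDiffAt ℝ ∞ (fun z : E n × E n => G2 g w φ z.1 z.2 i j) z :=
  contDiffAt_natUp g hφ hz hp w.smooth_c₂ w.smooth_d₂ i j

theorem contDiffAt_H1 (hφ : IsChart φ) (hz : z.1 ∈ φ.target) (hp : z.2 ≠ 0) (i j : Fin n) :
    ContDiffAt ℝ ∞ (fun z : E n × E n => H1 g w φ z.1 z.2 i j) z :=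
  (contDiffAt_natUp g hφ hz hp (contDiffOn_invFst w.smooth_c₁ w.pos_c₁)
    (contDiffOn_invSnd w.smooth_c₁ w.smooth_d₁ w.pos_c₁ w.pos_d₁) i j).congr_of_eventuallyEq
    ((eventually_mem_target_and_ne hz hp).mono fun _ hz' =>
      congrFun (congrFun (H1_eq g w hφ hz'.1 hz'.2) i) j)

theorem contDiffAt_H2 (hφ : IsChart φ) (hz : z.1 ∈ φ.target) (hp : z.2 ≠ 0) (i j : Fin n) :
    ContDiffAt ℝ ∞ (fun z : E n × E n => H2 g w φ z.1 z.2 i j) z :=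
  (contDiffAt_natLow g hφ hz hp (contDiffOn_invFst w.smooth_c₂ w.pos_c₂)
    (contDiffOn_invSnd w.smooth_c₂ w.smooth_d₂ w.pos_c₂ w.pos_d₂) i j).congr_of_eventuallyEq
    ((eventually_mem_target_and_ne hz hp).mono fun _ hz' =>
      congrFun (congrFun (H2_eq g w hφ hz'.1 hz'.2) i) j)

theorem contDiffAt_Q (hφ : IsChart φ) (hz : z.1 ∈ φ.target) (hp : z.2 ≠ 0) (i j h : Fin n) :
    ContDiffAt ℝ ∞ (fun z : E n × E n => Q g w φ z.1 z.2 i j h) z := by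
  have hG := fun i j => contDiffAt_G2 g w hφ hz hp i j
  exact contDiffAt_const.mul (ContDiffAt.sum fun k _ => (contDiffAt_H2 g w hφ hz hp h k).mul
    (((contDiffAt_pd_snd (f := fun y r => G2 g w φ y r j k) (hG j k) i).add
      (contDiffAt_pd_snd (f := fun y r => G2 g w φ y r i k) (hG i k) j)).sub
      (contDiffAt_pd_snd (f := fun y r => G2 g w φ y r i j) (hG i j) k)))

theorem contDiffAt_P (hφ : IsChart φ) (hz : z.1 ∈ φ.target) (hp : z.2 ≠ 0) (h i j : Fin n) :
    ContDiffAt ℝ ∞ (fun z : E n × E n => P g w φ z.1 z.2 h i j) z :=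
  contDiffAt_const.mul (ContDiffAt.sum fun k _ => (contDiffAt_H1 g w hφ hz hp h k).mul
    ((contDiffAt_pd_snd (f := fun y r => G1 g w φ y r j k) (contDiffAt_G1 g w hφ hz hp j k) i).sub
      (ContDiffAt.sum fun l _ => (contDiffAt_G2 g w hφ hz hp i l).mul
        (contDiffAt_curvatureZero g hφ hz l j k))))

theorem contDiffAt_S (hφ : IsChart φ) (hz : z.1 ∈ φ.target) (hp : z.2 ≠ 0) (h i j : Fin n) :
    ContDiffAt ℝ ∞ (fun z : E n × E n => S g w φ z.1 z.2 h i j) z :=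
  (contDiffAt_const.mul (ContDiffAt.sum fun k _ => (contDiffAt_H2 g w hφ hz hp h k).mul
    (contDiffAt_pd_snd (f := fun y r => G1 g w φ y r i j)
      (contDiffAt_G1 g w hφ hz hp i j) k))).add
    (contDiffAt_const.mul (contDiffAt_curvatureZero g hφ hz h i j))

end Smooth

/-- At a fixed base point p changes by the linear map `coPull`; hence ∂/∂p transforms like an upper
index, and no second derivative of the change of charts occurs. -/
theorem pd_comp_coPull (φ ψ : OpenPartialHomeomorph M (E n)) (x : M) {f : E n → ℝ} {r : E n}
    (hf : DifferentiableAt ℝ f (coPull φ ψ x r)) (c : Fin n) :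
    pd c (fun r => f (coPull φ ψ x r)) r = ∑ k, jac φ ψ x c k * pd k f (coPull φ ψ x r) := by
  have h := HasFDerivAt.comp (g := f) r hf.hasFDerivAt (coPull φ ψ x).hasFDerivAt
  rw [pd]
  erw [h.fderiv]
  have h2 : coPull φ ψ x (e c) = ∑ k, jac φ ψ x c k • (e k : E n) := by
    rw [sum_smul_e (WithLp.toLp 2 fun k => jac φ ψ x c k)]
    ext k
    simp [coPull_apply, e_apply]
  rw [ContinuousLinearMap.comp_apply, h2, map_sum]
  simp only [map_smul, smul_eq_mul]
  rfl

theorem pd_act₂_comp_coPull (φ ψ : OpenPartialHomeomorph M (E n)) (x : M)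
    (A B : Matrix (Fin n) (Fin n) ℝ) {F : E n → Matrix (Fin n) (Fin n) ℝ} {r : E n}
    (hF : ∀ i j, DifferentiableAt ℝ (fun s => F s i j) (coPull φ ψ x r)) (c a b : Fin n) :
    pd c (fun r => act₂ A B (F (coPull φ ψ x r)) a b) r =
      act₃ (Matrix.of (jac φ ψ x)) A B
        (fun k i j => pd k (fun s => F s i j) (coPull φ ψ x r)) c a b := by
  have h1 : DifferentiableAt ℝ (fun s => act₂ A B (F s) a b) (coPull φ ψ x r) :=
    DifferentiableAt.fun_sum fun i _ => DifferentiableAt.fun_sum fun j _ => (hF i j).const_mul _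
  rw [pd_comp_coPull φ ψ x (f := fun s => act₂ A B (F s) a b) h1]
  simp only [act₃]
  refine Finset.sum_congr rfl fun k _ => ?_
  have h2 : HasFDerivAt (fun s => act₂ A B (F s) a b)
      (∑ i, ∑ j, (A a i * B b j) • fderiv ℝ (fun s => F s i j) (coPull φ ψ x r))
      (coPull φ ψ x r) :=
    HasFDerivAt.fun_sum fun i _ => HasFDerivAt.fun_sum fun j _ =>
      (hF i j).hasFDerivAt.const_mul _
  rw [pd, h2.fderiv]
  simp only [sum_apply, smul_apply, smul_eq_mul,
    Finset.mul_sum, pd, Matrix.of_apply, mul_assoc]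

theorem pd_natUp_change (g : Metric n M) {u v : ℝ → ℝ} (hu : ContDiffOn ℝ ∞ u (Set.Ioi 0))
    (hv : ContDiffOn ℝ ∞ v (Set.Ioi 0)) {φ ψ : OpenPartialHomeomorph M (E n)}
    (hφ : IsChart φ) (hψ : IsChart ψ) {x : M} (hx : x ∈ φ.source) (hx' : x ∈ ψ.source) {r : E n}
    (hr : coPull φ ψ x r ≠ 0) (c a b : Fin n) :
    pd c (fun r => natUp g u v ψ (ψ x) r a b) r =
      act₃ (Matrix.of (jac φ ψ x)) (Matrix.of (jac φ ψ x)) (Matrix.of (jac φ ψ x))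
        (fun k i j => pd k (fun s => natUp g u v φ (φ x) s i j) (coPull φ ψ x r)) c a b := by
  rw [← pd_act₂_comp_coPull φ ψ x _ _ (F := fun s => natUp g u v φ (φ x) s)]
  · simp only [act₂_eq, natUp_change g u v hφ hψ hx hx']
  · intro i j
    have h := contDiffAt_natUp g (z := (φ x, coPull φ ψ x r)) hφ (φ.map_source hx) hr hu hv i j
    exact DifferentiableAt.comp (g := fun z : E n × E n => natUp g u v φ z.1 z.2 i j)
      (f := fun s => (φ x, s)) _ (h.differentiableAt (by simp))
      (hasFDerivAt_prodMk_right _ _).differentiableAt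

theorem pd_natLow_change (g : Metric n M) {u v : ℝ → ℝ} (hu : ContDiffOn ℝ ∞ u (Set.Ioi 0))
    (hv : ContDiffOn ℝ ∞ v (Set.Ioi 0)) {φ ψ : OpenPartialHomeomorph M (E n)}
    (hφ : IsChart φ) (hψ : IsChart ψ) {x : M} (hx : x ∈ φ.source) (hx' : x ∈ ψ.source) {r : E n}
    (hr : coPull φ ψ x r ≠ 0) (c a b : Fin n) :
    pd c (fun r => natLow g u v ψ (ψ x) r a b) r =
      act₃ (Matrix.of (jac φ ψ x)) (Matrix.of (jac ψ φ x)).transpose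
        (Matrix.of (jac ψ φ x)).transpose
        (fun k i j => pd k (fun s => natLow g u v φ (φ x) s i j) (coPull φ ψ x r)) c a b := by
  rw [← pd_act₂_comp_coPull φ ψ x _ _ (F := fun s => natLow g u v φ (φ x) s)]
  · simp only [act₂_eq, natLow_change g u v hφ hψ hx hx', Matrix.transpose_transpose]
  · intro i j
    have h := contDiffAt_natLow g (z := (φ x, coPull φ ψ x r)) hφ (φ.map_source hx) hr hu hv i j
    exact DifferentiableAt.comp (g := fun z : E n × E n => natLow g u v φ z.1 z.2 i j)
      (f := fun s => (φ x, s)) _ (h.differentiableAt (by simp))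
      (hasFDerivAt_prodMk_right _ _).differentiableAt

section ChangeOfComponents

variable (g : Metric n M) (w : MetricCoeffs) {φ ψ : OpenPartialHomeomorph M (E n)}

theorem H1_change (hφ : IsChart φ) (hψ : IsChart ψ) {x : M} (hx : x ∈ φ.source)
    (hx' : x ∈ ψ.source) (r : E n) (a b : Fin n) :
    H1 g w ψ (ψ x) r a b = act₂ (Matrix.of (jac φ ψ x)) (Matrix.of (jac φ ψ x))
      (H1 g w φ (φ x) (coPull φ ψ x r)) a b := by
  rw [act₂_eq]
  exact congrFun (congrFun (eq_inv_conj (jac_mul_jac hψ hφ hx' hx)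
    (natLow_change g _ _ hφ hψ hx hx' r)) a) b

theorem H2_change (hφ : IsChart φ) (hψ : IsChart ψ) {x : M} (hx : x ∈ φ.source)
    (hx' : x ∈ ψ.source) (r : E n) (a b : Fin n) :
    H2 g w ψ (ψ x) r a b = act₂ (Matrix.of (jac ψ φ x)).transpose
      (Matrix.of (jac ψ φ x)).transpose (H2 g w φ (φ x) (coPull φ ψ x r)) a b := by
  rw [act₂_eq]
  have h1 : (Matrix.of (jac ψ φ x)).transpose * (Matrix.of (jac φ ψ x)).transpose = 1 := by
    rw [← Matrix.transpose_mul, jac_mul_jac hψ hφ hx' hx, Matrix.transpose_one]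
  refine congrFun (congrFun (eq_inv_conj h1 ?_) a) b
  rw [Matrix.transpose_transpose]
  exact natUp_change g _ _ hφ hψ hx hx' r

theorem Q_change (hφ : IsChart φ) (hψ : IsChart ψ) {x : M} (hx : x ∈ φ.source)
    (hx' : x ∈ ψ.source) {r : E n} (hr : coPull φ ψ x r ≠ 0) (i j h : Fin n) :
    Q g w ψ (ψ x) r i j h = act₃ (Matrix.of (jac φ ψ x)) (Matrix.of (jac φ ψ x))
      (Matrix.of (jac ψ φ x)).transpose
      (fun i j h => Q g w φ (φ x) (coPull φ ψ x r) i j h) i j h := by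
  have h1 : (Matrix.of (jac ψ φ x)).transpose.transpose * (Matrix.of (jac φ ψ x)) = 1 :=
    jac_mul_jac hφ hψ hx hx'
  have h2 := fun c a b => pd_natUp_change g w.smooth_c₂ w.smooth_d₂ hφ hψ hx hx' hr c a b
  have h3 : ∀ k, pd i (fun s => G2 g w ψ (ψ x) s j k) r + pd j (fun s => G2 g w ψ (ψ x) s i k) r
      - pd k (fun s => G2 g w ψ (ψ x) s i j) r =
      act₃ (Matrix.of (jac φ ψ x)) (Matrix.of (jac φ ψ x)) (Matrix.of (jac φ ψ x))
        (fun k i j => pd i (fun s => G2 g w φ (φ x) s j k) (coPull φ ψ x r) +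
          pd j (fun s => G2 g w φ (φ x) s i k) (coPull φ ψ x r)
          - pd k (fun s => G2 g w φ (φ x) s i j) (coPull φ ψ x r)) k i j := by
    intro k
    simp only [G2, h2]
    -- The swaps bring the index `k` of each term to the front, where `H2` is contracted.
    rw [act₃_swap₂₃ _ _ _ _ i j k, act₃_swap₁₂ _ _ _ _ i k j, act₃_swap₁₂ _ _ _ _ j i k,
      act₃_swap₂₃ _ _ _ _ i j k, act₃_swap₁₂ _ _ _ _ i k j, act₃_add, act₃_sub]
  simp only [Q, h3, H2_change g w hφ hψ hx hx']
  rw [act₂_contract_act₃ h1, act₃_smul, act₃_swap₁₂, act₃_swap₂₃]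

theorem P_change (hφ : IsChart φ) (hψ : IsChart ψ) {x : M} (hx : x ∈ φ.source)
    (hx' : x ∈ ψ.source) {r : E n} (hr : coPull φ ψ x r ≠ 0) (h i j : Fin n) :
    P g w ψ (ψ x) r h i j = act₃ (Matrix.of (jac φ ψ x)) (Matrix.of (jac φ ψ x))
      (Matrix.of (jac ψ φ x)).transpose
      (fun h i j => P g w φ (φ x) (coPull φ ψ x r) h i j) h i j := by
  have h1 : (Matrix.of (jac φ ψ x)).transpose * (Matrix.of (jac ψ φ x)).transpose = 1 := by
    rw [← Matrix.transpose_mul, jac_mul_jac hφ hψ hx hx', Matrix.transpose_one]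
  have h2 := fun c a b => pd_natLow_change g w.smooth_c₁ w.smooth_d₁ hφ hψ hx hx' hr c a b
  have h3 : ∀ k, ∑ l, G2 g w ψ (ψ x) r i l * curvatureZero g ψ l j k (ψ x) r =
      act₃ (Matrix.of (jac φ ψ x)) (Matrix.of (jac ψ φ x)).transpose
        (Matrix.of (jac ψ φ x)).transpose (fun i j k => ∑ l, G2 g w φ (φ x) (coPull φ ψ x r) i l *
          curvatureZero g φ l j k (φ x) (coPull φ ψ x r)) i j k := by
    intro k
    have h4 : ∀ l, G2 g w ψ (ψ x) r i l = act₂ (Matrix.of (jac φ ψ x)) (Matrix.of (jac φ ψ x))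
        (G2 g w φ (φ x) (coPull φ ψ x r)) i l := fun l => by
      rw [act₂_eq, G2, natUp_change g _ _ hφ hψ hx hx' r, G2]
    simp only [h4, curvatureZero_change g hφ hψ hx hx']
    rw [act₂_contract_act₃ h1]
  have h5 : ∀ k, pd i (fun s => G1 g w ψ (ψ x) s j k) r -
      ∑ l, G2 g w ψ (ψ x) r i l * curvatureZero g ψ l j k (ψ x) r =
      act₃ (Matrix.of (jac ψ φ x)).transpose (Matrix.of (jac φ ψ x))
        (Matrix.of (jac ψ φ x)).transpose
        (fun k i j => pd i (fun s => G1 g w φ (φ x) s j k) (coPull φ ψ x r) -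
          ∑ l, G2 g w φ (φ x) (coPull φ ψ x r) i l *
            curvatureZero g φ l j k (φ x) (coPull φ ψ x r)) k i j := by
    intro k
    rw [h3]
    simp only [G1, h2]
    rw [act₃_sub, act₃_swap₂₃, act₃_swap₁₂]
  simp only [P, h5, H1_change g w hφ hψ hx hx']
  rw [act₂_contract_act₃ h1, act₃_smul]

theorem S_change (hφ : IsChart φ) (hψ : IsChart ψ) {x : M} (hx : x ∈ φ.source)
    (hx' : x ∈ ψ.source) {r : E n} (hr : coPull φ ψ x r ≠ 0) (h i j : Fin n) :
    S g w ψ (ψ x) r h i j = act₃ (Matrix.of (jac ψ φ x)).transpose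
      (Matrix.of (jac ψ φ x)).transpose (Matrix.of (jac ψ φ x)).transpose
      (fun h i j => S g w φ (φ x) (coPull φ ψ x r) h i j) h i j := by
  have h1 : (Matrix.of (jac ψ φ x)).transpose.transpose * (Matrix.of (jac φ ψ x)) = 1 :=
    jac_mul_jac hφ hψ hx hx'
  have h2 := fun c a b => pd_natLow_change g w.smooth_c₁ w.smooth_d₁ hφ hψ hx hx' hr c a b
  simp only [S, G1, h2, H2_change g w hφ hψ hx hx']
  rw [act₂_contract_act₃ h1, curvatureZero_change g hφ hψ hx hx', act₃_smul, act₃_smul, act₃_add]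

end ChangeOfComponents

section SumsOverIndices

variable {ι : Type*} [Fintype ι]

theorem sum_fin_one_arrow (F : (Fin 1 → ι) → ℝ) : ∑ i, F i = ∑ a, F ![a] :=
  Fintype.sum_equiv (Equiv.funUnique (Fin 1) ι) _ _ fun i => congrArg F (by
    ext k
    rw [Subsingleton.elim k 0]
    rfl)

theorem sum_fin_succ_arrow {m : ℕ} (F : (Fin (m + 1) → ι) → ℝ) :
    ∑ i, F i = ∑ a, ∑ i : Fin m → ι, F (Fin.cons a i) := by
  rw [← Fintype.sum_prod_type']
  exact (Fintype.sum_equiv (Fin.consEquiv fun _ => ι) _ _ fun i => rfl).symm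

end SumsOverIndices

/-- The coordinate fields span each tangent space, so a covector is zero exactly when its momenta
are. -/
theorem mem_TStarZero_iff {φ : OpenPartialHomeomorph M (E n)} (hφ : IsChart φ) {u : TStar n M}
    (hu : u.1 ∈ φ.source) : u ∈ TStarZero n M ↔ (indChart φ u).2 ≠ 0 := by
  refine not_congr ⟨fun h => ?_, fun h => ?_⟩
  · ext i
    rw [indChart_snd, h]
    rfl
  · refine ContinuousLinearMap.ext fun v => ?_
    have h1 : v = ∑ i, (show E n from mfderiv 𝓘(ℝ, E n) 𝓘(ℝ, E n) φ u.1 v) i •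
        coordVec φ i u.1 := by
      apply (hφ.isInvertible_mfderiv hu).injective
      simp only [map_sum, map_smul, mfderiv_coordVec hφ hu]
      exact (sum_smul_e (n := n) _).symm
    rw [h1, map_sum]
    refine Finset.sum_eq_zero fun i _ => ?_
    rw [map_smul, ← indChart_snd, h]
    exact smul_zero _

theorem isMTensor_Q (g : Metric n M) (w : MetricCoeffs) :
    IsMTensor (M := M) 2 1 (fun φ y p a b => Q g w φ y p (a 0) (a 1) (b 0)) where
  smooth φ hφ a b := fun z hz => (contDiffAt_Q g w hφ hz.1 hz.2 _ _ _).contDiffWithinAt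
  change φ ψ hφ hψ u hu hx hx' a b := by
    have h := coPull_indChart hφ hψ hx hx'
    have h' := Q_change g w hφ hψ hx hx' (r := (indChart ψ u).2)
      (by rw [h]; exact (mem_TStarZero_iff hφ hx).1 hu) (a 0) (a 1) (b 0)
    rw [h] at h'
    refine h'.trans ?_
    simp only [sum_fin_succ_arrow (m := 1), sum_fin_one_arrow, Fin.prod_univ_two,
      Fin.prod_univ_one, act₃]
    rfl

theorem isMTensor_P (g : Metric n M) (w : MetricCoeffs) :
    IsMTensor (M := M) 2 1 (fun φ y p a b => P g w φ y p (a 0) (a 1) (b 0)) where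
  smooth φ hφ a b := fun z hz => (contDiffAt_P g w hφ hz.1 hz.2 _ _ _).contDiffWithinAt
  change φ ψ hφ hψ u hu hx hx' a b := by
    have h := coPull_indChart hφ hψ hx hx'
    have h' := P_change g w hφ hψ hx hx' (r := (indChart ψ u).2)
      (by rw [h]; exact (mem_TStarZero_iff hφ hx).1 hu) (a 0) (a 1) (b 0)
    rw [h] at h'
    refine h'.trans ?_
    simp only [sum_fin_succ_arrow (m := 1), sum_fin_one_arrow, Fin.prod_univ_two,
      Fin.prod_univ_one, act₃]
    rfl

theorem isMTensor_S (g : Metric n M) (w : MetricCoeffs) :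
    IsMTensor (M := M) 0 3 (fun φ y p _ b => S g w φ y p (b 0) (b 1) (b 2)) where
  smooth φ hφ a b := fun z hz => (contDiffAt_S g w hφ hz.1 hz.2 _ _ _).contDiffWithinAt
  change φ ψ hφ hψ u hu hx hx' a b := by
    have h := coPull_indChart hφ hψ hx hx'
    have h' := S_change g w hφ hψ hx hx' (r := (indChart ψ u).2)
      (by rw [h]; exact (mem_TStarZero_iff hφ hx).1 hu) (b 0) (b 1) (b 2)
    rw [h] at h'
    refine h'.trans ?_
    simp only [sum_fin_succ_arrow (m := 2), sum_fin_succ_arrow (m := 1), sum_fin_one_arrow,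
      Fin.prod_univ_three, act₃, Fintype.sum_unique, Finset.univ_eq_empty, Finset.prod_empty,
      one_mul]
    rfl

/-! ### Adapted frames -/

/-- The vector field on `T*M` with the components `X` in the induced chart. -/
def liftField (φ : OpenPartialHomeomorph M (E n)) (X : E n × E n → E n × E n) : VField n M :=
  mpullback (IStar n) 𝓘(ℝ, E n × E n) (indChart φ) X

/-- The inverse of `dInd φ u`. -/
def indInv (φ : OpenPartialHomeomorph M (E n)) (u : TStar n M) :
    E n × E n →L[ℝ] TangentSpace (IStar n) u :=
  (mfderiv (IStar n) 𝓘(ℝ, E n × E n) (indChart φ) u).inverse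

theorem liftField_apply (φ : OpenPartialHomeomorph M (E n)) (X : E n × E n → E n × E n)
    (u : TStar n M) : liftField φ X u = indInv φ u (X (indChart φ u)) := rfl

theorem dInd_indInv {φ : OpenPartialHomeomorph M (E n)} (hφ : IsChart φ) {u : TStar n M}
    (hu : u.1 ∈ φ.source) (v : E n × E n) : dInd φ u (indInv φ u v) = v :=
  (isInvertible_mfderiv_indChart hφ hu).self_apply_inverse v

theorem indInv_dInd {φ : OpenPartialHomeomorph M (E n)} (hφ : IsChart φ) {u : TStar n M}
    (hu : u.1 ∈ φ.source) (ξ : TangentSpace (IStar n) u) : indInv φ u (dInd φ u ξ) = ξ :=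
  (isInvertible_mfderiv_indChart hφ hu).inverse_apply_self ξ

theorem dInd_add (φ : OpenPartialHomeomorph M (E n)) (u : TStar n M)
    (ξ η : TangentSpace (IStar n) u) : dInd φ u (ξ + η) = dInd φ u ξ + dInd φ u η :=
  (mfderiv (IStar n) 𝓘(ℝ, E n × E n) (indChart φ) u).map_add ξ η

theorem dInd_smul (φ : OpenPartialHomeomorph M (E n)) (u : TStar n M) (c : ℝ)
    (ξ : TangentSpace (IStar n) u) : dInd φ u (c • ξ) = c • dInd φ u ξ :=
  (mfderiv (IStar n) 𝓘(ℝ, E n × E n) (indChart φ) u).map_smul c ξ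

theorem covQ_eq (φ : OpenPartialHomeomorph M (E n)) (i : Fin n) (u : TStar n M)
    (ξ : TangentSpace (IStar n) u) : covQ φ i u ξ = (dInd φ u ξ).1 i := rfl

theorem sum_christoffelZero_mul (g : Metric n M) (φ : OpenPartialHomeomorph M (E n)) (i : Fin n)
    (y p v : E n) : ∑ j, christoffelZero g φ i j y p * v j =
      ∑ k, p k * christoffelForm g φ y v (e i) k := by
  have h : ∀ k, christoffelForm g φ y v (e i) k = ∑ j, christoffel g φ k i j y * v j := by
    intro k
    rw [christoffelForm_symm]
    conv_lhs => rw [← sum_smul_e v]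
    simp only [map_sum, map_smul, WithLp.ofLp_sum, Finset.sum_apply, PiLp.smul_apply,
      smul_eq_mul, christoffelForm_e]
    exact Finset.sum_congr rfl fun j _ => mul_comm _ _
  simp only [h, christoffelZero, Finset.sum_mul, Finset.mul_sum]
  rw [Finset.sum_comm]
  exact Finset.sum_congr rfl fun k _ => Finset.sum_congr rfl fun j _ => by ring

theorem covP_eq (g : Metric n M) (φ : OpenPartialHomeomorph M (E n)) (i : Fin n) (u : TStar n M)
    (ξ : TangentSpace (IStar n) u) : covP g φ i u ξ = (dInd φ u ξ).2 i -
      ∑ k, (indChart φ u).2 k * christoffelForm g φ (φ u.1) (dInd φ u ξ).1 (e i) k := by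
  rw [← sum_christoffelZero_mul]
  rfl

theorem covQ_add (φ : OpenPartialHomeomorph M (E n)) (i : Fin n) (u : TStar n M)
    (ξ η : TangentSpace (IStar n) u) : covQ φ i u (ξ + η) = covQ φ i u ξ + covQ φ i u η := by
  simp only [covQ_eq, dInd_add, Prod.fst_add, PiLp.add_apply]

theorem covQ_smul (φ : OpenPartialHomeomorph M (E n)) (i : Fin n) (u : TStar n M) (c : ℝ)
    (ξ : TangentSpace (IStar n) u) : covQ φ i u (c • ξ) = c * covQ φ i u ξ := by
  simp only [covQ_eq, dInd_smul, Prod.smul_fst, PiLp.smul_apply, smul_eq_mul]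

theorem covP_add (g : Metric n M) (φ : OpenPartialHomeomorph M (E n)) (i : Fin n) (u : TStar n M)
    (ξ η : TangentSpace (IStar n) u) :
    covP g φ i u (ξ + η) = covP g φ i u ξ + covP g φ i u η := by
  have h : ∀ ξ, covP g φ i u ξ = (dInd φ u ξ).2 i - ∑ j, christoffelZero g φ i j (indChart φ u).1
    (indChart φ u).2 * covQ φ j u ξ := fun _ => rfl
  simp only [h, covQ_add, dInd_add, Prod.snd_add, PiLp.add_apply, mul_add, Finset.sum_add_distrib]
  ring

theorem covP_smul (g : Metric n M) (φ : OpenPartialHomeomorph M (E n)) (i : Fin n) (u : TStar n M)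
    (c : ℝ) (ξ : TangentSpace (IStar n) u) : covP g φ i u (c • ξ) = c * covP g φ i u ξ := by
  have h : ∀ ξ, covP g φ i u ξ = (dInd φ u ξ).2 i - ∑ j, christoffelZero g φ i j (indChart φ u).1
    (indChart φ u).2 * covQ φ j u ξ := fun _ => rfl
  simp only [h, covQ_smul, dInd_smul, Prod.smul_snd, PiLp.smul_apply, smul_eq_mul, mul_sub,
    Finset.mul_sum, mul_left_comm c]

/-- `covQ φ i u` as a linear map. -/
def covQₗ (φ : OpenPartialHomeomorph M (E n)) (i : Fin n) (u : TStar n M) :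
    TangentSpace (IStar n) u →ₗ[ℝ] ℝ where
  toFun := covQ φ i u
  map_add' := covQ_add φ i u
  map_smul' := covQ_smul φ i u

/-- `covP g φ i u` as a linear map. -/
def covPₗ (g : Metric n M) (φ : OpenPartialHomeomorph M (E n)) (i : Fin n) (u : TStar n M) :
    TangentSpace (IStar n) u →ₗ[ℝ] ℝ where
  toFun := covP g φ i u
  map_add' := covP_add g φ i u
  map_smul' := covP_smul g φ i u

theorem covQ_neg (φ : OpenPartialHomeomorph M (E n)) (i : Fin n) (u : TStar n M)
    (ξ : TangentSpace (IStar n) u) : covQ φ i u (-ξ) = -covQ φ i u ξ := map_neg (covQₗ φ i u) ξ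

theorem covQ_sub (φ : OpenPartialHomeomorph M (E n)) (i : Fin n) (u : TStar n M)
    (ξ η : TangentSpace (IStar n) u) : covQ φ i u (ξ - η) = covQ φ i u ξ - covQ φ i u η :=
  map_sub (covQₗ φ i u) ξ η

theorem covQ_sum (φ : OpenPartialHomeomorph M (E n)) (i : Fin n) (u : TStar n M)
    (ξ : Fin n → TangentSpace (IStar n) u) : covQ φ i u (∑ k, ξ k) = ∑ k, covQ φ i u (ξ k) :=
  map_sum (covQₗ φ i u) ξ _

theorem covP_neg (g : Metric n M) (φ : OpenPartialHomeomorph M (E n)) (i : Fin n) (u : TStar n M)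
    (ξ : TangentSpace (IStar n) u) : covP g φ i u (-ξ) = -covP g φ i u ξ :=
  map_neg (covPₗ g φ i u) ξ

theorem covP_sub (g : Metric n M) (φ : OpenPartialHomeomorph M (E n)) (i : Fin n) (u : TStar n M)
    (ξ η : TangentSpace (IStar n) u) : covP g φ i u (ξ - η) = covP g φ i u ξ - covP g φ i u η :=
  map_sub (covPₗ g φ i u) ξ η

theorem covP_sum (g : Metric n M) (φ : OpenPartialHomeomorph M (E n)) (i : Fin n) (u : TStar n M)
    (ξ : Fin n → TangentSpace (IStar n) u) : covP g φ i u (∑ k, ξ k) = ∑ k, covP g φ i u (ξ k) :=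
  map_sum (covPₗ g φ i u) ξ _

/-- A tangent vector is determined by its components in the adapted coframe. -/
theorem ext_cov (g : Metric n M) {φ : OpenPartialHomeomorph M (E n)} (hφ : IsChart φ)
    {u : TStar n M} (hu : u.1 ∈ φ.source) {ξ η : TangentSpace (IStar n) u}
    (hq : ∀ i, covQ φ i u ξ = covQ φ i u η) (hp : ∀ i, covP g φ i u ξ = covP g φ i u η) :
    ξ = η := by
  have h1 : (dInd φ u ξ).1 = (dInd φ u η).1 := by
    ext i
    exact hq i
  rw [← indInv_dInd hφ hu ξ, ← indInv_dInd hφ hu η]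
  congr 1
  refine Prod.ext h1 ?_
  ext i
  have h2 := hp i
  rwa [covP_eq, covP_eq, h1, sub_left_inj] at h2

/-- The components of `δ/δqⁱ` in the induced chart. -/
def flatDelta (g : Metric n M) (φ : OpenPartialHomeomorph M (E n)) (i : Fin n) (z : E n × E n) :
    E n × E n :=
  (e i, ∑ h, christoffelZero g φ i h z.1 z.2 • (e h : E n))

theorem dP_eq_liftField (φ : OpenPartialHomeomorph M (E n)) (i : Fin n) :
    dP φ i = liftField (M := M) φ (fun _ => (0, e i)) := rfl

theorem clm_add_sum_smul {V W : Type*} [AddCommGroup V] [Module ℝ V] [TopologicalSpace V]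
    [AddCommGroup W] [Module ℝ W] [TopologicalSpace W] (L : V →L[ℝ] W) (a : V) (c : Fin n → ℝ)
    (b : Fin n → V) : L (a + ∑ h, c h • b h) = L a + ∑ h, c h • L (b h) := by
  simp only [map_add, map_sum, map_smul]

/-- The adapted frame consists of lifts of explicit fields on ℝⁿ × ℝⁿ; its differentiability and
brackets are computed there. -/
theorem delta_eq_liftField (g : Metric n M) (φ : OpenPartialHomeomorph M (E n)) (i : Fin n) :
    delta g φ i = liftField φ (flatDelta g φ i) := by
  funext u
  have h1 : dQ φ i u = indInv φ u (e i, 0) := rfl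
  have h3 : flatDelta g φ i (indChart φ u) = (e i, 0) +
      ∑ h, christoffelZero g φ i h (indChart φ u).1 (indChart φ u).2 • ((0, e h) : E n × E n) := by
    refine Prod.ext ?_ ?_ <;> simp [flatDelta, Prod.fst_sum, Prod.snd_sum]
  rw [liftField_apply, h3, clm_add_sum_smul, delta, h1]
  rfl

section Frame

variable (g : Metric n M) {φ : OpenPartialHomeomorph M (E n)} {u : TStar n M}

theorem dInd_dP (hφ : IsChart φ) (hu : u.1 ∈ φ.source) (i : Fin n) :
    dInd φ u (dP φ i u) = (0, e i) :=
  dInd_indInv hφ hu _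

theorem dInd_delta (hφ : IsChart φ) (hu : u.1 ∈ φ.source) (i : Fin n) :
    dInd φ u (delta g φ i u) = flatDelta g φ i (indChart φ u) := by
  rw [delta_eq_liftField]
  exact dInd_indInv hφ hu _

theorem covQ_dP (hφ : IsChart φ) (hu : u.1 ∈ φ.source) (i j : Fin n) :
    covQ φ j u (dP φ i u) = 0 := by
  rw [covQ_eq, dInd_dP hφ hu]
  rfl

theorem covQ_delta (hφ : IsChart φ) (hu : u.1 ∈ φ.source) (i j : Fin n) :
    covQ φ j u (delta g φ i u) = if j = i then 1 else 0 := by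
  rw [covQ_eq, dInd_delta g hφ hu]
  exact e_apply i j

theorem covP_dP (hφ : IsChart φ) (hu : u.1 ∈ φ.source) (i j : Fin n) :
    covP g φ j u (dP φ i u) = if j = i then 1 else 0 := by
  rw [covP_eq, dInd_dP hφ hu]
  simp [e_apply]

theorem covP_delta (hφ : IsChart φ) (hu : u.1 ∈ φ.source) (i j : Fin n) :
    covP g φ j u (delta g φ i u) = 0 := by
  rw [covP_eq, dInd_delta g hφ hu]
  simp only [flatDelta]
  have h := sum_christoffelZero_mul g φ j (φ u.1) (indChart φ u).2 (e i)
  simp only [e_apply, mul_ite, mul_one, mul_zero, Finset.sum_ite_eq', Finset.mem_univ,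
    if_true] at h
  rw [← h, sub_eq_zero]
  have h2 : christoffelZero g φ j i (φ u.1) (indChart φ u).2 =
      christoffelZero g φ i j (φ u.1) (indChart φ u).2 := by
    simp only [christoffelZero, christoffel_symm g φ _ i j]
  rw [sum_smul_e (n := n) (WithLp.toLp 2 fun h => _), h2]
  rfl

theorem covQ_change {ψ : OpenPartialHomeomorph M (E n)} (hφ : IsChart φ) (hψ : IsChart ψ)
    (hu : u.1 ∈ φ.source) (hu' : u.1 ∈ ψ.source) (ξ : TangentSpace (IStar n) u) (a : Fin n) :
    covQ ψ a u ξ = ∑ i, jac φ ψ u.1 a i * covQ φ i u ξ := by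
  simp only [covQ_eq]
  rw [dInd_change_fst hφ hψ hu hu', fderiv_chartChange_apply]

/-- The second derivatives of the change of charts in `dInd_change_snd` cancel those in
`christoffelForm_change`. This is the reason for the Christoffel term in `Dpᵢ`. -/
theorem covP_change {ψ : OpenPartialHomeomorph M (E n)} (hφ : IsChart φ) (hψ : IsChart ψ)
    (hu : u.1 ∈ φ.source) (hu' : u.1 ∈ ψ.source) (ξ : TangentSpace (IStar n) u) (i : Fin n) :
    covP g φ i u ξ = ∑ a, jac φ ψ u.1 a i * covP g ψ a u ξ := by
  set v := (dInd φ u ξ).1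
  set p := (indChart ψ u).2
  have h1 : ∑ k, (indChart φ u).2 k * christoffelForm g φ (φ u.1) v (e i) k =
      ∑ a, p a * (fderiv ℝ (chartChange φ ψ) (φ u.1) (christoffelForm g φ (φ u.1) v (e i))) a := by
    simp only [fderiv_chartChange_apply, indChart_snd_eq_sum hφ hψ hu hu', Finset.mul_sum,
      Finset.sum_mul]
    rw [Finset.sum_comm]
    exact Finset.sum_congr rfl fun a _ => Finset.sum_congr rfl fun k _ => by ring
  have h2 : ∀ c, christoffelForm g ψ (ψ u.1) (fderiv ℝ (chartChange φ ψ) (φ u.1) v)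
      (fderiv ℝ (chartChange φ ψ) (φ u.1) (e i)) c = ∑ a, jac φ ψ u.1 a i *
        christoffelForm g ψ (ψ u.1) (fderiv ℝ (chartChange φ ψ) (φ u.1) v) (e a) c := by
    intro c
    rw [← sum_smul_e (fderiv ℝ (chartChange φ ψ) (φ u.1) (e i))]
    simp only [map_sum, map_smul, WithLp.ofLp_sum, Finset.sum_apply, PiLp.smul_apply,
      smul_eq_mul, jac_eq]
  have h3 : ∑ a, p a * ∑ b, jac φ ψ u.1 b i *
        christoffelForm g ψ (ψ u.1) (fderiv ℝ (chartChange φ ψ) (φ u.1) v) (e b) a =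
      ∑ b, jac φ ψ u.1 b i * ∑ a, p a *
        christoffelForm g ψ (ψ u.1) (fderiv ℝ (chartChange φ ψ) (φ u.1) v) (e b) a := by
    simp only [Finset.mul_sum]
    rw [Finset.sum_comm]
    exact Finset.sum_congr rfl fun a _ => Finset.sum_congr rfl fun k _ => by ring
  rw [covP_eq, h1, christoffelForm_change g hφ hψ hu hu', dInd_change_snd hφ hψ hu hu']
  simp only [covP_eq, PiLp.add_apply, mul_add, Finset.sum_add_distrib, h2, h3,
    dInd_change_fst hφ hψ hu hu' ξ, mul_sub, Finset.sum_sub_distrib]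
  have h4 : ∀ a, p a * (fderiv ℝ (fderiv ℝ (chartChange φ ψ)) (φ u.1) v (e i)) a =
    (fderiv ℝ (fderiv ℝ (chartChange φ ψ)) (φ u.1) v (e i)) a * p a := fun a => mul_comm _ _
  simp only [h4, jac_eq]
  ring

/-- The components `dqⁱ(ξ)`. -/
def vecQ (φ : OpenPartialHomeomorph M (E n)) (u : TStar n M) (ξ : TangentSpace (IStar n) u) :
    Fin n → ℝ := fun i => covQ φ i u ξ

/-- The components `Dpᵢ(ξ)`. -/
def vecP (φ : OpenPartialHomeomorph M (E n)) (u : TStar n M) (ξ : TangentSpace (IStar n) u) :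
    Fin n → ℝ := fun i => covP g φ i u ξ

theorem vecQ_change {ψ : OpenPartialHomeomorph M (E n)} (hφ : IsChart φ) (hψ : IsChart ψ)
    (hu : u.1 ∈ φ.source) (hu' : u.1 ∈ ψ.source) (ξ : TangentSpace (IStar n) u) :
    vecQ ψ u ξ = (Matrix.of (jac φ ψ u.1)).mulVec (vecQ φ u ξ) :=
  funext fun a => covQ_change hφ hψ hu hu' ξ a

theorem vecP_change {ψ : OpenPartialHomeomorph M (E n)} (hφ : IsChart φ) (hψ : IsChart ψ)
    (hu : u.1 ∈ φ.source) (hu' : u.1 ∈ ψ.source) (ξ : TangentSpace (IStar n) u) :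
    vecP g ψ u ξ = (Matrix.of (jac ψ φ u.1)).transpose.mulVec (vecP g φ u ξ) :=
  funext fun a => covP_change g hψ hφ hu' hu ξ a

theorem dotProduct_conj {ι : Type*} [Fintype ι] [DecidableEq ι] {J K : Matrix ι ι ℝ}
    (h : K * J = 1) (A : Matrix ι ι ℝ) (x y : ι → ℝ) :
    J.mulVec x ⬝ᵥ (K.transpose * A * K).mulVec (J.mulVec y) = x ⬝ᵥ A.mulVec y := by
  rw [Matrix.mulVec_mulVec, Matrix.mul_assoc, h, Matrix.mul_one, ← Matrix.mulVec_mulVec,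
    Matrix.dotProduct_mulVec, Matrix.vecMul_transpose, Matrix.mulVec_mulVec, h, Matrix.one_mulVec]

/-- The definition of G uses the preferred chart, which varies with the point. Tensoriality of G⁽¹⁾,
G₍₂₎, dqⁱ and Dpᵢ gives the same formula in a fixed chart, where G can be differentiated. -/
theorem metricG_eq_dotProduct (w : MetricCoeffs) (hφ : IsChart φ) (hu : u.1 ∈ φ.source)
    (ξ η : TangentSpace (IStar n) u) : metricG g w u ξ η =
      vecQ φ u ξ ⬝ᵥ (G1 g w φ (φ u.1) (indChart φ u).2).mulVec (vecQ φ u η) +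
      vecP g φ u ξ ⬝ᵥ (G2 g w φ (φ u.1) (indChart φ u).2).mulVec (vecP g φ u η) := by
  set ψ := chartAt (E n) u.1
  have hψ : IsChart ψ := isChart_chartAt u.1
  have hu' : u.1 ∈ ψ.source := mem_chart_source _ _
  have h0 : metricG g w u ξ η =
      vecQ ψ u ξ ⬝ᵥ (G1 g w ψ (ψ u.1) (indChart ψ u).2).mulVec (vecQ ψ u η) +
      vecP g ψ u ξ ⬝ᵥ (G2 g w ψ (ψ u.1) (indChart ψ u).2).mulVec (vecP g ψ u η) := by
    simp only [dotProduct, Matrix.mulVec, Finset.mul_sum, ← Finset.sum_add_distrib]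
    exact Finset.sum_congr rfl fun i _ => Finset.sum_congr rfl fun j _ => by
      simp only [vecQ, vecP, ψ, indChart_fst]
      ring
  have hK := jac_mul_jac hφ hψ hu hu'
  have hK' : (Matrix.of (jac φ ψ u.1)).transpose * (Matrix.of (jac ψ φ u.1)).transpose = 1 := by
    rw [← Matrix.transpose_mul, hK, Matrix.transpose_one]
  have hG1 := natLow_change g w.c₁ w.d₁ hφ hψ hu hu' (indChart ψ u).2
  have hG2 := natUp_change g w.c₂ w.d₂ hφ hψ hu hu' (indChart ψ u).2
  rw [coPull_indChart hφ hψ hu hu'] at hG1 hG2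
  rw [h0, vecQ_change hφ hψ hu hu', vecQ_change hφ hψ hu hu', vecP_change g hφ hψ hu hu',
    vecP_change g hφ hψ hu hu', G1, hG1, G2, hG2, dotProduct_conj hK]
  -- Writing the Jacobian as a double transpose gives G₍₂₎ the form KᵀAK required by
  -- `dotProduct_conj`, now with the transposed Jacobians.
  conv_lhs =>
    enter [2, 2, 1, 1, 1]
    rw [← Matrix.transpose_transpose (Matrix.of (jac φ ψ u.1))]
  rw [dotProduct_conj hK']
  rfl

/-- Independence of the chart for J, for the same reason as for G: J exchanges the two kinds of
components through M-tensor fields. -/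
theorem vec_tensorJ (a : ComplexCoeffs) (hφ : IsChart φ) (hu : u.1 ∈ φ.source)
    (ξ : TangentSpace (IStar n) u) :
    vecQ φ u (tensorJ g a u ξ) =
      -Matrix.vecMul (vecP g φ u ξ) (natUp g a.a₂ a.b₂ φ (φ u.1) (indChart φ u).2) ∧
    vecP g φ u (tensorJ g a u ξ) =
      Matrix.vecMul (vecQ φ u ξ) (natLow g a.a₁ a.b₁ φ (φ u.1) (indChart φ u).2) := by
  set ψ := chartAt (E n) u.1
  have hψ : IsChart ψ := isChart_chartAt u.1
  have hu' : u.1 ∈ ψ.source := mem_chart_source _ _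
  have h1 : vecQ ψ u (tensorJ g a u ξ) =
      -Matrix.vecMul (vecP g ψ u ξ) (natUp g a.a₂ a.b₂ ψ (ψ u.1) (indChart ψ u).2) := by
    funext k
    simp only [vecQ, tensorJ, covQ_sum, covQ_sub, covQ_smul, covQ_dP hψ hu', ψ,
      covQ_delta g hψ hu', Pi.neg_apply, Matrix.vecMul, dotProduct]
    simp [vecP, indChart_fst]
  have h2 : vecP g ψ u (tensorJ g a u ξ) =
      Matrix.vecMul (vecQ ψ u ξ) (natLow g a.a₁ a.b₁ ψ (ψ u.1) (indChart ψ u).2) := by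
    funext k
    simp only [vecP, tensorJ, covP_sum, covP_sub, covP_smul, covP_dP g hψ hu', ψ,
      covP_delta g hψ hu', Matrix.vecMul, dotProduct]
    simp [vecQ, indChart_fst]
  have hK := jac_mul_jac hφ hψ hu hu'
  have hL := natLow_change g a.a₁ a.b₁ hφ hψ hu hu' (indChart ψ u).2
  have hU := natUp_change g a.a₂ a.b₂ hφ hψ hu hu' (indChart ψ u).2
  rw [coPull_indChart hφ hψ hu hu'] at hL hU
  constructor
  · rw [vecQ_change hψ hφ hu' hu, h1, vecP_change g hφ hψ hu hu', hU, Matrix.mulVec_neg,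
      Matrix.mulVec_transpose, Matrix.vecMul_vecMul, ← Matrix.vecMul_transpose,
      Matrix.vecMul_vecMul]
    congr 2
    rw [Matrix.mul_assoc, Matrix.mul_assoc, ← Matrix.transpose_mul, hK, Matrix.transpose_one,
      Matrix.mul_one, ← Matrix.mul_assoc, hK, Matrix.one_mul]
  · rw [vecP_change g hψ hφ hu' hu, h2, vecQ_change hφ hψ hu hu', hL, Matrix.mulVec_transpose,
      ← Matrix.vecMul_transpose, Matrix.vecMul_vecMul, Matrix.vecMul_vecMul]
    congr 1
    rw [Matrix.mul_assoc, Matrix.mul_assoc, hK, Matrix.mul_one, ← Matrix.mul_assoc,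
      ← Matrix.transpose_mul, hK, Matrix.transpose_one, Matrix.one_mul]

end Frame

/-! ### Differentiation in an induced chart -/

section Lift

variable {φ : OpenPartialHomeomorph M (E n)} {u : TStar n M}

theorem mdifferentiableAt_flat {X : E n × E n → E n × E n} {z : E n × E n}
    (hX : ContDiffAt ℝ ∞ X z) : MDifferentiableAt 𝓘(ℝ, E n × E n) 𝓘(ℝ, E n × E n).tangent
      (fun z => (⟨z, X z⟩ : TangentBundle 𝓘(ℝ, E n × E n) (E n × E n))) z :=
  (contMDiffAt_vectorSpace_iff_contDiffAt.2 hX).mdifferentiableAt (by simp)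

theorem diffAt_liftField (hφ : IsChart φ) (hu : u.1 ∈ φ.source) {X : E n × E n → E n × E n}
    (hX : ContDiffAt ℝ ∞ X (indChart φ u)) : DiffAt (liftField φ X) u :=
  MDifferentiableAt.mpullback_vectorField (n := ∞) (mdifferentiableAt_flat hX)
    (contMDiffAt_indChart hφ hu) (isInvertible_mfderiv_indChart hφ hu) (by norm_cast)

theorem isManifold_TStar : IsManifold (IStar n) (minSmoothness ℝ 2) (TStar n M) := by
  rw [minSmoothness_of_isRCLikeNormedField]
  have h : IsManifold (IStar n) ∞ (TStar n M) := inferInstance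
  exact IsManifold.of_le (n := ∞) (by norm_cast)

/-- The bracket is natural under pullback by a local diffeomorphism, and on ℝⁿ × ℝⁿ it is DY·X −
DX·Y. -/
theorem mlieBracket_liftField (hφ : IsChart φ) (hu : u.1 ∈ φ.source)
    {X Y : E n × E n → E n × E n} (hX : ContDiffAt ℝ ∞ X (indChart φ u))
    (hY : ContDiffAt ℝ ∞ Y (indChart φ u)) :
    mlieBracket (IStar n) (liftField φ X) (liftField φ Y) u =
      indInv φ u (fderiv ℝ Y (indChart φ u) (X (indChart φ u)) -
        fderiv ℝ X (indChart φ u) (Y (indChart φ u))) := by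
  have := isManifold_TStar (n := n) (M := M)
  have h := mpullback_mlieBracket (n := ∞) (mdifferentiableAt_flat hX) (mdifferentiableAt_flat hY)
    (contMDiffAt_indChart hφ hu) (by
      rw [minSmoothness_of_isRCLikeNormedField]
      norm_cast)
  rw [liftField, liftField, ← h, mpullback_apply]
  have h2 : mlieBracket 𝓘(ℝ, E n × E n) (M := E n × E n) X Y = lieBracket ℝ X Y :=
    mlieBracketWithin_univ.symm.trans
      (mlieBracketWithin_eq_lieBracketWithin.trans lieBracketWithin_univ)
  rw [h2]
  rfl

theorem dirDeriv_eq_fderiv (hφ : IsChart φ) (hu : u.1 ∈ φ.source) {F : TStar n M → ℝ}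
    {f : E n × E n → ℝ} (hF : ∀ v : TStar n M, v.1 ∈ φ.source → F v = f (indChart φ v))
    (hf : DifferentiableAt ℝ f (indChart φ u)) (ξ : TangentSpace (IStar n) u) :
    dirDeriv F u ξ = fderiv ℝ f (indChart φ u) (dInd φ u ξ) := by
  have h1 : F =ᶠ[𝓝 u] f ∘ indChart φ := (eventually_mem_source φ hu).mono fun v hv => hF v hv
  have h2 := HasMFDerivAt.comp u hf.hasFDerivAt.hasMFDerivAt (hasMFDerivAt_indChart hφ hu)
  have h3 := (h2.congr_of_eventuallyEq h1).mfderiv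
  rw [dirDeriv, h3]
  rfl

end Lift

/-! ### Derivatives along the horizontal fields δ/δqᵏ. -/

section Horizontal

variable (g : Metric n M) {φ : OpenPartialHomeomorph M (E n)} {z : E n × E n}

/-- The matrix `(Γ^l_{ki})_{l,i}`. -/
def christoffelMatrix (φ : OpenPartialHomeomorph M (E n)) (k : Fin n) (y : E n) :
    Matrix (Fin n) (Fin n) ℝ :=
  Matrix.of fun l i => christoffel g φ l k i y

/-- Horizontal derivatives are taken along the straight line through `z` with velocity `flatDelta g
φ k z`; it need not be an integral curve, since only its tangent at 0 counts. -/
theorem hasDerivAt_horizontal_fst {f : E n → ℝ} (hf : DifferentiableAt ℝ f z.1) (k : Fin n) :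
    HasDerivAt (fun s : ℝ => f (z + s • flatDelta g φ k z).1) (pd k f z.1) 0 := by
  have h : HasFDerivAt (fun z : E n × E n => f z.1)
      ((fderiv ℝ f z.1).comp (ContinuousLinearMap.fst ℝ (E n) (E n))) z :=
    HasFDerivAt.comp (g := f) z hf.hasFDerivAt hasFDerivAt_fst
  exact h.hasLineDerivAt (flatDelta g φ k z)

theorem hasDerivAt_horizontal_gLow (hφ : IsChart φ) (hz : z.1 ∈ φ.target) (k i j : Fin n) :
    HasDerivAt (fun s : ℝ => gLow g φ (z + s • flatDelta g φ k z).1 i j)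
      (((christoffelMatrix g φ k z.1).transpose * gLow g φ z.1 +
        gLow g φ z.1 * christoffelMatrix g φ k z.1) i j) 0 := by
  have h := hasDerivAt_horizontal_fst g (φ := φ)
    ((contDiffAt_gLow g hφ hz i j).differentiableAt (by simp)) k
  have h2 : pd k (fun y => gLow g φ y i j) z.1 = ((christoffelMatrix g φ k z.1).transpose *
      gLow g φ z.1 + gLow g φ z.1 * christoffelMatrix g φ k z.1) i j := by
    rw [pd_gLow g hφ hz, fderiv_metricForm g hφ hz]
    simp only [metricForm_apply, christoffelForm_e, e_apply, Matrix.add_apply, Matrix.mul_apply,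
      christoffelMatrix, Matrix.transpose_apply, Matrix.of_apply]
    simp [mul_comm]
  rwa [h2] at h

theorem hasDerivAt_horizontal_gUp (hφ : IsChart φ) (hz : z.1 ∈ φ.target) (k i j : Fin n) :
    HasDerivAt (fun s : ℝ => gUp g φ (z + s • flatDelta g φ k z).1 i j)
      ((-(gUp g φ z.1 * (christoffelMatrix g φ k z.1).transpose +
        christoffelMatrix g φ k z.1 * gUp g φ z.1)) i j) 0 := by
  set B' : Matrix (Fin n) (Fin n) ℝ := Matrix.of fun i j => pd k (fun y => gUp g φ y i j) z.1
  set C := christoffelMatrix g φ k z.1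
  have h1 : ∀ i j, HasDerivAt (fun s : ℝ => gUp g φ (z + s • flatDelta g φ k z).1 i j) (B' i j) 0 :=
    fun i j => hasDerivAt_horizontal_fst g (φ := φ)
      ((contDiffAt_gUp g hφ hz i j).differentiableAt (by simp)) k
  -- The identity g g⁻¹ = 1, differentiated along the line, which stays in the chart for small s.
  have h2 : (C.transpose * gLow g φ z.1 + gLow g φ z.1 * C) * gUp g φ z.1 +
      gLow g φ z.1 * B' = 0 := by
    ext i j
    have h3 := HasDerivAt.fun_sum (u := Finset.univ) fun l _ =>
      (hasDerivAt_horizontal_gLow g hφ hz k i l).mul (h1 l j)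
    have h4 : (fun s : ℝ => ∑ l, gLow g φ (z + s • flatDelta g φ k z).1 i l *
        gUp g φ (z + s • flatDelta g φ k z).1 l j) =ᶠ[𝓝 0]
        fun _ => (1 : Matrix (Fin n) (Fin n) ℝ) i j := by
      have hc : ContinuousAt (fun s : ℝ => (z + s • flatDelta g φ k z).1) 0 := by fun_prop
      have h5 := hc.eventually (p := fun y => y ∈ φ.target)
        (φ.open_target.mem_nhds (by simpa using hz))
      filter_upwards [h5] with s hs
      rw [← gLow_mul_gUp g hφ hs, Matrix.mul_apply]
    have h6 := h3.unique ((hasDerivAt_const 0 _).congr_of_eventuallyEq h4)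
    simp only [zero_smul, add_zero] at h6
    rw [Finset.sum_add_distrib] at h6
    rw [Matrix.add_apply, Matrix.mul_apply, Matrix.mul_apply]
    exact h6
  have h3 : B' = -(gUp g φ z.1 * C.transpose + C * gUp g φ z.1) := by
    have h4 := congrArg (fun N => gUp g φ z.1 * N) h2
    simp only [Matrix.mul_add, Matrix.add_mul, Matrix.mul_assoc, gLow_mul_gUp g hφ hz,
      Matrix.mul_one, Matrix.mul_zero] at h4
    simp only [← Matrix.mul_assoc, gUp_mul_gLow g hφ hz, Matrix.one_mul] at h4
    exact (neg_eq_of_add_eq_zero_right h4).symm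
  rw [← h3]
  exact h1 i j

theorem hasDerivAt_horizontal_snd (k i : Fin n) :
    HasDerivAt (fun s : ℝ => (z + s • flatDelta g φ k z).2 i)
      (Matrix.vecMul z.2 (christoffelMatrix g φ k z.1) i) 0 := by
  have h : HasFDerivAt (fun z : E n × E n => z.2 i)
      ((coordCLM i).comp (ContinuousLinearMap.snd ℝ (E n) (E n))) z :=
    ((coordCLM i).comp (ContinuousLinearMap.snd ℝ (E n) (E n))).hasFDerivAt
  have h2 := h.hasLineDerivAt (flatDelta g φ k z)
  have h3 : ((coordCLM i).comp (ContinuousLinearMap.snd ℝ (E n) (E n))) (flatDelta g φ k z) =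
      Matrix.vecMul z.2 (christoffelMatrix g φ k z.1) i := by
    simp [flatDelta, e_apply, christoffelZero, Matrix.vecMul, dotProduct, christoffelMatrix]
  rw [h3] at h2
  exact h2

theorem hasDerivAt_horizontal_pUp (hφ : IsChart φ) (hz : z.1 ∈ φ.target) (k i : Fin n) :
    HasDerivAt (fun s : ℝ => pUp g φ (z + s • flatDelta g φ k z).1
        (z + s • flatDelta g φ k z).2 i)
      (-Matrix.mulVec (christoffelMatrix g φ k z.1) (pUp g φ z.1 z.2) i) 0 := by
  have h := HasDerivAt.fun_sum (u := Finset.univ) fun l _ =>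
    (hasDerivAt_horizontal_snd g (φ := φ) (z := z) k l).mul
      (hasDerivAt_horizontal_gUp g hφ hz k l i)
  simp only [zero_smul, add_zero] at h
  refine h.congr_deriv ?_
  rw [Finset.sum_add_distrib]
  set C := christoffelMatrix g φ k z.1
  have h1 : ∑ l, Matrix.vecMul z.2 C l * gUp g φ z.1 l i =
      Matrix.vecMul z.2 (C * gUp g φ z.1) i := by
    rw [← Matrix.vecMul_vecMul]
    rfl
  have h2 : ∑ l, z.2 l * (-(gUp g φ z.1 * C.transpose + C * gUp g φ z.1)) l i =
      -(Matrix.vecMul z.2 (gUp g φ z.1 * C.transpose) i +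
        Matrix.vecMul z.2 (C * gUp g φ z.1) i) := by
    simp only [Matrix.neg_apply, Matrix.add_apply, mul_neg, mul_add, Finset.sum_neg_distrib,
      Finset.sum_add_distrib]
    rfl
  rw [h1, h2, ← Matrix.vecMul_vecMul _ _ C.transpose, Matrix.vecMul_transpose]
  have h3 : Matrix.vecMul z.2 (gUp g φ z.1) = pUp g φ z.1 z.2 := rfl
  rw [h3]
  ring

/-- In t = ½ p_l g^{0l} the factor p_l is moved by the Christoffel matrix and g^{0l} by its
negative: parallel transport preserves length. -/
theorem hasDerivAt_horizontal_energy (hφ : IsChart φ) (hz : z.1 ∈ φ.target) (k : Fin n) :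
    HasDerivAt (fun s : ℝ => energy g φ (z + s • flatDelta g φ k z).1
        (z + s • flatDelta g φ k z).2) 0 0 := by
  simp only [energy_eq]
  have h := HasDerivAt.fun_sum (u := Finset.univ) fun l _ =>
    (hasDerivAt_horizontal_snd g (φ := φ) (z := z) k l).mul
      (hasDerivAt_horizontal_pUp g hφ hz k l)
  simp only [zero_smul, add_zero] at h
  refine (h.const_mul (1 / 2 : ℝ)).congr_deriv ?_
  rw [Finset.sum_add_distrib]
  simp only [mul_neg, Finset.sum_neg_distrib]
  have h2 := Matrix.dotProduct_mulVec (z.2 : Fin n → ℝ) (christoffelMatrix g φ k z.1)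
    (pUp g φ z.1 z.2)
  simp only [dotProduct] at h2
  rw [h2]
  ring

theorem hasDerivAt_horizontal_comp_energy (hφ : IsChart φ) (hz : z.1 ∈ φ.target) (hp : z.2 ≠ 0)
    {f : ℝ → ℝ} (hf : ContDiffOn ℝ ∞ f (Set.Ioi 0)) (k : Fin n) :
    HasDerivAt (fun s : ℝ => f (energy g φ (z + s • flatDelta g φ k z).1
        (z + s • flatDelta g φ k z).2)) 0 0 := by
  have h1 : HasDerivAt f (deriv f (energy g φ z.1 z.2)) (energy g φ z.1 z.2) :=
    ((hf.contDiffAt (Ioi_mem_nhds (energy_pos g hφ hz hp))).differentiableAt (by simp)).hasDerivAt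
  have h2 := HasDerivAt.comp (h₂ := f) (0 : ℝ) (by
    simp only [zero_smul, add_zero]
    exact h1)
    (hasDerivAt_horizontal_energy g hφ hz k)
  rw [mul_zero] at h2
  exact h2

/-- The coefficients depend on the energy alone and do not change; g_{ij} and p_i p_j are moved by
the same Christoffel matrix. -/
theorem fderiv_natLow_horizontal (hφ : IsChart φ) (hz : z.1 ∈ φ.target) (hp : z.2 ≠ 0)
    {f h : ℝ → ℝ} (hf : ContDiffOn ℝ ∞ f (Set.Ioi 0)) (hh : ContDiffOn ℝ ∞ h (Set.Ioi 0))
    (k i j : Fin n) :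
    fderiv ℝ (fun z : E n × E n => natLow g f h φ z.1 z.2 i j) z (flatDelta g φ k z) =
      ((christoffelMatrix g φ k z.1).transpose * natLow g f h φ z.1 z.2 +
        natLow g f h φ z.1 z.2 * christoffelMatrix g φ k z.1) i j := by
  have h1 := ((contDiffAt_natLow g hφ hz hp hf hh i j).differentiableAt
    (by simp)).hasFDerivAt.hasLineDerivAt (flatDelta g φ k z)
  refine HasDerivAt.unique h1 ?_
  have h2 := ((hasDerivAt_horizontal_comp_energy g hφ hz hp hf k).mul
    (hasDerivAt_horizontal_gLow g hφ hz k i j)).add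
    (((hasDerivAt_horizontal_comp_energy g hφ hz hp hh k).mul
      (hasDerivAt_horizontal_snd g (φ := φ) (z := z) k i)).mul (hasDerivAt_horizontal_snd g (φ := φ) (z := z) k j))
  simp only [Pi.mul_apply, zero_smul, add_zero] at h2
  refine h2.congr_deriv ?_
  simp only [natLow_eq, Matrix.mul_add, Matrix.add_mul, Matrix.mul_smul, Matrix.smul_mul,
    Matrix.mul_vecMulVec, Matrix.vecMulVec_mul, Matrix.mulVec_transpose]
  simp only [Matrix.add_apply, Matrix.smul_apply, Matrix.vecMulVec_apply, smul_eq_mul]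
  ring

theorem fderiv_natUp_horizontal (hφ : IsChart φ) (hz : z.1 ∈ φ.target) (hp : z.2 ≠ 0)
    {f h : ℝ → ℝ} (hf : ContDiffOn ℝ ∞ f (Set.Ioi 0)) (hh : ContDiffOn ℝ ∞ h (Set.Ioi 0))
    (k i j : Fin n) :
    fderiv ℝ (fun z : E n × E n => natUp g f h φ z.1 z.2 i j) z (flatDelta g φ k z) =
      -((natUp g f h φ z.1 z.2 * (christoffelMatrix g φ k z.1).transpose +
        christoffelMatrix g φ k z.1 * natUp g f h φ z.1 z.2) i j) := by
  have h1 := ((contDiffAt_natUp g hφ hz hp hf hh i j).differentiableAt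
    (by simp)).hasFDerivAt.hasLineDerivAt (flatDelta g φ k z)
  refine HasDerivAt.unique h1 ?_
  have h2 := ((hasDerivAt_horizontal_comp_energy g hφ hz hp hf k).mul
    (hasDerivAt_horizontal_gUp g hφ hz k i j)).add
    (((hasDerivAt_horizontal_comp_energy g hφ hz hp hh k).mul
      (hasDerivAt_horizontal_pUp g hφ hz k i)).mul (hasDerivAt_horizontal_pUp g hφ hz k j))
  simp only [Pi.mul_apply, zero_smul, add_zero] at h2
  refine h2.congr_deriv ?_
  simp only [natUp_eq, Matrix.mul_add, Matrix.add_mul, Matrix.mul_smul, Matrix.smul_mul,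
    Matrix.mul_vecMulVec, Matrix.vecMulVec_mul, Matrix.vecMul_transpose]
  simp only [Matrix.add_apply, Matrix.smul_apply, Matrix.vecMulVec_apply, smul_eq_mul,
    Matrix.neg_apply]
  ring

end Horizontal

/-! ### Lie brackets of the adapted frame. -/

section Brackets

variable (g : Metric n M) {φ : OpenPartialHomeomorph M (E n)} {u : TStar n M}

theorem contDiffAt_christoffelZero (hφ : IsChart φ) {z : E n × E n} (hz : z.1 ∈ φ.target)
    (i j : Fin n) : ContDiffAt ℝ ∞ (fun z : E n × E n => christoffelZero g φ i j z.1 z.2) z :=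
  ContDiffAt.sum fun k _ => (contDiffAt_snd_apply k).mul
    (ContDiffAt.comp (g := christoffel g φ k i j) z (contDiffAt_christoffel g hφ hz k i j)
      contDiffAt_fst)

theorem fderiv_christoffelZero (hφ : IsChart φ) {z : E n × E n} (hz : z.1 ∈ φ.target)
    (i j : Fin n) (ζ : E n × E n) :
    fderiv ℝ (fun z : E n × E n => christoffelZero g φ i j z.1 z.2) z ζ =
      ∑ k, (z.2 k * fderiv ℝ (christoffel g φ k i j) z.1 ζ.1 +
        ζ.2 k * christoffel g φ k i j z.1) := by
  have h1 : ∀ k, HasFDerivAt (fun z : E n × E n => christoffel g φ k i j z.1)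
      ((fderiv ℝ (christoffel g φ k i j) z.1).comp (ContinuousLinearMap.fst ℝ (E n) (E n))) z :=
    fun k => HasFDerivAt.comp (g := christoffel g φ k i j) z
      ((contDiffAt_christoffel g hφ hz k i j).differentiableAt (by simp)).hasFDerivAt
      hasFDerivAt_fst
  have h2 : ∀ k, HasFDerivAt (fun z : E n × E n => z.2 k)
      ((coordCLM k).comp (ContinuousLinearMap.snd ℝ (E n) (E n))) z := fun k =>
    ((coordCLM k).comp (ContinuousLinearMap.snd ℝ (E n) (E n))).hasFDerivAt
  have h3 := HasFDerivAt.fun_sum (u := Finset.univ) fun k _ => (h2 k).mul (h1 k)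
  have h4 : fderiv ℝ (fun z : E n × E n => christoffelZero g φ i j z.1 z.2) z = _ := h3.fderiv
  rw [h4]
  simp [mul_comm]

theorem contDiffAt_flatDelta (hφ : IsChart φ) {z : E n × E n} (hz : z.1 ∈ φ.target)
    (i : Fin n) : ContDiffAt ℝ ∞ (flatDelta g φ i) z :=
  contDiffAt_const.prodMk (ContDiffAt.sum fun h _ =>
    contDiffAt_smul_const (contDiffAt_christoffelZero g hφ hz i h) _)

theorem fderiv_const_prodMk_sum {b : Fin n → E n × E n → ℝ} {z : E n × E n}
    (hb : ∀ h, ContDiffAt ℝ ∞ (b h) z) (c : E n) (ζ : E n × E n) :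
    fderiv ℝ (fun z => (c, ∑ h, b h z • (e h : E n))) z ζ =
      (0, ∑ h, fderiv ℝ (b h) z ζ • (e h : E n)) := by
  have h1 := fun h => ((hb h).differentiableAt (by simp)).hasFDerivAt.smul_const (e h : E n)
  have h2 := (hasFDerivAt_const c z).prodMk
    (HasFDerivAt.fun_sum (u := Finset.univ) fun h _ => h1 h)
  rw [h2.fderiv]
  simp

theorem fderiv_flatDelta (hφ : IsChart φ) {z : E n × E n} (hz : z.1 ∈ φ.target)
    (i : Fin n) (ζ : E n × E n) : fderiv ℝ (flatDelta g φ i) z ζ =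
      (0, ∑ h, fderiv ℝ (fun z : E n × E n => christoffelZero g φ i h z.1 z.2) z ζ •
        (e h : E n)) :=
  fderiv_const_prodMk_sum (fun h => contDiffAt_christoffelZero g hφ hz i h) (e i) ζ

theorem indInv_vertical (r : Fin n → ℝ) :
    indInv φ u (0, ∑ h, r h • (e h : E n)) = ∑ h, r h • dP φ h u := by
  have h := clm_add_sum_smul (indInv φ u) 0 r (fun h => ((0, e h) : E n × E n))
  have h2 : (0 : E n × E n) + ∑ h, r h • ((0, e h) : E n × E n) =
      (0, ∑ h, r h • (e h : E n)) := by
    refine Prod.ext ?_ ?_ <;> simp [Prod.fst_sum, Prod.snd_sum]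
  rw [h2, (indInv φ u).map_zero, zero_add] at h
  exact h

theorem mlieBracket_dP_dP (hφ : IsChart φ) (hu : u.1 ∈ φ.source) (i j : Fin n) :
    mlieBracket (IStar n) (dP φ i) (dP φ j) u = 0 := by
  rw [dP_eq_liftField, dP_eq_liftField,
    mlieBracket_liftField hφ hu contDiffAt_const contDiffAt_const]
  simp only [fderiv_const_apply, zero_apply, sub_zero]
  exact (indInv φ u).map_zero

theorem mlieBracket_dP_delta (hφ : IsChart φ) (hu : u.1 ∈ φ.source) (i j : Fin n) :
    mlieBracket (IStar n) (dP φ i) (delta g φ j) u =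
      ∑ h, christoffel g φ i j h (φ u.1) • dP φ h u := by
  have hz : (indChart φ u).1 ∈ φ.target := φ.map_source hu
  rw [dP_eq_liftField, delta_eq_liftField,
    mlieBracket_liftField hφ hu contDiffAt_const (contDiffAt_flatDelta g hφ hz j),
    fderiv_flatDelta g hφ hz, ← indInv_vertical]
  congr 1
  refine Prod.ext ?_ ?_
  · simp
  · simp only [fderiv_christoffelZero g hφ hz]
    simp [e_apply, indChart_fst]

theorem mlieBracket_delta_delta (hφ : IsChart φ) (hu : u.1 ∈ φ.source) (i j : Fin n) :
    mlieBracket (IStar n) (delta g φ i) (delta g φ j) u =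
      ∑ h, curvatureZero g φ h i j (φ u.1) (indChart φ u).2 • dP φ h u := by
  have hz : (indChart φ u).1 ∈ φ.target := φ.map_source hu
  -- The product rule for p_k Γᵏ_{jh}: the derivative of p_k along δ/δqⁱ is p_l Γˡ_{ik}, which after
  -- relabelling gives the quadratic term. Antisymmetrizing in i, j produces the curvature.
  have key : ∀ i j h, fderiv ℝ (fun z : E n × E n => christoffelZero g φ j h z.1 z.2)
      (indChart φ u) (flatDelta g φ i (indChart φ u)) = ∑ k, (indChart φ u).2 k *
        (pd i (christoffel g φ k j h) (φ u.1) +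
          ∑ l, christoffel g φ k i l (φ u.1) * christoffel g φ l j h (φ u.1)) := by
    intro i j h
    have h1 : ∀ k, (flatDelta g φ i (indChart φ u)).2 k =
        ∑ l, (indChart φ u).2 l * christoffel g φ l i k (φ u.1) := by
      intro k
      simp [flatDelta, e_apply, christoffelZero, indChart_fst]
    rw [fderiv_christoffelZero g hφ hz]
    simp only [h1, mul_add, Finset.sum_add_distrib, indChart_fst, Finset.sum_mul, Finset.mul_sum]
    rw [Finset.sum_comm (f := fun k l => (indChart φ u).2 l * _ * _)]
    congr 1
    exact Finset.sum_congr rfl fun k _ => Finset.sum_congr rfl fun l _ => by ring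
  rw [delta_eq_liftField, delta_eq_liftField, mlieBracket_liftField hφ hu
    (contDiffAt_flatDelta g hφ hz i) (contDiffAt_flatDelta g hφ hz j),
    fderiv_flatDelta g hφ hz, fderiv_flatDelta g hφ hz, ← indInv_vertical]
  congr 1
  refine Prod.ext ?_ ?_
  · simp
  · simp only [key, Prod.snd_sub, ← Finset.sum_sub_distrib, ← sub_smul, ← mul_sub]
    refine Finset.sum_congr rfl fun h _ => ?_
    congr 1
    refine Finset.sum_congr rfl fun k _ => ?_
    rw [curvature, Finset.sum_sub_distrib]
    ring

end Brackets

/-! ### The Levi-Civita connection -/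

section MetricG

variable (g : Metric n M) (w : MetricCoeffs) {φ : OpenPartialHomeomorph M (E n)} {u : TStar n M}

theorem G1_symm (φ : OpenPartialHomeomorph M (E n)) (y p : E n) (i j : Fin n) :
    G1 g w φ y p i j = G1 g w φ y p j i := by
  simp only [G1, natLow, Matrix.of_apply, gLow_symm g φ y i j]
  ring

theorem G2_symm (φ : OpenPartialHomeomorph M (E n)) (y p : E n) (i j : Fin n) :
    G2 g w φ y p i j = G2 g w φ y p j i := by
  simp only [G2, natUp, Matrix.of_apply, gUp_symm g φ y i j]
  ring

theorem metricG_symm (u : TStar n M) (ξ η : TangentSpace (IStar n) u) :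
    metricG g w u ξ η = metricG g w u η ξ := by
  simp only [metricG]
  rw [Finset.sum_comm]
  refine Finset.sum_congr rfl fun i _ => Finset.sum_congr rfl fun j _ => ?_
  rw [G1_symm, G2_symm]
  ring

theorem metricG_sub_left (u : TStar n M) (ξ ξ' η : TangentSpace (IStar n) u) :
    metricG g w u (ξ - ξ') η = metricG g w u ξ η - metricG g w u ξ' η := by
  simp only [metricG, covQ_sub, covP_sub, ← Finset.sum_sub_distrib]
  exact Finset.sum_congr rfl fun i _ => Finset.sum_congr rfl fun j _ => by ring

theorem metricG_neg_left (u : TStar n M) (ξ η : TangentSpace (IStar n) u) :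
    metricG g w u (-ξ) η = -metricG g w u ξ η := by
  simp only [metricG, covQ_neg, covP_neg, ← Finset.sum_neg_distrib]
  exact Finset.sum_congr rfl fun i _ => Finset.sum_congr rfl fun j _ => by ring

theorem metricG_zero_left (u : TStar n M) (η : TangentSpace (IStar n) u) :
    metricG g w u 0 η = 0 := by
  have h := metricG_sub_left g w u η η η
  rwa [sub_self, sub_self] at h

theorem metricG_delta (hφ : IsChart φ) (hu : u.1 ∈ φ.source) (ξ : TangentSpace (IStar n) u)
    (k : Fin n) : metricG g w u ξ (delta g φ k u) =
      ∑ j, covQ φ j u ξ * G1 g w φ (φ u.1) (indChart φ u).2 j k := by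
  rw [metricG_eq_dotProduct g w hφ hu]
  simp only [dotProduct, Matrix.mulVec, vecQ, vecP, covQ_delta g hφ hu, covP_delta g hφ hu]
  simp

theorem metricG_dP (hφ : IsChart φ) (hu : u.1 ∈ φ.source) (ξ : TangentSpace (IStar n) u)
    (k : Fin n) : metricG g w u ξ (dP φ k u) =
      ∑ j, covP g φ j u ξ * G2 g w φ (φ u.1) (indChart φ u).2 j k := by
  rw [metricG_eq_dotProduct g w hφ hu]
  simp only [dotProduct, Matrix.mulVec, vecQ, vecP, covQ_dP hφ hu, covP_dP g hφ hu]
  simp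

theorem metricG_delta_delta (hφ : IsChart φ) (hu : u.1 ∈ φ.source) (i k : Fin n) :
    metricG g w u (delta g φ i u) (delta g φ k u) = G1 g w φ (φ u.1) (indChart φ u).2 i k := by
  simp [metricG_delta g w hφ hu, covQ_delta g hφ hu]

theorem metricG_dP_dP (hφ : IsChart φ) (hu : u.1 ∈ φ.source) (i k : Fin n) :
    metricG g w u (dP φ i u) (dP φ k u) = G2 g w φ (φ u.1) (indChart φ u).2 i k := by
  simp [metricG_dP g w hφ hu, covP_dP g hφ hu]

theorem metricG_dP_delta (hφ : IsChart φ) (hu : u.1 ∈ φ.source) (i k : Fin n) :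
    metricG g w u (dP φ i u) (delta g φ k u) = 0 := by
  simp [metricG_delta g w hφ hu, covQ_dP hφ hu]

theorem metricG_delta_dP (hφ : IsChart φ) (hu : u.1 ∈ φ.source) (i k : Fin n) :
    metricG g w u (delta g φ i u) (dP φ k u) = 0 := by
  simp [metricG_dP g w hφ hu, covP_delta g hφ hu]

theorem covQ_sum_dP (hφ : IsChart φ) (hu : u.1 ∈ φ.source) (c : Fin n → ℝ) (k : Fin n) :
    covQ φ k u (∑ h, c h • dP φ h u) = 0 := by
  simp [covQ_sum, covQ_smul, covQ_dP hφ hu]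

theorem covP_sum_dP (hφ : IsChart φ) (hu : u.1 ∈ φ.source) (c : Fin n → ℝ) (k : Fin n) :
    covP g φ k u (∑ h, c h • dP φ h u) = c k := by
  simp [covP_sum, covP_smul, covP_dP g hφ hu]

theorem covQ_sum_delta (hφ : IsChart φ) (hu : u.1 ∈ φ.source) (c : Fin n → ℝ) (k : Fin n) :
    covQ φ k u (∑ h, c h • delta g φ h u) = c k := by
  simp [covQ_sum, covQ_smul, covQ_delta g hφ hu]

theorem covP_sum_delta (hφ : IsChart φ) (hu : u.1 ∈ φ.source) (c : Fin n → ℝ) (k : Fin n) :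
    covP g φ k u (∑ h, c h • delta g φ h u) = 0 := by
  simp [covP_sum, covP_smul, covP_delta g hφ hu]

theorem metricG_sum_dP_delta (hφ : IsChart φ) (hu : u.1 ∈ φ.source) (c : Fin n → ℝ) (k : Fin n) :
    metricG g w u (∑ h, c h • dP φ h u) (delta g φ k u) = 0 := by
  simp [metricG_delta g w hφ hu, covQ_sum_dP hφ hu]

theorem metricG_sum_dP_dP (hφ : IsChart φ) (hu : u.1 ∈ φ.source) (c : Fin n → ℝ) (k : Fin n) :
    metricG g w u (∑ h, c h • dP φ h u) (dP φ k u) =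
      ∑ h, c h * G2 g w φ (φ u.1) (indChart φ u).2 h k := by
  simp [metricG_dP g w hφ hu, covP_sum_dP g hφ hu]

theorem H1_mul_G1 (hφ : IsChart φ) {y p : E n} (hy : y ∈ φ.target) (hp : p ≠ 0) :
    H1 g w φ y p * G1 g w φ y p = 1 := by
  have h := natLow_mul_natUp_inv g w.pos_c₁ w.pos_d₁ hφ hy hp
  rw [H1_eq g w hφ hy hp]
  exact mul_eq_one_comm.1 h

theorem H2_mul_G2 (hφ : IsChart φ) {y p : E n} (hy : y ∈ φ.target) (hp : p ≠ 0) :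
    H2 g w φ y p * G2 g w φ y p = 1 := by
  rw [H2_eq g w hφ hy hp]
  exact natLow_inv_mul_natUp g w.pos_c₂ w.pos_d₂ hφ hy hp

/-- Solves a linear system with symmetric matrix `G` and left inverse `H`; the factors 2 and 1/2 are
those of the Koszul formula. -/
theorem eq_mulVec_of_vecMul_eq {ι : Type*} [Fintype ι] [DecidableEq ι] {H G : Matrix ι ι ℝ}
    (h : H * G = 1) (hs : ∀ i j, G i j = G j i) {x c : ι → ℝ}
    (hx : ∀ k, 2 * ∑ j, x j * G j k = c k) (i : ι) : x i = 1 / 2 * ∑ k, H i k * c k := by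
  have h1 : c = (2 : ℝ) • G.mulVec x := by
    funext k
    rw [← hx]
    simp only [Matrix.mulVec, dotProduct, Pi.smul_apply, smul_eq_mul]
    congr 1
    exact Finset.sum_congr rfl fun j _ => by rw [hs j k, mul_comm]
  have h2 : ∑ k, H i k * c k = H.mulVec c i := rfl
  rw [h2, h1, Matrix.mulVec_smul, Matrix.mulVec_mulVec, h, Matrix.one_mulVec]
  simp

/-- The horizontal components of a vector in terms of its products with the `δ/δqᵏ`. -/
theorem covQ_eq_of_metricG (hφ : IsChart φ) (hu : u.1 ∈ φ.source) (h0 : u ∈ TStarZero n M)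
    {ξ : TangentSpace (IStar n) u} {c : Fin n → ℝ}
    (h : ∀ k, 2 * metricG g w u ξ (delta g φ k u) = c k) (i : Fin n) :
    covQ φ i u ξ = 1 / 2 * ∑ k, H1 g w φ (φ u.1) (indChart φ u).2 i k * c k := by
  simp only [metricG_delta g w hφ hu] at h
  exact eq_mulVec_of_vecMul_eq (x := fun j => covQ φ j u ξ)
    (H1_mul_G1 g w hφ (φ.map_source hu) ((mem_TStarZero_iff hφ hu).1 h0))
    (G1_symm g w φ _ _) h i

/-- The vertical components of a vector in terms of its products with the `∂/∂pₖ`. -/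
theorem covP_eq_of_metricG (hφ : IsChart φ) (hu : u.1 ∈ φ.source) (h0 : u ∈ TStarZero n M)
    {ξ : TangentSpace (IStar n) u} {c : Fin n → ℝ}
    (h : ∀ k, 2 * metricG g w u ξ (dP φ k u) = c k) (i : Fin n) :
    covP g φ i u ξ = 1 / 2 * ∑ k, H2 g w φ (φ u.1) (indChart φ u).2 i k * c k := by
  simp only [metricG_dP g w hφ hu] at h
  exact eq_mulVec_of_vecMul_eq (x := fun j => covP g φ j u ξ)
    (H2_mul_G2 g w hφ (φ.map_source hu) ((mem_TStarZero_iff hφ hu).1 h0))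
    (G2_symm g w φ _ _) h i

theorem diffAt_dP (hφ : IsChart φ) (hu : u.1 ∈ φ.source) (i : Fin n) : DiffAt (dP φ i) u :=
  diffAt_liftField hφ hu contDiffAt_const

theorem diffAt_delta (hφ : IsChart φ) (hu : u.1 ∈ φ.source) (i : Fin n) :
    DiffAt (delta g φ i) u := by
  rw [delta_eq_liftField]
  exact diffAt_liftField hφ hu (contDiffAt_flatDelta g hφ (φ.map_source hu) i)

theorem dirDeriv_dP (hφ : IsChart φ) (hu : u.1 ∈ φ.source) {F : TStar n M → ℝ}
    {f : E n → E n → ℝ}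
    (hF : ∀ v : TStar n M, v.1 ∈ φ.source → F v = f (φ v.1) (indChart φ v).2)
    (hf : ContDiffAt ℝ ∞ (fun z : E n × E n => f z.1 z.2) (indChart φ u)) (i : Fin n) :
    dirDeriv F u (dP φ i u) = pd i (f (φ u.1)) (indChart φ u).2 := by
  have h := hf.differentiableAt (by simp)
  rw [dirDeriv_eq_fderiv hφ hu (f := fun z => f z.1 z.2) hF h, dInd_dP hφ hu,
    ← pd_eq_fderiv_snd h]
  rfl

theorem dirDeriv_delta (hφ : IsChart φ) (hu : u.1 ∈ φ.source) {F : TStar n M → ℝ}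
    {f : E n → E n → ℝ}
    (hF : ∀ v : TStar n M, v.1 ∈ φ.source → F v = f (φ v.1) (indChart φ v).2)
    (hf : ContDiffAt ℝ ∞ (fun z : E n × E n => f z.1 z.2) (indChart φ u)) (k : Fin n) :
    dirDeriv F u (delta g φ k u) = fderiv ℝ (fun z : E n × E n => f z.1 z.2) (indChart φ u)
      (flatDelta g φ k (indChart φ u)) := by
  rw [dirDeriv_eq_fderiv hφ hu (f := fun z => f z.1 z.2) hF (hf.differentiableAt (by simp)),
    dInd_delta g hφ hu]

theorem dirDeriv_eq_zero (hφ : IsChart φ) (hu : u.1 ∈ φ.source) {F : TStar n M → ℝ}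
    (hF : ∀ v : TStar n M, v.1 ∈ φ.source → F v = 0) (ξ : TangentSpace (IStar n) u) :
    dirDeriv F u ξ = 0 := by
  rw [dirDeriv_eq_fderiv hφ hu (f := fun _ => 0) hF (differentiableAt_const 0)]
  simp

end MetricG

/-! ### The Koszul formula on the adapted frame. -/

section LeviCivita

variable (g : Metric n M) (w : MetricCoeffs) {φ : OpenPartialHomeomorph M (E n)} {u : TStar n M}

/-- Metric compatibility for the three pairs of fields, with the differences of covariant
derivatives turned into brackets by the absence of torsion. -/
theorem koszul_formula {nabla : VField n M →
      ((u : TStar n M) → TangentSpace (IStar n) u →L[ℝ] TangentSpace (IStar n) u)}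
    (hn : IsLeviCivita (metricG g w) nabla) (h0 : u ∈ TStarZero n M) {X Y Z : VField n M}
    (hX : DiffAt X u) (hY : DiffAt Y u) (hZ : DiffAt Z u) :
    2 * metricG g w u (nabla Y u (X u)) (Z u) =
      dirDeriv (fun v => metricG g w v (Y v) (Z v)) u (X u)
      + dirDeriv (fun v => metricG g w v (X v) (Z v)) u (Y u)
      - dirDeriv (fun v => metricG g w v (X v) (Y v)) u (Z u)
      + metricG g w u (mlieBracket (IStar n) X Y u) (Z u)
      - metricG g w u (mlieBracket (IStar n) X Z u) (Y u)
      - metricG g w u (mlieBracket (IStar n) Y Z u) (X u) := by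
  rw [hn.metric u h0 Y Z hY hZ, hn.metric u h0 X Z hX hZ, hn.metric u h0 X Y hX hY,
    ← hn.torsionFree u h0 X Y hX hY, ← hn.torsionFree u h0 X Z hX hZ,
    ← hn.torsionFree u h0 Y Z hY hZ]
  simp only [metricG_sub_left]
  rw [metricG_symm g w u (Y u) (nabla Z u (X u)), metricG_symm g w u (X u) (nabla Z u (Y u)),
    metricG_symm g w u (X u) (nabla Y u (Z u))]
  ring

theorem dirDeriv_dP_G2 (hφ : IsChart φ) (hu : u.1 ∈ φ.source) (h0 : u ∈ TStarZero n M)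
    (i j k : Fin n) : dirDeriv (fun v => metricG g w v (dP φ j v) (dP φ k v)) u (dP φ i u) =
      pd i (fun r => G2 g w φ (φ u.1) r j k) (indChart φ u).2 :=
  dirDeriv_dP hφ hu (f := fun y r => G2 g w φ y r j k)
    (fun _ hv => metricG_dP_dP g w hφ hv j k)
    (contDiffAt_G2 g w hφ (φ.map_source hu) ((mem_TStarZero_iff hφ hu).1 h0) j k) i

theorem dirDeriv_dP_G1 (hφ : IsChart φ) (hu : u.1 ∈ φ.source) (h0 : u ∈ TStarZero n M)
    (i j k : Fin n) :
    dirDeriv (fun v => metricG g w v (delta g φ j v) (delta g φ k v)) u (dP φ i u) =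
      pd i (fun r => G1 g w φ (φ u.1) r j k) (indChart φ u).2 :=
  dirDeriv_dP hφ hu (f := fun y r => G1 g w φ y r j k)
    (fun _ hv => metricG_delta_delta g w hφ hv j k)
    (contDiffAt_G1 g w hφ (φ.map_source hu) ((mem_TStarZero_iff hφ hu).1 h0) j k) i

theorem dirDeriv_delta_G2 (hφ : IsChart φ) (hu : u.1 ∈ φ.source) (h0 : u ∈ TStarZero n M)
    (k i j : Fin n) :
    dirDeriv (fun v => metricG g w v (dP φ i v) (dP φ j v)) u (delta g φ k u) =
      -(∑ l, christoffel g φ j k l (φ u.1) * G2 g w φ (φ u.1) (indChart φ u).2 l i +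
        ∑ l, christoffel g φ i k l (φ u.1) * G2 g w φ (φ u.1) (indChart φ u).2 l j) := by
  have hz : (indChart φ u).1 ∈ φ.target := φ.map_source hu
  have hp := (mem_TStarZero_iff hφ hu).1 h0
  rw [dirDeriv_delta g hφ hu (f := fun y r => G2 g w φ y r i j)
    (fun _ hv => metricG_dP_dP g w hφ hv i j) (contDiffAt_G2 g w hφ hz hp i j) k]
  refine (fderiv_natUp_horizontal g hφ hz hp w.smooth_c₂ w.smooth_d₂ k i j).trans ?_
  rw [Matrix.add_apply, Matrix.mul_apply, Matrix.mul_apply]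
  congr 2
  exact Finset.sum_congr rfl fun l _ => by
    rw [mul_comm, G2_symm g w φ _ _ l i]
    rfl

theorem dirDeriv_delta_G1 (hφ : IsChart φ) (hu : u.1 ∈ φ.source) (h0 : u ∈ TStarZero n M)
    (k i j : Fin n) :
    dirDeriv (fun v => metricG g w v (delta g φ i v) (delta g φ j v)) u (delta g φ k u) =
      ∑ l, christoffel g φ l k i (φ u.1) * G1 g w φ (φ u.1) (indChart φ u).2 l j +
        ∑ l, christoffel g φ l k j (φ u.1) * G1 g w φ (φ u.1) (indChart φ u).2 l i := by
  have hz : (indChart φ u).1 ∈ φ.target := φ.map_source hu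
  have hp := (mem_TStarZero_iff hφ hu).1 h0
  rw [dirDeriv_delta g hφ hu (f := fun y r => G1 g w φ y r i j)
    (fun _ hv => metricG_delta_delta g w hφ hv i j) (contDiffAt_G1 g w hφ hz hp i j) k]
  refine (fderiv_natLow_horizontal g hφ hz hp w.smooth_c₁ w.smooth_d₁ k i j).trans ?_
  rw [Matrix.add_apply, Matrix.mul_apply, Matrix.mul_apply]
  congr 1
  exact Finset.sum_congr rfl fun l _ => by
    rw [mul_comm, G1_symm g w φ _ _ l i]
    rfl

theorem mlieBracket_delta_dP (hφ : IsChart φ) (hu : u.1 ∈ φ.source) (i j : Fin n) :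
    mlieBracket (IStar n) (delta g φ j) (dP φ i) u =
      -∑ h, christoffel g φ i j h (φ u.1) • dP φ h u := by
  rw [mlieBracket_swap_apply, mlieBracket_dP_delta g hφ hu]

section

variable {nabla : VField n M →
    ((u : TStar n M) → TangentSpace (IStar n) u →L[ℝ] TangentSpace (IStar n) u)}

theorem nabla_dP_dP (hn : IsLeviCivita (metricG g w) nabla) (hφ : IsChart φ)
    (hu : u.1 ∈ φ.source) (h0 : u ∈ TStarZero n M) (i j : Fin n) :
    nabla (dP φ j) u (dP φ i u) =
      ∑ h, Q g w φ (φ u.1) (indChart φ u).2 i j h • dP φ h u := by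
  have dp := fun i => diffAt_dP hφ hu (u := u) i
  have dd := fun i => diffAt_delta g hφ hu (u := u) i
  refine ext_cov g hφ hu (fun k => ?_) fun k => ?_
  -- The products with δ/δqᵏ vanish: the derivative of G₍₂₎ along δ/δqᵏ cancels against the two
  -- brackets.
  · rw [covQ_sum_dP hφ hu, covQ_eq_of_metricG g w hφ hu h0 (c := fun _ => 0) ?_ k]
    · simp
    · intro k
      rw [koszul_formula g w hn h0 (dp i) (dp j) (dd k), dirDeriv_delta_G2 g w hφ hu h0,
        dirDeriv_eq_zero hφ hu (fun v hv => metricG_dP_delta g w hφ hv j k),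
        dirDeriv_eq_zero hφ hu (fun v hv => metricG_dP_delta g w hφ hv i k),
        mlieBracket_dP_dP hφ hu, mlieBracket_dP_delta g hφ hu, mlieBracket_dP_delta g hφ hu,
        metricG_zero_left, metricG_sum_dP_dP g w hφ hu, metricG_sum_dP_dP g w hφ hu]
      ring
  · rw [covP_sum_dP g hφ hu]
    refine covP_eq_of_metricG g w hφ hu h0 (fun k => ?_) k
    rw [koszul_formula g w hn h0 (dp i) (dp j) (dp k), dirDeriv_dP_G2 g w hφ hu h0,
      dirDeriv_dP_G2 g w hφ hu h0, dirDeriv_dP_G2 g w hφ hu h0, mlieBracket_dP_dP hφ hu,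
      mlieBracket_dP_dP hφ hu, mlieBracket_dP_dP hφ hu, metricG_zero_left, metricG_zero_left,
      metricG_zero_left]
    ring

theorem nabla_dP_delta (hn : IsLeviCivita (metricG g w) nabla) (hφ : IsChart φ)
    (hu : u.1 ∈ φ.source) (h0 : u ∈ TStarZero n M) (i j : Fin n) :
    nabla (delta g φ j) u (dP φ i u) =
      ∑ h, P g w φ (φ u.1) (indChart φ u).2 h i j • delta g φ h u := by
  have dp := fun i => diffAt_dP hφ hu (u := u) i
  have dd := fun i => diffAt_delta g hφ hu (u := u) i
  refine ext_cov g hφ hu (fun k => ?_) fun k => ?_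
  · rw [covQ_sum_delta g hφ hu]
    refine covQ_eq_of_metricG g w hφ hu h0 (fun k => ?_) k
    -- The mixed brackets are vertical, hence orthogonal to the δ/δq; the curvature enters through
    -- the bracket of δ/δq^j and δ/δqᵏ, paired with ∂/∂pᵢ.
    rw [koszul_formula g w hn h0 (dp i) (dd j) (dd k), dirDeriv_dP_G1 g w hφ hu h0,
      dirDeriv_eq_zero hφ hu (fun v hv => metricG_dP_delta g w hφ hv i k),
      dirDeriv_eq_zero hφ hu (fun v hv => metricG_dP_delta g w hφ hv i j),
      mlieBracket_dP_delta g hφ hu, mlieBracket_dP_delta g hφ hu,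
      mlieBracket_delta_delta g hφ hu, metricG_sum_dP_delta g w hφ hu,
      metricG_sum_dP_delta g w hφ hu, metricG_sum_dP_dP g w hφ hu]
    have h1 : ∀ l, curvatureZero g φ l j k (φ u.1) (indChart φ u).2 *
        G2 g w φ (φ u.1) (indChart φ u).2 l i = G2 g w φ (φ u.1) (indChart φ u).2 i l *
        curvatureZero g φ l j k (φ u.1) (indChart φ u).2 := fun l => by
      rw [mul_comm, G2_symm]
    simp only [h1]
    ring
  · rw [covP_sum_delta g hφ hu, covP_eq_of_metricG g w hφ hu h0 (c := fun _ => 0) ?_ k]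
    · simp
    · intro k
      rw [koszul_formula g w hn h0 (dp i) (dd j) (dp k), dirDeriv_delta_G2 g w hφ hu h0,
        dirDeriv_eq_zero hφ hu (fun v hv => metricG_delta_dP g w hφ hv j k),
        dirDeriv_eq_zero hφ hu (fun v hv => metricG_dP_delta g w hφ hv i j),
        mlieBracket_dP_dP hφ hu, mlieBracket_dP_delta g hφ hu, mlieBracket_delta_dP g hφ hu,
        metricG_zero_left, metricG_neg_left, metricG_sum_dP_dP g w hφ hu,
        metricG_sum_dP_dP g w hφ hu]
      ring

/-- Torsion-freeness reduces this to `nabla_dP_delta` and a bracket, which supplies the Christoffel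
term. -/
theorem nabla_delta_dP (hn : IsLeviCivita (metricG g w) nabla) (hφ : IsChart φ)
    (hu : u.1 ∈ φ.source) (h0 : u ∈ TStarZero n M) (i j : Fin n) :
    nabla (dP φ j) u (delta g φ i u) = -∑ h, christoffel g φ j i h (φ u.1) • dP φ h u +
      ∑ h, P g w φ (φ u.1) (indChart φ u).2 h j i • delta g φ h u := by
  have h := hn.torsionFree u h0 (delta g φ i) (dP φ j) (diffAt_delta g hφ hu i)
    (diffAt_dP hφ hu j)
  rw [mlieBracket_delta_dP g hφ hu, nabla_dP_delta g w hn hφ hu h0] at h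
  exact eq_add_of_sub_eq h

theorem nabla_delta_delta (hn : IsLeviCivita (metricG g w) nabla) (hφ : IsChart φ)
    (hu : u.1 ∈ φ.source) (h0 : u ∈ TStarZero n M) (i j : Fin n) :
    nabla (delta g φ j) u (delta g φ i u) = ∑ h, christoffel g φ h i j (φ u.1) • delta g φ h u +
      ∑ h, S g w φ (φ u.1) (indChart φ u).2 h i j • dP φ h u := by
  have dp := fun i => diffAt_dP hφ hu (u := u) i
  have dd := fun i => diffAt_delta g hφ hu (u := u) i
  have hz := φ.map_source hu
  have hp := (mem_TStarZero_iff hφ hu).1 h0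
  refine ext_cov g hφ hu (fun k => ?_) fun k => ?_
  · rw [covQ_add, covQ_sum_delta g hφ hu, covQ_sum_dP hφ hu, add_zero]
    -- The symbols are written as ½ `H1` applied to 2ΓG⁽¹⁾, to be matched with the Koszul formula,
    -- where four of six Christoffel terms cancel.
    have h1 := eq_mulVec_of_vecMul_eq (H1_mul_G1 g w hφ hz hp) (G1_symm g w φ _ _)
      (x := fun h => christoffel g φ h i j (φ u.1)) (fun k => rfl) k
    rw [h1]
    refine covQ_eq_of_metricG g w hφ hu h0 (fun k => ?_) k
    rw [koszul_formula g w hn h0 (dd i) (dd j) (dd k), dirDeriv_delta_G1 g w hφ hu h0,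
      dirDeriv_delta_G1 g w hφ hu h0, dirDeriv_delta_G1 g w hφ hu h0,
      mlieBracket_delta_delta g hφ hu, mlieBracket_delta_delta g hφ hu,
      mlieBracket_delta_delta g hφ hu, metricG_sum_dP_delta g w hφ hu,
      metricG_sum_dP_delta g w hφ hu, metricG_sum_dP_delta g w hφ hu]
    simp only [christoffel_symm g φ _ k, christoffel_symm g φ _ j i]
    ring
  · rw [covP_add, covP_sum_delta g hφ hu, covP_sum_dP g hφ hu, zero_add]
    -- Likewise the free term R⁰ of `S` is moved under `H2`, where the Koszul formula produces
    -- R⁰G₍₂₎ from a bracket.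
    have h1 := eq_mulVec_of_vecMul_eq (H2_mul_G2 g w hφ hz hp) (G2_symm g w φ _ _)
      (x := fun h => curvatureZero g φ h i j (φ u.1) (indChart φ u).2) (fun k => rfl) k
    have h2 : S g w φ (φ u.1) (indChart φ u).2 k i j = 1 / 2 * ∑ l,
        H2 g w φ (φ u.1) (indChart φ u).2 k l *
        (∑ m, curvatureZero g φ m i j (φ u.1) (indChart φ u).2 *
          G2 g w φ (φ u.1) (indChart φ u).2 m l -
          pd l (fun r => G1 g w φ (φ u.1) r i j) (indChart φ u).2) := by
      rw [S, h1]
      simp only [mul_sub, Finset.sum_sub_distrib, mul_left_comm _ (2 : ℝ), ← Finset.mul_sum]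
      ring
    rw [h2]
    refine covP_eq_of_metricG g w hφ hu h0 (fun k => ?_) k
    rw [koszul_formula g w hn h0 (dd i) (dd j) (dp k), dirDeriv_dP_G1 g w hφ hu h0,
      dirDeriv_eq_zero hφ hu (fun v hv => metricG_delta_dP g w hφ hv i k),
      dirDeriv_eq_zero hφ hu (fun v hv => metricG_delta_dP g w hφ hv j k),
      mlieBracket_delta_delta g hφ hu, mlieBracket_delta_dP g hφ hu,
      mlieBracket_delta_dP g hφ hu, metricG_neg_left, metricG_neg_left,
      metricG_sum_dP_dP g w hφ hu, metricG_sum_dP_delta g w hφ hu,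
      metricG_sum_dP_delta g w hφ hu]
    ring

end

end LeviCivita

/-! ### The Kähler conditions -/

section MomentumDerivatives

variable (g : Metric n M) {φ : OpenPartialHomeomorph M (E n)} {y p : E n}

theorem hasDerivAt_vertical_apply (k i : Fin n) :
    HasDerivAt (fun s : ℝ => (p + s • (e k : E n)) i) (if i = k then 1 else 0) 0 := by
  have h := ((coordCLM i).hasFDerivAt (x := p)).hasLineDerivAt (e k)
  rw [coordCLM_apply, e_apply] at h
  exact h

theorem hasDerivAt_vertical_pUp (k i : Fin n) :
    HasDerivAt (fun s : ℝ => pUp g φ y (p + s • (e k : E n)) i) (gUp g φ y k i) 0 := by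
  have h := HasDerivAt.fun_sum (u := Finset.univ) fun l _ =>
    (hasDerivAt_vertical_apply (p := p) k l).mul_const (gUp g φ y l i)
  refine h.congr_deriv ?_
  simp

theorem hasDerivAt_vertical_energy (k : Fin n) :
    HasDerivAt (fun s : ℝ => energy g φ y (p + s • (e k : E n))) (pUp g φ y p k) 0 := by
  simp only [energy_eq]
  have h := HasDerivAt.fun_sum (u := Finset.univ) fun l _ =>
    (hasDerivAt_vertical_apply (p := p) k l).mul (hasDerivAt_vertical_pUp g (φ := φ) (y := y) (p := p) k l)
  simp only [zero_smul, add_zero] at h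
  refine (h.const_mul (1 / 2 : ℝ)).congr_deriv ?_
  have h2 : ∑ l, p l * gUp g φ y k l = pUp g φ y p k := by
    simp only [pUp, gUp_symm g φ y k]
  rw [Finset.sum_add_distrib, h2]
  simp
  ring

theorem hasDerivAt_vertical_comp_energy (hφ : IsChart φ) (hy : y ∈ φ.target) (hp : p ≠ 0)
    {f : ℝ → ℝ} (hf : ContDiffOn ℝ ∞ f (Set.Ioi 0)) (k : Fin n) :
    HasDerivAt (fun s : ℝ => f (energy g φ y (p + s • (e k : E n))))
      (deriv f (energy g φ y p) * pUp g φ y p k) 0 := by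
  have h1 : HasDerivAt f (deriv f (energy g φ y p)) (energy g φ y p) :=
    ((hf.contDiffAt (Ioi_mem_nhds (energy_pos g hφ hy hp))).differentiableAt (by simp)).hasDerivAt
  exact HasDerivAt.comp (h₂ := f) (0 : ℝ) (by
    simp only [zero_smul, add_zero]
    exact h1) (hasDerivAt_vertical_energy g k)

theorem pd_eq_of_hasDerivAt {F : E n → E n → ℝ}
    (hF : ContDiffAt ℝ ∞ (fun z : E n × E n => F z.1 z.2) (y, p)) {k : Fin n} {F' : ℝ}
    (h : HasDerivAt (fun s : ℝ => F y (p + s • (e k : E n))) F' 0) : pd k (F y) p = F' := by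
  have h1 : DifferentiableAt ℝ (F y) p :=
    DifferentiableAt.comp (g := fun z : E n × E n => F z.1 z.2) (f := fun r => (y, r)) p
      (hF.differentiableAt (by simp)) (hasFDerivAt_prodMk_right _ _).differentiableAt
  exact HasDerivAt.unique (h1.hasFDerivAt.hasLineDerivAt (e k)) h

theorem pd_natLow (hφ : IsChart φ) (hy : y ∈ φ.target) (hp : p ≠ 0)
    {f h : ℝ → ℝ} (hf : ContDiffOn ℝ ∞ f (Set.Ioi 0)) (hh : ContDiffOn ℝ ∞ h (Set.Ioi 0))
    (k i j : Fin n) : pd k (fun r => natLow g f h φ y r i j) p =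
      deriv f (energy g φ y p) * pUp g φ y p k * gLow g φ y i j +
      deriv h (energy g φ y p) * pUp g φ y p k * p i * p j +
      h (energy g φ y p) * (kron i k * p j + p i * kron j k) := by
  refine pd_eq_of_hasDerivAt (F := fun y r => natLow g f h φ y r i j)
    (contDiffAt_natLow g (z := (y, p)) hφ hy hp hf hh i j) ?_
  have h2 := ((hasDerivAt_vertical_comp_energy g hφ hy hp hf k).mul_const (gLow g φ y i j)).add
    (((hasDerivAt_vertical_comp_energy g hφ hy hp hh k).mul
      (hasDerivAt_vertical_apply (p := p) k i)).mul (hasDerivAt_vertical_apply (p := p) k j))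
  simp only [Pi.mul_apply, zero_smul, add_zero] at h2
  refine h2.congr_deriv ?_
  simp only [kron]
  ring

theorem pd_natUp (hφ : IsChart φ) (hy : y ∈ φ.target) (hp : p ≠ 0)
    {f h : ℝ → ℝ} (hf : ContDiffOn ℝ ∞ f (Set.Ioi 0)) (hh : ContDiffOn ℝ ∞ h (Set.Ioi 0))
    (k i j : Fin n) : pd k (fun r => natUp g f h φ y r i j) p =
      deriv f (energy g φ y p) * pUp g φ y p k * gUp g φ y i j +
      deriv h (energy g φ y p) * pUp g φ y p k * pUp g φ y p i * pUp g φ y p j +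
      h (energy g φ y p) * (gUp g φ y k i * pUp g φ y p j + pUp g φ y p i * gUp g φ y k j) := by
  refine pd_eq_of_hasDerivAt (F := fun y r => natUp g f h φ y r i j)
    (contDiffAt_natUp g (z := (y, p)) hφ hy hp hf hh i j) ?_
  have h2 := ((hasDerivAt_vertical_comp_energy g hφ hy hp hf k).mul_const (gUp g φ y i j)).add
    (((hasDerivAt_vertical_comp_energy g hφ hy hp hh k).mul
      (hasDerivAt_vertical_pUp g (φ := φ) (y := y) (p := p) k i)).mul (hasDerivAt_vertical_pUp g (φ := φ) (y := y) (p := p) k j))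
  simp only [Pi.mul_apply, zero_smul, add_zero] at h2
  refine h2.congr_deriv ?_
  ring

theorem pd_mixed (hφ : IsChart φ) (hy : y ∈ φ.target) (hp : p ≠ 0)
    {f h : ℝ → ℝ} (hf : ContDiffOn ℝ ∞ f (Set.Ioi 0)) (hh : ContDiffOn ℝ ∞ h (Set.Ioi 0))
    (k i j : Fin n) :
    pd k (fun r => f (energy g φ y r) * kron i j + h (energy g φ y r) * r i * pUp g φ y r j) p =
      deriv f (energy g φ y p) * pUp g φ y p k * kron i j +
      deriv h (energy g φ y p) * pUp g φ y p k * p i * pUp g φ y p j +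
      h (energy g φ y p) * (kron i k * pUp g φ y p j + p i * gUp g φ y k j) := by
  refine pd_eq_of_hasDerivAt (F := fun y r => f (energy g φ y r) * kron i j +
    h (energy g φ y r) * r i * pUp g φ y r j) ?_ ?_
  · exact ((contDiffAt_comp_energy g (z := (y, p)) hφ hy hp hf).mul contDiffAt_const).add
      (((contDiffAt_comp_energy g (z := (y, p)) hφ hy hp hh).mul (contDiffAt_snd_apply i)).mul
        (contDiffAt_pUp g (z := (y, p)) hφ hy j))
  have h2 := ((hasDerivAt_vertical_comp_energy g hφ hy hp hf k).mul_const (kron i j)).add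
    (((hasDerivAt_vertical_comp_energy g hφ hy hp hh k).mul
      (hasDerivAt_vertical_apply (p := p) k i)).mul (hasDerivAt_vertical_pUp g (φ := φ) (y := y) (p := p) k j))
  simp only [Pi.mul_apply, zero_smul, add_zero] at h2
  refine h2.congr_deriv ?_
  simp only [kron]
  ring

end MomentumDerivatives

/-! ### Points of T*₀M with prescribed coordinates or energy, and comparison of coefficients. -/

section Points

variable (g : Metric n M) {φ : OpenPartialHomeomorph M (E n)}

/-- Relations between coefficients are obtained at points of T*₀M; this, with a rescaling of p,
makes them available for every t > 0. -/
theorem exists_indChart_eq (hφ : IsChart φ) {y : E n} (hy : y ∈ φ.target) (p : E n) :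
    ∃ u : TStar n M, u.1 ∈ φ.source ∧ φ u.1 = y ∧ (indChart φ u).2 = p := by
  let L : E n →L[ℝ] ℝ := ∑ i, p i • coordCLM i
  refine ⟨⟨φ.symm y, L.comp (mfderiv 𝓘(ℝ, E n) 𝓘(ℝ, E n) φ (φ.symm y))⟩, φ.map_target hy,
    φ.right_inv hy, ?_⟩
  ext i
  rw [indChart_snd]
  have h1 := mfderiv_coordVec hφ (φ.map_target hy) i
  have h2 : L (e i) = p i := by simp [L, e_apply]
  rw [← h2, ← h1]
  rfl

theorem energy_smul (φ : OpenPartialHomeomorph M (E n)) (y p : E n) (s : ℝ) :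
    energy g φ y (s • p) = s ^ 2 * energy g φ y p := by
  simp only [energy, PiLp.smul_apply, smul_eq_mul, Finset.mul_sum]
  exact Finset.sum_congr rfl fun i _ => Finset.sum_congr rfl fun j _ => by ring

/-- The energy takes all positive values on each cotangent space. -/
theorem exists_energy_eq (hφ : IsChart φ) {y p : E n} (hy : y ∈ φ.target) (hp : p ≠ 0) {t : ℝ}
    (ht : 0 < t) : ∃ u : TStar n M, u ∈ TStarZero n M ∧ u.1 ∈ φ.source ∧
      energy g φ (φ u.1) (indChart φ u).2 = t := by
  have h0 := energy_pos g hφ hy hp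
  obtain ⟨u, hu, hu1, hu2⟩ := exists_indChart_eq hφ hy (√(t / energy g φ y p) • p)
  have hs : 0 < √(t / energy g φ y p) := Real.sqrt_pos.2 (div_pos ht h0)
  refine ⟨u, (mem_TStarZero_iff hφ hu).2 ?_, hu, ?_⟩
  · rw [hu2]
    exact smul_ne_zero hs.ne' hp
  · rw [hu1, hu2, energy_smul, Real.sq_sqrt (div_pos ht h0).le, div_mul_cancel₀ _ h0.ne']

/-- This is how n ≥ 2 enters: a nonzero vector annihilated by p sees g but not p ⊗ p. -/
theorem exists_annihilated (hn : 2 ≤ n) {p : E n} (hp : p ≠ 0) :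
    ∃ v : E n, v ≠ 0 ∧ ∑ i, p i * v i = 0 := by
  obtain ⟨i, hi⟩ : ∃ i, p i ≠ 0 := by
    by_contra! h
    exact hp (by
      ext i
      exact h i)
  have : Nontrivial (Fin n) := Fin.nontrivial_iff_two_le.2 hn
  obtain ⟨j, hj⟩ := exists_ne i
  refine ⟨p j • e i - p i • e j, fun h => hi ?_, ?_⟩
  · have h1 := congrArg (fun v : E n => v j) h
    simpa [e_apply, hj] using h1
  · simp [e_apply, mul_sub]
    ring

/-- Over a point, `g` and `p ⊗ p` are linearly independent. -/
theorem coeff_eq_of_natural (hn : 2 ≤ n) (hφ : IsChart φ) {y p : E n} (hy : y ∈ φ.target)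
    (hp : p ≠ 0) {a b a' b' : ℝ} (h : ∀ i j, a * gLow g φ y i j + b * p i * p j =
      a' * gLow g φ y i j + b' * p i * p j) : a = a' ∧ b = b' := by
  obtain ⟨v, hv, hpv⟩ := exists_annihilated hn hp
  have hpos := metricForm_pos g hφ hy v hv
  -- Contraction with `v ⊗ v` kills p ⊗ p and isolates the coefficient of g.
  have key : ∀ a b : ℝ, ∑ i, ∑ j, (a * gLow g φ y i j + b * p i * p j) * (v i * v j) =
      a * metricForm g φ y v v := by
    intro a b
    have h1 : ∑ i, ∑ j, b * p i * p j * (v i * v j) = 0 := by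
      have h2 : ∀ i j, b * p i * p j * (v i * v j) = b * (p i * v i) * (p j * v j) :=
        fun i j => by ring
      simp only [h2, ← Finset.mul_sum, hpv, mul_zero, Finset.sum_const_zero]
    simp only [add_mul, Finset.sum_add_distrib]
    rw [h1, add_zero, metricForm_apply]
    simp only [Finset.mul_sum, mul_assoc]
  have ha : a = a' := by
    have h1 := key a b
    simp only [h] at h1
    rw [key a' b'] at h1
    exact (mul_right_cancel₀ hpos.ne' h1).symm
  refine ⟨ha, ?_⟩
  obtain ⟨i, hi⟩ : ∃ i, p i ≠ 0 := by
    by_contra! h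
    exact hp (by
      ext i
      exact h i)
  have h1 := h i i
  rw [ha, add_right_inj, mul_assoc, mul_assoc] at h1
  exact mul_right_cancel₀ (mul_ne_zero hi hi) h1

end Points

/-! ### The Kähler conditions as relations between the coefficients. -/

section Kaehler

variable (g : Metric n M) (w : MetricCoeffs) (a : ComplexCoeffs)
  {φ : OpenPartialHomeomorph M (E n)} {u : TStar n M}

theorem ComplexCoeffs.contDiffOn_a₁ (a : ComplexCoeffs) : ContDiffOn ℝ ∞ a.a₁ (Set.Ioi 0) :=
  contDiffOn_const.mul fun _ ht => (Real.contDiffAt_sqrt (ne_of_gt ht)).contDiffWithinAt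

theorem covQ_tensorJ_delta (hφ : IsChart φ) (hu : u.1 ∈ φ.source) (i k : Fin n) :
    covQ φ k u (tensorJ g a u (delta g φ i u)) = 0 := by
  refine (congrFun (vec_tensorJ g a hφ hu (delta g φ i u)).1 k).trans ?_
  simp [Matrix.vecMul, dotProduct, vecP, covP_delta g hφ hu]

theorem covP_tensorJ_delta (hφ : IsChart φ) (hu : u.1 ∈ φ.source) (i k : Fin n) :
    covP g φ k u (tensorJ g a u (delta g φ i u)) =
      natLow g a.a₁ a.b₁ φ (φ u.1) (indChart φ u).2 i k := by
  refine (congrFun (vec_tensorJ g a hφ hu (delta g φ i u)).2 k).trans ?_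
  simp [Matrix.vecMul, dotProduct, vecQ, covQ_delta g hφ hu]

theorem covP_tensorJ_vertical (hφ : IsChart φ) (hu : u.1 ∈ φ.source)
    {ξ : TangentSpace (IStar n) u} (hξ : ∀ i, covQ φ i u ξ = 0) (k : Fin n) :
    covP g φ k u (tensorJ g a u ξ) = 0 := by
  refine (congrFun (vec_tensorJ g a hφ hu ξ).2 k).trans ?_
  simp [Matrix.vecMul, dotProduct, vecQ, hξ]

theorem metricG_vertical_tensorJ_vertical (hφ : IsChart φ) (hu : u.1 ∈ φ.source)
    {ξ η : TangentSpace (IStar n) u} (hξ : ∀ i, covQ φ i u ξ = 0) (hη : ∀ i, covQ φ i u η = 0) :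
    metricG g w u ξ (tensorJ g a u η) = 0 := by
  have h1 : vecQ φ u ξ = 0 := funext hξ
  have h2 : vecP g φ u (tensorJ g a u η) = 0 :=
    funext fun k => covP_tensorJ_vertical g a hφ hu hη k
  rw [metricG_eq_dotProduct g w hφ hu, h1, h2]
  simp

/-- The coefficients of the product of `u g_{ij} + v p_i p_j` and `u' g^{ij} + v' g^{0i} g^{0j}`. -/
def prodFst (u u' : ℝ → ℝ) (t : ℝ) : ℝ := u t * u' t

/-- The coefficients of the product of `u g_{ij} + v p_i p_j` and `u' g^{ij} + v' g^{0i} g^{0j}`. -/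
def prodSnd (u v u' v' : ℝ → ℝ) (t : ℝ) : ℝ := u t * v' t + v t * u' t + 2 * t * v t * v' t

/-- The mixed components of the fundamental form are the entries of J⁽¹⁾G₍₂₎. -/
theorem metricG_dP_tensorJ_delta (hφ : IsChart φ) (hu : u.1 ∈ φ.source) (i k : Fin n) :
    metricG g w u (dP φ k u) (tensorJ g a u (delta g φ i u)) =
      prodFst a.a₁ w.c₂ (energy g φ (φ u.1) (indChart φ u).2) * kron i k +
      prodSnd a.a₁ a.b₁ w.c₂ w.d₂ (energy g φ (φ u.1) (indChart φ u).2) * (indChart φ u).2 i *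
        pUp g φ (φ u.1) (indChart φ u).2 k := by
  rw [metricG_symm, metricG_dP g w hφ hu]
  simp only [covP_tensorJ_delta g a hφ hu]
  have h := congrFun (congrFun (natLow_mul_natUp g a.a₁ a.b₁ w.c₂ w.d₂ hφ (φ.map_source hu)
    (indChart φ u).2) i) k
  rw [Matrix.mul_apply] at h
  refine h.trans ?_
  simp [Matrix.vecMulVec_apply, Matrix.one_apply, kron, prodFst, prodSnd, mul_assoc]

/-- On the δ/δqⁱ the Hermitian condition reads G⁽¹⁾ = J⁽¹⁾G₍₂₎J⁽¹⁾, and the coefficients of g and p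
⊗ p are compared. -/
theorem hermitian_relations (hn : 2 ≤ n) (hK : IsKahler (metricG g w) (tensorJ g a))
    (hφ : IsChart φ) (hu : u.1 ∈ φ.source) (h0 : u ∈ TStarZero n M) {t : ℝ}
    (ht : energy g φ (φ u.1) (indChart φ u).2 = t) :
    w.c₁ t = prodFst a.a₁ w.c₂ t * a.a₁ t ∧
    w.d₁ t = prodFst a.a₁ w.c₂ t * a.b₁ t + prodSnd a.a₁ a.b₁ w.c₂ w.d₂ t * a.a₁ t +
      2 * t * prodSnd a.a₁ a.b₁ w.c₂ w.d₂ t * a.b₁ t := by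
  have hz := φ.map_source hu
  have hp := (mem_TStarZero_iff hφ hu).1 h0
  refine coeff_eq_of_natural g hn hφ hz hp fun i j => ?_
  have h1 := hK.hermitian u h0 (delta g φ i u) (delta g φ j u)
  rw [metricG_delta_delta g w hφ hu, metricG_eq_dotProduct g w hφ hu] at h1
  set p := (indChart φ u).2
  set y := φ u.1
  have h2 : ∀ i, vecQ φ u (tensorJ g a u (delta g φ i u)) = 0 := fun i =>
    funext fun k => covQ_tensorJ_delta g a hφ hu i k
  have h3 : ∀ i, vecP g φ u (tensorJ g a u (delta g φ i u)) =
      natLow g a.a₁ a.b₁ φ y p i := fun i =>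
    funext fun k => covP_tensorJ_delta g a hφ hu i k
  have h4 : natLow g a.a₁ a.b₁ φ y p i ⬝ᵥ
      (G2 g w φ y p).mulVec (natLow g a.a₁ a.b₁ φ y p j) =
      (natLow g a.a₁ a.b₁ φ y p * natUp g w.c₂ w.d₂ φ y p * natLow g a.a₁ a.b₁ φ y p) i j := by
    rw [Matrix.dotProduct_mulVec, Matrix.mul_apply]
    refine Finset.sum_congr rfl fun k _ => ?_
    have h5 : natLow g a.a₁ a.b₁ φ y p j k = natLow g a.a₁ a.b₁ φ y p k j := by
      simp only [natLow, Matrix.of_apply, gLow_symm g φ y j k]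
      ring
    rw [h5]
    rfl
  rw [h2, h2, h3, h3, h4, natLow_mul_natUp g _ _ _ _ hφ hz, natLow_eq, ht] at h1
  simp only [zero_dotProduct, Matrix.add_mul, Matrix.mul_add, Matrix.smul_mul, Matrix.mul_smul,
    Matrix.one_mul, Matrix.vecMulVec_mul_vecMulVec] at h1
  have h6 : Matrix.vecMul (pUp g φ y p) (gLow g φ y) = (p : Fin n → ℝ) := by
    have : pUp g φ y p = Matrix.vecMul p (gUp g φ y) := rfl
    rw [this, Matrix.vecMul_vecMul, gUp_mul_gLow g hφ hz, Matrix.vecMul_one]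
  have h7 : pUp g φ y p ⬝ᵥ (p : Fin n → ℝ) = 2 * t := by
    rw [dotProduct_comm, ← ht]
    exact sum_mul_pUp g φ y p
  rw [Matrix.vecMulVec_mul, h6, h7] at h1
  simp only [Matrix.add_apply, Matrix.smul_apply, Matrix.vecMulVec_apply, Pi.smul_apply, smul_eq_mul,
    G1, natLow, Matrix.of_apply] at h1
  rw [ht] at h1
  rw [← h1]
  simp only [prodFst, prodSnd]
  ring

end Kaehler

section Kaehler

variable (g : Metric n M) (w : MetricCoeffs) (a : ComplexCoeffs)
  {φ : OpenPartialHomeomorph M (E n)} {u : TStar n M}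

/-- The components of `J δ/δqⁱ` in the induced chart. -/
def flatJDelta (φ : OpenPartialHomeomorph M (E n)) (i : Fin n) (z : E n × E n) : E n × E n :=
  (0, ∑ h, natLow g a.a₁ a.b₁ φ z.1 z.2 i h • (e h : E n))

theorem tensorJ_delta (hφ : IsChart φ) (hu : u.1 ∈ φ.source) (i : Fin n) :
    tensorJ g a u (delta g φ i u) = liftField φ (flatJDelta g a φ i) u := by
  rw [liftField_apply, flatJDelta, indInv_vertical]
  refine ext_cov g hφ hu (fun k => ?_) fun k => ?_
  · rw [covQ_tensorJ_delta g a hφ hu, covQ_sum_dP hφ hu]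
  · rw [covP_tensorJ_delta g a hφ hu, covP_sum_dP g hφ hu]
    rfl

theorem contDiffAt_flatJDelta (hφ : IsChart φ) {z : E n × E n} (hz : z.1 ∈ φ.target)
    (hp : z.2 ≠ 0) (i : Fin n) : ContDiffAt ℝ ∞ (flatJDelta g a φ i) z :=
  contDiffAt_const.prodMk (ContDiffAt.sum fun h _ => contDiffAt_smul_const
    (contDiffAt_natLow g hφ hz hp a.contDiffOn_a₁ a.smooth_b₁ i h) _)

theorem fderiv_flatJDelta (hφ : IsChart φ) {z : E n × E n} (hz : z.1 ∈ φ.target)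
    (hp : z.2 ≠ 0) (i : Fin n) (ζ : E n × E n) : fderiv ℝ (flatJDelta g a φ i) z ζ =
      (0, ∑ h, fderiv ℝ (fun z : E n × E n => natLow g a.a₁ a.b₁ φ z.1 z.2 i h) z ζ •
        (e h : E n)) :=
  fderiv_const_prodMk_sum
    (fun h => contDiffAt_natLow g hφ hz hp a.contDiffOn_a₁ a.smooth_b₁ i h) 0 ζ

theorem eventually_tensorJ_delta (hφ : IsChart φ) (hu : u.1 ∈ φ.source) (i : Fin n) :
    (fun v => tensorJ g a v (delta g φ i v)) =ᶠ[𝓝 u] liftField φ (flatJDelta g a φ i) :=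
  (eventually_mem_source φ hu).mono fun _ hv => tensorJ_delta g a hφ hv i

/-- The q-components of both fields are constant in an induced chart. J sends the resulting vertical
bracket to a horizontal vector, so it drops out of the vertical part of the Nijenhuis tensor. -/
theorem covQ_mlieBracket_tensorJ_delta (hφ : IsChart φ) (hu : u.1 ∈ φ.source)
    (h0 : u ∈ TStarZero n M) (i j k : Fin n) :
    covQ φ k u (mlieBracket (IStar n) (fun v => tensorJ g a v (delta g φ i v))
      (delta g φ j) u) = 0 := by
  have hz : (indChart φ u).1 ∈ φ.target := φ.map_source hu
  have hp := (mem_TStarZero_iff hφ hu).1 h0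
  have h1 := (eventually_tensorJ_delta g a hφ hu i).mlieBracket_vectorField_eq
    (Filter.EventuallyEq.refl (𝓝 u) (delta g φ j))
  rw [h1, delta_eq_liftField, mlieBracket_liftField hφ hu
    (contDiffAt_flatJDelta g a hφ hz hp i) (contDiffAt_flatDelta g hφ hz j),
    covQ_eq, dInd_indInv hφ hu, fderiv_flatDelta g hφ hz, fderiv_flatJDelta g a hφ hz hp]
  simp

theorem fderiv_natLow_flatJDelta (hφ : IsChart φ) {z : E n × E n} (hz : z.1 ∈ φ.target)
    (hp : z.2 ≠ 0) (i j h : Fin n) :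
    fderiv ℝ (fun z : E n × E n => natLow g a.a₁ a.b₁ φ z.1 z.2 j h) z (flatJDelta g a φ i z) =
      ∑ k, natLow g a.a₁ a.b₁ φ z.1 z.2 i k *
        pd k (fun r => natLow g a.a₁ a.b₁ φ z.1 r j h) z.2 := by
  have h1 : flatJDelta g a φ i z = ∑ k, natLow g a.a₁ a.b₁ φ z.1 z.2 i k •
      ((0, e k) : E n × E n) := by
    refine Prod.ext ?_ ?_ <;> simp [flatJDelta, Prod.fst_sum, Prod.snd_sum]
  have hd := (contDiffAt_natLow g hφ hz hp a.contDiffOn_a₁ a.smooth_b₁ j h).differentiableAt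
    (by simp)
  rw [h1, map_sum]
  simp only [map_smul, smul_eq_mul]
  exact Finset.sum_congr rfl fun k _ => by
    rw [pd_eq_fderiv_snd (f := fun y r => natLow g a.a₁ a.b₁ φ y r j h) hd]

theorem covP_mlieBracket_tensorJ_tensorJ (hφ : IsChart φ) (hu : u.1 ∈ φ.source)
    (h0 : u ∈ TStarZero n M) (i j h : Fin n) :
    covP g φ h u (mlieBracket (IStar n) (fun v => tensorJ g a v (delta g φ i v))
      (fun v => tensorJ g a v (delta g φ j v)) u) =
      ∑ k, natLow g a.a₁ a.b₁ φ (φ u.1) (indChart φ u).2 i k *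
        pd k (fun r => natLow g a.a₁ a.b₁ φ (φ u.1) r j h) (indChart φ u).2 -
      ∑ k, natLow g a.a₁ a.b₁ φ (φ u.1) (indChart φ u).2 j k *
        pd k (fun r => natLow g a.a₁ a.b₁ φ (φ u.1) r i h) (indChart φ u).2 := by
  have hz : (indChart φ u).1 ∈ φ.target := φ.map_source hu
  have hp := (mem_TStarZero_iff hφ hu).1 h0
  rw [(eventually_tensorJ_delta g a hφ hu i).mlieBracket_vectorField_eq
    (eventually_tensorJ_delta g a hφ hu j), mlieBracket_liftField hφ hu
    (contDiffAt_flatJDelta g a hφ hz hp i) (contDiffAt_flatJDelta g a hφ hz hp j),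
    fderiv_flatJDelta g a hφ hz hp, fderiv_flatJDelta g a hφ hz hp, Prod.mk_sub_mk, sub_zero,
    ← Finset.sum_sub_distrib]
  simp only [← sub_smul]
  rw [indInv_vertical, covP_sum_dP g hφ hu, fderiv_natLow_flatJDelta g a hφ hz hp,
    fderiv_natLow_flatJDelta g a hφ hz hp]
  rfl

theorem natLow_mulVec_pUp (f h : ℝ → ℝ) (hφ : IsChart φ) {y : E n} (hy : y ∈ φ.target) (p : E n)
    (i : Fin n) : ∑ k, natLow g f h φ y p i k * pUp g φ y p k =
      (f (energy g φ y p) + 2 * energy g φ y p * h (energy g φ y p)) * p i := by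
  have h1 : Matrix.mulVec (gLow g φ y) (pUp g φ y p) i = p i :=
    congrFun (gLow_mulVec_pUp g hφ hy p) i
  rw [Matrix.mulVec, dotProduct] at h1
  have h2 := sum_mul_pUp g φ y p
  have h3 : ∀ k, natLow g f h φ y p i k * pUp g φ y p k =
      f (energy g φ y p) * (gLow g φ y i k * pUp g φ y p k) +
      h (energy g φ y p) * p i * (p k * pUp g φ y p k) := fun k => by
    simp only [natLow, Matrix.of_apply]
    ring
  simp only [h3, Finset.sum_add_distrib, ← Finset.mul_sum, h1, h2]
  ring

/-- The derivative of the components of J⁽¹⁾ along the vertical field Jδ/δqⁱ, from which the bracket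
of two such fields is formed. The factor in front of p_i is the one by which J⁽¹⁾ acts on p♯. -/
theorem sum_natLow_mul_pd_natLow {f h : ℝ → ℝ} (hf : ContDiffOn ℝ ∞ f (Set.Ioi 0))
    (hh : ContDiffOn ℝ ∞ h (Set.Ioi 0)) (hφ : IsChart φ) {y p : E n} (hy : y ∈ φ.target)
    (hp : p ≠ 0) (i j l : Fin n) :
    ∑ k, natLow g f h φ y p i k * pd k (fun r => natLow g f h φ y r j l) p =
      (f (energy g φ y p) + 2 * energy g φ y p * h (energy g φ y p)) * p i *
        (deriv f (energy g φ y p) * gLow g φ y j l + deriv h (energy g φ y p) * p j * p l) +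
      h (energy g φ y p) * (natLow g f h φ y p i j * p l + p j * natLow g f h φ y p i l) := by
  have h1 : ∀ k, natLow g f h φ y p i k * pd k (fun r => natLow g f h φ y r j l) p =
      natLow g f h φ y p i k * pUp g φ y p k *
        (deriv f (energy g φ y p) * gLow g φ y j l + deriv h (energy g φ y p) * p j * p l) +
      h (energy g φ y p) * (natLow g f h φ y p i k * kron j k * p l +
        p j * (natLow g f h φ y p i k * kron l k)) := fun k => by
    rw [pd_natLow g hφ hy hp hf hh]
    ring
  have h2 : ∀ j, ∑ k, natLow g f h φ y p i k * kron j k = natLow g f h φ y p i j := fun j => by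
    simp [kron]
  simp only [h1, Finset.sum_add_distrib, ← Finset.mul_sum, ← Finset.sum_mul, h2,
    natLow_mulVec_pUp g f h hφ hy]

/-- The vertical part of the Nijenhuis tensor on `δ/δqⁱ`, `δ/δq^j`. -/
theorem nijenhuis_relation (hn : 2 ≤ n) {c : ℝ} (hc : HasConstantSectionalCurvature g c)
    (hK : IsKahler (metricG g w) (tensorJ g a)) (hφ : IsChart φ) (hu : u.1 ∈ φ.source)
    (h0 : u ∈ TStarZero n M) {t : ℝ} (ht : energy g φ (φ u.1) (indChart φ u).2 = t) :
    (a.a₁ t + 2 * t * a.b₁ t) * deriv a.a₁ t - a.a₁ t * a.b₁ t = c := by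
  have hz := φ.map_source hu
  have hp := (mem_TStarZero_iff hφ hu).1 h0
  set y := φ u.1 with hy
  set p := (indChart φ u).2 with hp_def
  set C := (a.a₁ t + 2 * t * a.b₁ t) * deriv a.a₁ t - a.a₁ t * a.b₁ t
  -- Antisymmetrization in i, j removes the terms in b₁' and the products of three momenta; the
  -- curvature term has the same shape as what remains.
  have key : ∀ i j h, C * (p i * gLow g φ y j h - p j * gLow g φ y i h) =
      c * (p i * gLow g φ y j h - p j * gLow g φ y i h) := by
    intro i j h
    have h1 := congrArg (covP g φ h u) (hK.integrable u h0 (delta g φ i) (delta g φ j)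
      (diffAt_delta g hφ hu i) (diffAt_delta g hφ hu j))
    have hz0 : covP g φ h u 0 = 0 := map_zero (covPₗ g φ h u)
    have hq := covQ_mlieBracket_tensorJ_delta g a hφ hu h0
    have hq' : ∀ k, covQ φ k u (mlieBracket (IStar n) (delta g φ i)
        (fun v => tensorJ g a v (delta g φ j v)) u) = 0 := by
      intro k
      rw [mlieBracket_swap_apply, covQ_neg, hq, neg_zero]
    rw [covP_sub, covP_sub, covP_sub, covP_mlieBracket_tensorJ_tensorJ g a hφ hu h0,
      covP_tensorJ_vertical g a hφ hu (fun k => hq i j k),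
      covP_tensorJ_vertical g a hφ hu hq', mlieBracket_delta_delta g hφ hu,
      covP_sum_dP g hφ hu, hz0, curvatureZero_of_constant g hc hφ hz,
      sum_natLow_mul_pd_natLow g a.contDiffOn_a₁ a.smooth_b₁ hφ hz hp,
      sum_natLow_mul_pd_natLow g a.contDiffOn_a₁ a.smooth_b₁ hφ hz hp] at h1
    simp only [natLow, Matrix.of_apply, ← hp_def, ht] at h1
    rw [gLow_symm g φ y j i, gLow_symm g φ y h j, gLow_symm g φ y h i] at h1
    linear_combination h1
  -- With p_i ≠ 0, contracting j and h with a vector `v` annihilated by p leaves p_i g(v, v), a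
  -- nonzero factor.
  obtain ⟨i, hi⟩ : ∃ i, p i ≠ 0 := by
    by_contra! h
    exact hp (by
      ext i
      exact h i)
  obtain ⟨v, hv, hpv⟩ := exists_annihilated hn hp
  have hpos := metricForm_pos g hφ hz v hv
  have hsum : ∑ j, ∑ h, (p i * gLow g φ y j h - p j * gLow g φ y i h) * (v j * v h) =
      p i * metricForm g φ y v v := by
    have h1 : ∑ j, ∑ h, p j * gLow g φ y i h * (v j * v h) = 0 := by
      have h2 : ∀ j h, p j * gLow g φ y i h * (v j * v h) = p j * v j * (gLow g φ y i h * v h) :=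
        fun j h => by ring
      simp only [h2, ← Finset.mul_sum, ← Finset.sum_mul, hpv, zero_mul]
    simp only [sub_mul, Finset.sum_sub_distrib]
    rw [h1, sub_zero, metricForm_apply]
    simp only [Finset.mul_sum, mul_assoc]
  have h3 : C * (p i * metricForm g φ y v v) = c * (p i * metricForm g φ y v v) := by
    rw [← hsum]
    simp only [Finset.mul_sum, ← mul_assoc C, ← mul_assoc c, key]
  exact mul_right_cancel₀ (mul_ne_zero hi hpos.ne') h3

theorem contDiffOn_prodFst {f f' : ℝ → ℝ} (hf : ContDiffOn ℝ ∞ f (Set.Ioi 0))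
    (hf' : ContDiffOn ℝ ∞ f' (Set.Ioi 0)) : ContDiffOn ℝ ∞ (prodFst f f') (Set.Ioi 0) :=
  hf.mul hf'

theorem contDiffOn_prodSnd {f h f' h' : ℝ → ℝ} (hf : ContDiffOn ℝ ∞ f (Set.Ioi 0))
    (hh : ContDiffOn ℝ ∞ h (Set.Ioi 0)) (hf' : ContDiffOn ℝ ∞ f' (Set.Ioi 0))
    (hh' : ContDiffOn ℝ ∞ h' (Set.Ioi 0)) :
    ContDiffOn ℝ ∞ (prodSnd f h f' h') (Set.Ioi 0) :=
  ((hf.mul hh').add (hh.mul hf')).add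
    (((contDiffOn_const.mul contDiffOn_id).mul hh).mul hh')

theorem dirDeriv_congr {F F' : TStar n M → ℝ} (h : F =ᶠ[𝓝 u] F')
    (ξ : TangentSpace (IStar n) u) : dirDeriv F u ξ = dirDeriv F' u ξ := by
  rw [dirDeriv, dirDeriv, h.mfderiv_eq]
  rfl

theorem eventually_mem_TStarZero (hφ : IsChart φ) (hu : u.1 ∈ φ.source) (h0 : u ∈ TStarZero n M) :
    ∀ᶠ v in 𝓝 u, v ∈ TStarZero n M ∧ v.1 ∈ φ.source := by
  have h1 : ContinuousAt (fun v => (indChart φ v).2) u :=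
    continuousAt_snd.comp (contMDiffAt_indChart hφ hu).continuousAt
  filter_upwards [h1.eventually (isOpen_ne.mem_nhds ((mem_TStarZero_iff hφ hu).1 h0)),
    eventually_mem_source φ hu] with v hv hv'
  exact ⟨(mem_TStarZero_iff hφ hv').2 hv, hv'⟩

/-- The closedness of the fundamental form on `δ/δqⁱ`, `∂/∂pⱼ`, `∂/∂pₖ`. -/
theorem closed_relation (hn : 2 ≤ n) (hK : IsKahler (metricG g w) (tensorJ g a))
    (hφ : IsChart φ) (hu : u.1 ∈ φ.source) (h0 : u ∈ TStarZero n M) {t : ℝ}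
    (ht : energy g φ (φ u.1) (indChart φ u).2 = t) :
    deriv (prodFst a.a₁ w.c₂) t = prodSnd a.a₁ a.b₁ w.c₂ w.d₂ t := by
  have hz := φ.map_source hu
  have hp := (mem_TStarZero_iff hφ hu).1 h0
  set y := φ u.1 with hy
  set p := (indChart φ u).2 with hp_def
  have hF := contDiffOn_prodFst a.contDiffOn_a₁ w.smooth_c₂
  have hm := contDiffOn_prodSnd a.contDiffOn_a₁ a.smooth_b₁ w.smooth_c₂ w.smooth_d₂
  set f := prodFst a.a₁ w.c₂
  set m := prodSnd a.a₁ a.b₁ w.c₂ w.d₂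
  have hd : ∀ i j k, dirDeriv (fun v => metricG g w v (dP φ k v) (tensorJ g a v (delta g φ i v)))
      u (dP φ j u) = pd j (fun r => f (energy g φ y r) * kron i k +
        m (energy g φ y r) * r i * pUp g φ y r k) p := by
    intro i j k
    refine dirDeriv_dP hφ hu (f := fun y r => f (energy g φ y r) * kron i k +
        m (energy g φ y r) * r i * pUp g φ y r k)
      (fun v hv => metricG_dP_tensorJ_delta g w a hφ hv i k) ?_ j
    exact ((contDiffAt_comp_energy g hφ hz hp hF).mul contDiffAt_const).add
      (((contDiffAt_comp_energy g hφ hz hp hm).mul (contDiffAt_snd_apply i)).mul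
        (contDiffAt_pUp g hφ hz k))
  -- The Hermitian condition and J² = −I make G(·, J·) skew, so a single family of mixed components
  -- suffices.
  have hd' : ∀ i j k, dirDeriv (fun v => metricG g w v (delta g φ i v)
      (tensorJ g a v (dP φ j v))) u (dP φ k u) = -dirDeriv (fun v => metricG g w v (dP φ j v)
        (tensorJ g a v (delta g φ i v))) u (dP φ k u) := by
    intro i j k
    have h1 : (fun v => metricG g w v (delta g φ i v) (tensorJ g a v (dP φ j v))) =ᶠ[𝓝 u]
        fun v => -metricG g w v (dP φ j v) (tensorJ g a v (delta g φ i v)) := by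
      filter_upwards [eventually_mem_TStarZero hφ hu h0] with v hv
      have h2 := hK.hermitian v hv.1 (delta g φ i v) (tensorJ g a v (dP φ j v))
      rw [hK.almostComplex v hv.1, metricG_symm, metricG_neg_left] at h2
      exact h2.symm
    rw [dirDeriv_congr h1]
    have h3 := mfderiv_neg (I := IStar n) (x := u)
      (f := fun v => metricG g w v (dP φ j v) (tensorJ g a v (delta g φ i v)))
    exact congrArg (fun L : TangentSpace (IStar n) u →L[ℝ] ℝ => L (dP φ k u)) h3
  have hv0 : ∀ j k : Fin n, covQ φ k u (dP φ j u) = 0 := fun j k => covQ_dP hφ hu j k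
  -- The brackets involved are vertical and contribute nothing, so closedness says that the momentum
  -- derivatives of the mixed components are symmetric.
  have key : ∀ i j k, pd j (fun r => f (energy g φ y r) * kron i k +
        m (energy g φ y r) * r i * pUp g φ y r k) p = pd k (fun r => f (energy g φ y r) *
        kron i j + m (energy g φ y r) * r i * pUp g φ y r j) p := by
    intro i j k
    have h1 := hK.closed u h0 (delta g φ i) (dP φ j) (dP φ k) (diffAt_delta g hφ hu i)
      (diffAt_dP hφ hu j) (diffAt_dP hφ hu k)
    rw [hd', hd, hd, dirDeriv_eq_zero hφ hu (fun v hv => metricG_vertical_tensorJ_vertical g w a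
      hφ hv (fun l => covQ_dP hφ hv j l) (fun l => covQ_dP hφ hv k l)), mlieBracket_dP_dP hφ hu,
      metricG_zero_left, metricG_vertical_tensorJ_vertical g w a hφ hu ?_ (hv0 k),
      metricG_vertical_tensorJ_vertical g w a hφ hu ?_ (hv0 j)] at h1
    · linarith
    · intro l
      rw [mlieBracket_dP_delta g hφ hu, covQ_sum_dP hφ hu]
    · intro l
      rw [mlieBracket_delta_dP g hφ hu, covQ_neg, covQ_sum_dP hφ hu, neg_zero]
  obtain ⟨j, hj⟩ : ∃ j, pUp g φ y p j ≠ 0 := by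
    by_contra! h
    have h1 := sum_mul_pUp g φ y p
    simp only [h, mul_zero, Finset.sum_const_zero] at h1
    have h2 := energy_pos g hφ hz hp
    linarith
  have : Nontrivial (Fin n) := Fin.nontrivial_iff_two_le.2 hn
  obtain ⟨k, hk⟩ := exists_ne j
  -- For k ≠ j the derivative of f survives on one side and the undifferentiated m on the other,
  -- both times g^{0j}; all other terms agree.
  have h1 := key k j k
  rw [pd_mixed g hφ hz hp hF hm, pd_mixed g hφ hz hp hF hm, ht, gUp_symm g φ y k j] at h1
  simp only [kron, if_true, if_neg hk] at h1
  have h2 : (deriv f t - m t) * pUp g φ y p j = 0 := by linear_combination h1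
  exact sub_eq_zero.1 ((mul_eq_zero.1 h2).resolve_right hj)

end Kaehler

/-! ### Scalar identities, with the square roots removed by t = s² and c = k². -/

section Scalars

/-- The relations of the coefficients of a Kähler structure and of their first derivatives at
`t = s²`; `k = √c`, `q = √2` and `B`, `B'` stand for `√2 b₁`, `√2 b₁'`. -/
structure KaehlerRelations (q k s l l' l'' B B' c₁ c₁' d₁ d₁' c₂ c₂' d₂ d₂' : ℝ) : Prop where
  two : q ^ 2 = 2
  pos_q : 0 < q
  pos_k : 0 < k
  pos_s : 0 < s
  pos_l : 0 < l
  pos_l' : 0 < l + 2 * s ^ 2 * l'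
  pos_B : 0 < k + s * B
  hc₁ : c₁ = q * (l * k * s)
  hc₁' : c₁' = q * (k * (l' * s + l / (2 * s)))
  hd₁ : c₁ + 2 * s ^ 2 * d₁ = q * ((l + 2 * s ^ 2 * l') * (s * (k + s * B)))
  hd₁' : c₁' + 2 * d₁ + 2 * s ^ 2 * d₁' = q * ((3 * l' + 2 * s ^ 2 * l'') * (s * (k + s * B)) +
    (l + 2 * s ^ 2 * l') * (k / (2 * s) + B + s ^ 2 * B'))
  hc₂ : c₂ * (q * (k * s)) = l
  hc₂' : c₂' * (q * (k * s)) + c₂ * (q * (k / (2 * s))) = l'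
  hd₂ : (c₂ + 2 * s ^ 2 * d₂) * (q * (s * (k + s * B))) = l + 2 * s ^ 2 * l'
  hd₂' : (c₂' + 2 * d₂ + 2 * s ^ 2 * d₂') * (q * (s * (k + s * B))) +
    (c₂ + 2 * s ^ 2 * d₂) * (q * (k / (2 * s) + B + s ^ 2 * B')) = 3 * l' + 2 * s ^ 2 * l''

variable {q k s l l' l'' B B' c₁ c₁' d₁ d₁' c₂ c₂' d₂ d₂' : ℝ}

namespace KaehlerRelations

/-- The relations are solved one after another, each being linear in one new unknown; positivity
makes all denominators nonzero. -/
theorem solve (r : KaehlerRelations q k s l l' l'' B B' c₁ c₁' d₁ d₁' c₂ c₂' d₂ d₂') :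
    d₁ = q * ((l' * (k + s * B) + l * B / (2 * s)) * s) ∧ c₂ = l / (q * (k * s)) ∧
    c₂' = (2 * s ^ 2 * l' - l) / (2 * q * k * s ^ 3) ∧
    d₂ = (2 * s * k * l' - l * B) / (2 * q * s ^ 2 * k * (k + s * B)) ∧
    d₁' = (q * ((3 * l' + 2 * s ^ 2 * l'') * (s * (k + s * B)) +
      (l + 2 * s ^ 2 * l') * (k / (2 * s) + B + s ^ 2 * B')) - c₁' - 2 * d₁) / (2 * s ^ 2) ∧
    c₂ + 2 * s ^ 2 * d₂ = (l + 2 * s ^ 2 * l') / (q * (s * (k + s * B))) ∧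
    d₂' = ((3 * l' + 2 * s ^ 2 * l'') / (q * (s * (k + s * B))) -
      (l + 2 * s ^ 2 * l') * (k / (2 * s) + B + s ^ 2 * B') / (q * (s * (k + s * B)) ^ 2) -
      c₂' - 2 * d₂) / (2 * s ^ 2) := by
  obtain ⟨-, hq, hk, hs, hl, hL, hB, a1, a2, a3, a4, a5, a6, a7, a8⟩ := r
  have e1 : c₂ = l / (q * (k * s)) := by
    field_simp
    linear_combination a5
  have e2 : c₂' = (2 * s ^ 2 * l' - l) / (2 * q * k * s ^ 3) := by
    rw [e1] at a6
    field_simp at a6 ⊢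
    linear_combination a6
  have e3 : d₂ = (2 * s * k * l' - l * B) / (2 * q * s ^ 2 * k * (k + s * B)) := by
    rw [e1] at a7
    field_simp at a7 ⊢
    refine mul_left_cancel₀ hs.ne' ?_
    linear_combination a7
  have e4 : c₂ + 2 * s ^ 2 * d₂ = (l + 2 * s ^ 2 * l') / (q * (s * (k + s * B))) := by
    rw [← a7]
    field_simp
  refine ⟨?_, e1, e2, e3, ?_, e4, ?_⟩
  · rw [a1] at a3
    field_simp
    refine mul_left_cancel₀ (pow_ne_zero 2 hs.ne') ?_
    linear_combination a3
  · rw [← a4]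
    field_simp
    ring
  · rw [e4, e2, e3] at a8
    rw [e2, e3]
    field_simp at a8 ⊢
    linear_combination a8

/-- The left sides are the coefficients of `Q_eq_of_coeffs`; after substituting `solve`, both sides
are rational functions in the same variables. -/
theorem coeffs_Q (r : KaehlerRelations q k s l l' l'' B B' c₁ c₁' d₁ d₁' c₂ c₂' d₂ d₂') :
    (2 * d₂ - c₂') / (2 * (c₂ + 2 * s ^ 2 * d₂)) = (k - s * B) / (4 * k * s ^ 2) ∧
    c₂' / (2 * c₂) = -((l - 2 * s ^ 2 * l') / (4 * s ^ 2 * l)) ∧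
    (2 * c₂' * (-d₂ / (c₂ * (c₂ + 2 * s ^ 2 * d₂))) + d₂' / (c₂ + 2 * s ^ 2 * d₂)) / 2 =
      (l * (B ^ 2 / 2 * l + k ^ 2 * l') - k * l * (B' * l - B * l') * s
          + (B ^ 2 * l * l' - 4 * k ^ 2 * l' ^ 2 + 2 * k ^ 2 * l * l'') * s ^ 2
          - 2 * k * (l * l' * B' + 2 * B * l' ^ 2 - l * l'' * B) * s ^ 3) /
        (4 * k * s ^ 2 * l * (k + s * B) * (l + 2 * s ^ 2 * l')) := by
  obtain ⟨-, e1, e2, e3, -, e4, e5⟩ := r.solve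
  obtain ⟨-, hq, hk, hs, hl, hL, hB, -⟩ := r
  rw [e4]
  refine ⟨?_, ?_, ?_⟩
  · rw [e2, e3]
    field_simp
    ring
  · rw [e1, e2]
    field_simp
    ring
  · rw [e5, e1, e2, e3]
    field_simp
    ring

theorem coeffs_P (r : KaehlerRelations q k s l l' l'' B B' c₁ c₁' d₁ d₁' c₂ c₂' d₂ d₂') :
    (d₁ - k ^ 2 * c₂) / (2 * c₁) =
      (-k * l + B * l * s + 2 * k * l' * s ^ 2 + 2 * B * l' * s ^ 3) / (4 * k * l * s ^ 2) ∧
    (d₁ + k ^ 2 * c₂) / (2 * (c₁ + 2 * s ^ 2 * d₁)) = 1 / (4 * s ^ 2) ∧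
    c₁' / (2 * c₁) = (l + 2 * s ^ 2 * l') / (4 * s ^ 2 * l) ∧
    ((c₁' + d₁ - k ^ 2 * c₂) * (-d₁ / (c₁ * (c₁ + 2 * s ^ 2 * d₁))) +
        d₁' / (c₁ + 2 * s ^ 2 * d₁)) / 2 =
      (l * (-(B ^ 2) / 2 * l + k ^ 2 * l') + k * B' * l ^ 2 * s
          - 2 * (B ^ 2 * l * l' + 2 * k ^ 2 * l' ^ 2 - k ^ 2 * l * l'') * s ^ 2
          + 2 * k * (B' * l * l' - 3 * B * l' ^ 2 + B * l * l'') * s ^ 3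
          - 2 * B ^ 2 * l' ^ 2 * s ^ 4) /
        (4 * k * l * s ^ 2 * (k + s * B) * (l + 2 * s ^ 2 * l')) := by
  obtain ⟨e1, e2, -, -, e3, -, -⟩ := r.solve
  obtain ⟨h2, hq, hk, hs, hl, hL, hB, f1, f2, f3, -⟩ := r
  -- By q² = 2 the division by q in c₂ becomes a multiplication, so that q becomes a common factor
  -- with d₁ and cancels.
  have e4 : k ^ 2 * c₂ = q * (k * l / (2 * s)) := by
    rw [e2]
    field_simp
    rw [h2]
  rw [f3, e4]
  refine ⟨?_, ?_, ?_, ?_⟩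
  · rw [e1, f1]
    field_simp
    ring
  · have h : d₁ + q * (k * l / (2 * s)) =
        q * ((k + s * B) * (l + 2 * s ^ 2 * l') / (2 * s)) := by
      rw [e1]
      field_simp
      ring
    rw [h]
    -- As a single symbol this factor cancels without being expanded.
    generalize l + 2 * s ^ 2 * l' = L at hL ⊢
    field_simp
    norm_num
  · rw [f1, f2]
    field_simp
    ring
  · rw [e3, e1, f2, f1]
    field_simp
    ring

theorem coeffs_S (r : KaehlerRelations q k s l l' l'' B B' c₁ c₁' d₁ d₁' c₂ c₂' d₂ d₂') :
    -(c₁' / (2 * (c₂ + 2 * s ^ 2 * d₂))) = -k * (k + s * B) / 2 ∧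
    k ^ 2 / 2 - d₁ / (2 * c₂) =
      k * (k * l - B * l * s - 2 * k * l' * s ^ 2 - 2 * B * l' * s ^ 3) / (2 * l) ∧
    -(k ^ 2 / 2) - d₁ / (2 * c₂) =
      -(k * (k * l + B * l * s + 2 * k * l' * s ^ 2 + 2 * B * l' * s ^ 3) / (2 * l)) ∧
    -(d₁' / (c₂ + 2 * s ^ 2 * d₂) + 2 * d₁ * (-d₂ / (c₂ * (c₂ + 2 * s ^ 2 * d₂)))) / 2 =
      -((l * (B ^ 2 * l + k ^ 2 * l') + k * l * (l * B' + 4 * l' * B) * s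
          + (l ^ 2 * B * B' + 5 * l * l' * B ^ 2 - 4 * k ^ 2 * l' ^ 2 + 2 * k ^ 2 * l * l'') * s ^ 2
          + 2 * k * (l * l' * B' - 2 * l' ^ 2 * B + 2 * l * l'' * B) * s ^ 3
          + 2 * l * B * (l' * B' + l'' * B) * s ^ 4) / (2 * l * (l + 2 * s ^ 2 * l'))) := by
  obtain ⟨e1, e2, -, e3, e4, e5, -⟩ := r.solve
  obtain ⟨h2, hq, hk, hs, hl, hL, hB, f1, f2, -⟩ := r
  have f3 : c₁' = q * (k * (l + 2 * s ^ 2 * l') / (2 * s)) := by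
    rw [f2]
    field_simp
    ring
  rw [e5]
  refine ⟨?_, ?_, ?_, ?_⟩
  · rw [f3]
    field_simp
    rw [h2]
  · rw [e1, e2]
    field_simp
    rw [h2]
    ring
  · rw [e1, e2]
    field_simp
    rw [h2]
    ring
  · rw [e4, f2, e1, e2, e3]
    field_simp
    rw [h2]
    ring

end KaehlerRelations

theorem sqrt_mul_sq {x y : ℝ} (hx : 0 ≤ x) (hy : 0 ≤ y) : √(x * y ^ 2) = √x * y := by
  rw [Real.sqrt_mul hx, Real.sqrt_sq hy]

/-- Squares in place of c and t remove their roots; the remaining √2 is absorbed in √2 b and √2 b',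
the variables of `KaehlerRelations`. -/
theorem coeffQ_sq (hk : 0 ≤ k) (hs : 0 ≤ s) (b b' : ℝ) :
    coeffQ (k ^ 2) (s ^ 2) l l' l'' b b' =
      (l * ((√2 * b) ^ 2 / 2 * l + k ^ 2 * l') - k * l * (√2 * b' * l - √2 * b * l') * s
          + ((√2 * b) ^ 2 * l * l' - 4 * k ^ 2 * l' ^ 2 + 2 * k ^ 2 * l * l'') * s ^ 2
          - 2 * k * (l * l' * (√2 * b') + 2 * (√2 * b) * l' ^ 2 - l * l'' * (√2 * b)) * s ^ 3) /
        (4 * k * s ^ 2 * l * (k + s * (√2 * b)) * (l + 2 * s ^ 2 * l')) := by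
  have h2 : √2 ^ 2 = 2 := Real.sq_sqrt (by norm_num)
  rw [coeffQ, sqrt_mul_sq (by norm_num) hk, sqrt_mul_sq (by norm_num) hs, Real.sqrt_sq hk,
    Real.sqrt_sq hs]
  congr 1
  · linear_combination (-(b ^ 2 * l ^ 2 / 2 + b ^ 2 * l * l' * s ^ 2)) * h2
  · ring

theorem coeffP_sq (hk : 0 ≤ k) (hs : 0 ≤ s) (b b' : ℝ) :
    coeffP (k ^ 2) (s ^ 2) l l' l'' b b' =
      (l * (-((√2 * b) ^ 2) / 2 * l + k ^ 2 * l') + k * (√2 * b') * l ^ 2 * s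
          - 2 * ((√2 * b) ^ 2 * l * l' + 2 * k ^ 2 * l' ^ 2 - k ^ 2 * l * l'') * s ^ 2
          + 2 * k * (√2 * b' * l * l' - 3 * (√2 * b) * l' ^ 2 + √2 * b * l * l'') * s ^ 3
          - 2 * (√2 * b) ^ 2 * l' ^ 2 * s ^ 4) /
        (4 * k * l * s ^ 2 * (k + s * (√2 * b)) * (l + 2 * s ^ 2 * l')) := by
  have h2 : √2 ^ 2 = 2 := Real.sq_sqrt (by norm_num)
  rw [coeffP, sqrt_mul_sq (by norm_num) hk, Real.sqrt_sq hs]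
  congr 1
  · linear_combination (b ^ 2 * l ^ 2 / 2 + 2 * b ^ 2 * l * l' * s ^ 2 +
      2 * b ^ 2 * l' ^ 2 * s ^ 4) * h2
  · linear_combination 2 * k ^ 2 * l * s ^ 2 * (l + 2 * s ^ 2 * l') * h2

theorem coeffS_sq (hk : 0 ≤ k) (hs : 0 ≤ s) (b b' : ℝ) :
    coeffS (k ^ 2) (s ^ 2) l l' l'' b b' =
      -((l * ((√2 * b) ^ 2 * l + k ^ 2 * l') + k * l * (l * (√2 * b') + 4 * l' * (√2 * b)) * s
          + (l ^ 2 * (√2 * b) * (√2 * b') + 5 * l * l' * (√2 * b) ^ 2 - 4 * k ^ 2 * l' ^ 2 +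
            2 * k ^ 2 * l * l'') * s ^ 2
          + 2 * k * (l * l' * (√2 * b') - 2 * l' ^ 2 * (√2 * b) + 2 * l * l'' * (√2 * b)) * s ^ 3
          + 2 * l * (√2 * b) * (l' * (√2 * b') + l'' * (√2 * b)) * s ^ 4) /
        (2 * l * (l + 2 * s ^ 2 * l'))) := by
  have h2 : √2 ^ 2 = 2 := Real.sq_sqrt (by norm_num)
  rw [coeffS, sqrt_mul_sq (by norm_num) hk, Real.sqrt_sq hs]
  congr 2
  linear_combination (-(l ^ 2 * b ^ 2 + l ^ 2 * b * b' * s ^ 2 + 5 * l * l' * b ^ 2 * s ^ 2 +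
    2 * l * b * (l' * b' + l'' * b) * s ^ 4)) * h2

end Scalars

/-! ### Q, P, S in terms of the coefficients of G. -/

section Components

variable (g : Metric n M) (w : MetricCoeffs) {φ : OpenPartialHomeomorph M (E n)} {y p : E n}

/-- In the direction of p the inverse matrix has the reciprocal factor. -/
theorem invFst_add_invSnd {u v : ℝ → ℝ} {t : ℝ} (hu : 0 < u t) (hv : 0 < u t + 2 * t * v t) :
    invFst u t + 2 * t * invSnd u v t = 1 / (u t + 2 * t * v t) := by
  rw [invFst, invSnd]
  field_simp
  ring

theorem sum_mul_kron (x : Fin n → ℝ) (i : Fin n) : ∑ k, x k * kron i k = x i := by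
  simp [kron]

theorem kron_comm (i j : Fin n) : kron i j = kron j i := by
  simp [kron, eq_comm]

theorem sum_gLow_mul_gUp (hφ : IsChart φ) (hy : y ∈ φ.target) (i j : Fin n) :
    ∑ k, gLow g φ y i k * gUp g φ y j k = kron i j := by
  have h := congrFun (congrFun (gLow_mul_gUp g hφ hy) i) j
  rw [Matrix.mul_apply, Matrix.one_apply] at h
  rw [kron, ← h]
  exact Finset.sum_congr rfl fun k _ => by rw [gUp_symm g φ y j k]

theorem sum_natLow_mul_gUp (α β : ℝ → ℝ) (hφ : IsChart φ) (hy : y ∈ φ.target) (h j : Fin n) :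
    ∑ k, natLow g α β φ y p h k * gUp g φ y j k =
      α (energy g φ y p) * kron h j + β (energy g φ y p) * p h * pUp g φ y p j := by
  have h1 : ∀ k, natLow g α β φ y p h k * gUp g φ y j k =
      α (energy g φ y p) * (gLow g φ y h k * gUp g φ y j k) +
        β (energy g φ y p) * p h * (p k * gUp g φ y k j) := fun k => by
    rw [gUp_symm g φ y k j]
    simp only [natLow, Matrix.of_apply]
    ring
  simp only [h1, Finset.sum_add_distrib, ← Finset.mul_sum, sum_gLow_mul_gUp g hφ hy, pUp]

theorem sum_natUp_mul_p (α β : ℝ → ℝ) (h : Fin n) :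
    ∑ k, natUp g α β φ y p h k * p k =
      (α (energy g φ y p) + 2 * energy g φ y p * β (energy g φ y p)) * pUp g φ y p h := by
  have h1 : ∀ k, natUp g α β φ y p h k * p k =
      α (energy g φ y p) * (p k * gUp g φ y k h) +
        β (energy g φ y p) * pUp g φ y p h * (p k * pUp g φ y p k) := fun k => by
    rw [gUp_symm g φ y k h]
    simp only [natUp, Matrix.of_apply]
    ring
  simp only [h1, Finset.sum_add_distrib, ← Finset.mul_sum, sum_mul_pUp g φ y p]
  rw [← pUp]
  ring

theorem sum_natUp_mul_gLow (α β : ℝ → ℝ) (hφ : IsChart φ) (hy : y ∈ φ.target) (h j : Fin n) :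
    ∑ k, natUp g α β φ y p h k * gLow g φ y j k =
      α (energy g φ y p) * kron j h + β (energy g φ y p) * pUp g φ y p h * p j := by
  have h2 : ∑ k, gLow g φ y j k * pUp g φ y p k = p j :=
    congrFun (gLow_mulVec_pUp g hφ hy p) j
  have h1 : ∀ k, natUp g α β φ y p h k * gLow g φ y j k =
      α (energy g φ y p) * (gLow g φ y j k * gUp g φ y h k) +
        β (energy g φ y p) * pUp g φ y p h * (gLow g φ y j k * pUp g φ y p k) := fun k => by
    simp only [natUp, Matrix.of_apply]
    ring
  simp only [h1, Finset.sum_add_distrib, ← Finset.mul_sum, sum_gLow_mul_gUp g hφ hy, h2]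

/-- Among the derivatives of G₍₂₎, the d₂ terms with g^{ik} and g^{jk} cancel and those with g^{ij}
add up. `H2` is itself natural, so its contractions with g^{ik}, g^{jk} and g^{0k} are explicit. -/
theorem Q_eq_of_coeffs (hφ : IsChart φ) (hy : y ∈ φ.target) (hp : p ≠ 0) {t : ℝ}
    (ht : energy g φ y p = t) (i j h : Fin n) : Q g w φ y p i j h =
      (2 * w.d₂ t - deriv w.c₂ t) / (2 * (w.c₂ t + 2 * t * w.d₂ t)) * gUp g φ y i j * p h +
      deriv w.c₂ t / (2 * w.c₂ t) * (kron i h * pUp g φ y p j + kron j h * pUp g φ y p i) +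
      (2 * deriv w.c₂ t * (-w.d₂ t / (w.c₂ t * (w.c₂ t + 2 * t * w.d₂ t))) +
        deriv w.d₂ t / (w.c₂ t + 2 * t * w.d₂ t)) / 2 * pUp g φ y p i * pUp g φ y p j * p h := by
  have ht0 : 0 < t := ht ▸ energy_pos g hφ hy hp
  have h1 : ∀ k, natLow g (invFst w.c₂) (invSnd w.c₂ w.d₂) φ y p h k *
      (pd i (fun r => natUp g w.c₂ w.d₂ φ y r j k) p +
        pd j (fun r => natUp g w.c₂ w.d₂ φ y r i k) p -
        pd k (fun r => natUp g w.c₂ w.d₂ φ y r i j) p) =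
      deriv w.c₂ t * pUp g φ y p i * (natLow g (invFst w.c₂) (invSnd w.c₂ w.d₂) φ y p h k *
        gUp g φ y j k) +
      deriv w.c₂ t * pUp g φ y p j * (natLow g (invFst w.c₂) (invSnd w.c₂ w.d₂) φ y p h k *
        gUp g φ y i k) +
      ((2 * w.d₂ t - deriv w.c₂ t) * gUp g φ y i j +
        deriv w.d₂ t * pUp g φ y p i * pUp g φ y p j) *
          (natLow g (invFst w.c₂) (invSnd w.c₂ w.d₂) φ y p h k * pUp g φ y p k) := fun k => by
    rw [pd_natUp g hφ hy hp w.smooth_c₂ w.smooth_d₂, pd_natUp g hφ hy hp w.smooth_c₂ w.smooth_d₂,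
      pd_natUp g hφ hy hp w.smooth_c₂ w.smooth_d₂, gUp_symm g φ y j i, gUp_symm g φ y k i,
      gUp_symm g φ y k j, ht]
    ring
  simp only [Q, G2]
  rw [H2_eq g w hφ hy hp]
  simp only [h1, Finset.sum_add_distrib, ← Finset.mul_sum, sum_natLow_mul_gUp g _ _ hφ hy,
    natLow_mulVec_pUp g _ _ hφ hy, ht, invFst_add_invSnd (w.pos_c₂ t ht0) (w.pos_d₂ t ht0)]
  rw [kron_comm h i, kron_comm h j, invFst, invSnd]
  generalize w.c₂ t + 2 * t * w.d₂ t = e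
  ring

theorem P_eq_of_coeffs {c : ℝ} (hc : HasConstantSectionalCurvature g c) (hφ : IsChart φ)
    (hy : y ∈ φ.target) (hp : p ≠ 0) {t : ℝ} (ht : energy g φ y p = t) (h i j : Fin n) :
    P g w φ y p h i j =
      (w.d₁ t - c * w.c₂ t) / (2 * w.c₁ t) * gUp g φ y h i * p j +
      (w.d₁ t + c * w.c₂ t) / (2 * (w.c₁ t + 2 * t * w.d₁ t)) * kron i j * pUp g φ y p h +
      deriv w.c₁ t / (2 * w.c₁ t) * kron h j * pUp g φ y p i +
      ((deriv w.c₁ t + w.d₁ t - c * w.c₂ t) *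
        (-w.d₁ t / (w.c₁ t * (w.c₁ t + 2 * t * w.d₁ t))) +
        deriv w.d₁ t / (w.c₁ t + 2 * t * w.d₁ t)) / 2 * pUp g φ y p h * pUp g φ y p i * p j := by
  have ht0 : 0 < t := ht ▸ energy_pos g hφ hy hp
  -- The d₂ part drops out: in constant curvature R⁰_{ljk} g^{0l} = c(p_j p_k − p_k p_j) = 0.
  have h0 : ∀ k, ∑ l, natUp g w.c₂ w.d₂ φ y p i l * curvatureZero g φ l j k y p =
      c * w.c₂ t * (p j * kron i k - p k * kron i j) := fun k => by
    have h1 : ∀ l, natUp g w.c₂ w.d₂ φ y p i l * curvatureZero g φ l j k y p =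
        c * p j * (natUp g w.c₂ w.d₂ φ y p i l * gLow g φ y k l) -
        c * p k * (natUp g w.c₂ w.d₂ φ y p i l * gLow g φ y j l) := fun l => by
      rw [curvatureZero_of_constant g hc hφ hy, gLow_symm g φ y l k, gLow_symm g φ y l j]
      ring
    simp only [h1, Finset.sum_sub_distrib, ← Finset.mul_sum, sum_natUp_mul_gLow g _ _ hφ hy, ht]
    rw [kron_comm k i, kron_comm j i]
    ring
  have h1 : ∀ k, natUp g (invFst w.c₁) (invSnd w.c₁ w.d₁) φ y p h k *
      (pd i (fun r => natLow g w.c₁ w.d₁ φ y r j k) p -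
        c * w.c₂ t * (p j * kron i k - p k * kron i j)) =
      deriv w.c₁ t * pUp g φ y p i * (natUp g (invFst w.c₁) (invSnd w.c₁ w.d₁) φ y p h k *
        gLow g φ y j k) +
      (deriv w.d₁ t * pUp g φ y p i * p j + (w.d₁ t + c * w.c₂ t) * kron i j) *
        (natUp g (invFst w.c₁) (invSnd w.c₁ w.d₁) φ y p h k * p k) +
      (w.d₁ t - c * w.c₂ t) * p j *
        (natUp g (invFst w.c₁) (invSnd w.c₁ w.d₁) φ y p h k * kron i k) := fun k => by
    rw [pd_natLow g hφ hy hp w.smooth_c₁ w.smooth_d₁, kron_comm j i, kron_comm k i, ht]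
    ring
  simp only [P, G1, G2, h0]
  rw [H1_eq g w hφ hy hp]
  simp only [h1, Finset.sum_add_distrib, ← Finset.mul_sum, sum_natUp_mul_gLow g _ _ hφ hy,
    sum_natUp_mul_p, sum_mul_kron, ht, invFst_add_invSnd (w.pos_c₁ t ht0) (w.pos_d₁ t ht0)]
  rw [kron_comm j h, natUp, Matrix.of_apply, ht, invFst, invSnd]
  generalize w.c₁ t + 2 * t * w.d₁ t = e
  ring

theorem S_eq_of_coeffs {c : ℝ} (hc : HasConstantSectionalCurvature g c) (hφ : IsChart φ)
    (hy : y ∈ φ.target) (hp : p ≠ 0) {t : ℝ} (ht : energy g φ y p = t) (h i j : Fin n) :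
    S g w φ y p h i j =
      -(deriv w.c₁ t / (2 * (w.c₂ t + 2 * t * w.d₂ t))) * gLow g φ y i j * p h +
      (c / 2 - w.d₁ t / (2 * w.c₂ t)) * gLow g φ y h j * p i +
      (-(c / 2) - w.d₁ t / (2 * w.c₂ t)) * gLow g φ y h i * p j +
      -(deriv w.d₁ t / (w.c₂ t + 2 * t * w.d₂ t) +
        2 * w.d₁ t * (-w.d₂ t / (w.c₂ t * (w.c₂ t + 2 * t * w.d₂ t)))) / 2 *
          p h * p i * p j := by
  have ht0 : 0 < t := ht ▸ energy_pos g hφ hy hp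
  have h1 : ∀ k, natLow g (invFst w.c₂) (invSnd w.c₂ w.d₂) φ y p h k *
      pd k (fun r => natLow g w.c₁ w.d₁ φ y r i j) p =
      (deriv w.c₁ t * gLow g φ y i j + deriv w.d₁ t * p i * p j) *
        (natLow g (invFst w.c₂) (invSnd w.c₂ w.d₂) φ y p h k * pUp g φ y p k) +
      w.d₁ t * p j * (natLow g (invFst w.c₂) (invSnd w.c₂ w.d₂) φ y p h k * kron i k) +
      w.d₁ t * p i * (natLow g (invFst w.c₂) (invSnd w.c₂ w.d₂) φ y p h k * kron j k) :=
    fun k => by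
      rw [pd_natLow g hφ hy hp w.smooth_c₁ w.smooth_d₁, ht]
      ring
  simp only [S, G1]
  rw [H2_eq g w hφ hy hp, curvatureZero_of_constant g hc hφ hy]
  simp only [h1, Finset.sum_add_distrib, ← Finset.mul_sum, natLow_mulVec_pUp g _ _ hφ hy,
    sum_mul_kron, ht, invFst_add_invSnd (w.pos_c₂ t ht0) (w.pos_d₂ t ht0)]
  simp only [natLow, Matrix.of_apply]
  rw [ht, invFst, invSnd]
  generalize w.c₂ t + 2 * t * w.d₂ t = e
  ring

end Components

/-! ### Elimination of all coefficients in favour of λ and b₁. -/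

section Explicit

/-- Lets the relations between coefficients, known only for t > 0, be differentiated. -/
theorem hasDerivAt_unique_of_eqOn_Ioi {F G : ℝ → ℝ} {F' G' t : ℝ} (hF : HasDerivAt F F' t)
    (hG : HasDerivAt G G' t) (ht : 0 < t) (h : ∀ t > 0, F t = G t) : F' = G' :=
  hF.unique (hG.congr_of_eventuallyEq ((lt_mem_nhds ht).mono fun s hs => h s hs))

theorem hasDerivAt_of_contDiffOn_Ioi {F : ℝ → ℝ} (hF : ContDiffOn ℝ ∞ F (Set.Ioi 0)) {t : ℝ}
    (ht : 0 < t) : HasDerivAt F (deriv F t) t :=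
  ((hF.contDiffAt (Ioi_mem_nhds ht)).differentiableAt (by simp)).hasDerivAt

theorem contDiffOn_deriv_Ioi {F : ℝ → ℝ} (hF : ContDiffOn ℝ ∞ F (Set.Ioi 0)) :
    ContDiffOn ℝ ∞ (deriv F) (Set.Ioi 0) :=
  hF.deriv_of_isOpen isOpen_Ioi (by simp)

theorem ComplexCoeffs.hasDerivAt_a₁ (a : ComplexCoeffs) {t : ℝ} (ht : 0 < t) :
    HasDerivAt a.a₁ (a.A * (1 / (2 * √t))) t :=
  (Real.hasDerivAt_sqrt ht.ne').const_mul a.A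

theorem hasDerivAt_add_two_mul {f h : ℝ → ℝ} {f' h' t : ℝ} (hf : HasDerivAt f f' t)
    (hh : HasDerivAt h h' t) :
    HasDerivAt (fun t => f t + 2 * t * h t) (f' + (2 * h t + 2 * t * h')) t := by
  have h := hf.add (((hasDerivAt_id t).const_mul 2).mul hh)
  rw [mul_one] at h
  exact h

variable (g : Metric n M) (w : MetricCoeffs) (a : ComplexCoeffs)
  {φ : OpenPartialHomeomorph M (E n)} {y p : E n}

/-- The coefficients of a Kähler structure over a space form satisfy `KaehlerRelations`. -/
theorem kaehlerRelations (hn : 2 ≤ n) {c : ℝ} (hc0 : 0 < c)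
    (hc : HasConstantSectionalCurvature g c) (hK : IsKahler (metricG g w) (tensorJ g a))
    {lam : ℝ → ℝ} (hlam : ∀ t > 0, w.c₁ t = lam t * a.a₁ t) (hφ : IsChart φ)
    (hy : y ∈ φ.target) (hp : p ≠ 0) {t : ℝ} (ht : 0 < t) :
    KaehlerRelations (√2) (√c) (√t) (lam t) (deriv lam t) (deriv (deriv lam) t)
      (√2 * a.b₁ t) (√2 * deriv a.b₁ t) (w.c₁ t) (deriv w.c₁ t) (w.d₁ t) (deriv w.d₁ t)
      (w.c₂ t) (deriv w.c₂ t) (w.d₂ t) (deriv w.d₂ t) := by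
  have h2 : √2 ^ 2 = 2 := Real.sq_sqrt (by norm_num)
  have hq : 0 < √2 := by positivity
  have hk : 0 < √c := Real.sqrt_pos.2 hc0
  have ha : ∀ t > 0, 0 < a.a₁ t := fun t ht => mul_pos a.pos_A (Real.sqrt_pos.2 ht)
  -- For a₁ = A√t the terms in b₁ cancel in the Nijenhuis relation, which reads A²/2 = c; one value,
  -- t = 1, suffices.
  have hA : a.A = √2 * √c := by
    obtain ⟨u, h0, hu, hut⟩ := exists_energy_eq g hφ hy hp one_pos
    have h1 := nijenhuis_relation g w a hn hc hK hφ hu h0 hut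
    rw [(a.hasDerivAt_a₁ one_pos).deriv, ComplexCoeffs.a₁] at h1
    simp only [Real.sqrt_one] at h1
    rw [← Real.sqrt_mul (by norm_num), show 2 * c = a.A ^ 2 by linarith,
      Real.sqrt_sq a.pos_A.le]
  have hherm : ∀ t > 0, w.c₁ t = prodFst a.a₁ w.c₂ t * a.a₁ t ∧
      w.d₁ t = prodFst a.a₁ w.c₂ t * a.b₁ t + prodSnd a.a₁ a.b₁ w.c₂ w.d₂ t * a.a₁ t +
        2 * t * prodSnd a.a₁ a.b₁ w.c₂ w.d₂ t * a.b₁ t := fun t ht => by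
    obtain ⟨u, h0, hu, hut⟩ := exists_energy_eq g hφ hy hp ht
    exact hermitian_relations g w a hn hK hφ hu h0 hut
  -- From c₁ = c₂a₁² and c₁ = λa₁. This also yields the smoothness and the positivity of λ.
  have hl : ∀ t > 0, lam t = w.c₂ t * a.a₁ t := fun t ht => by
    have h := (hherm t ht).1
    rw [hlam t ht] at h
    rw [mul_right_cancel₀ (ha t ht).ne' h, prodFst, mul_comm]
  have hlC : ContDiffOn ℝ ∞ lam (Set.Ioi 0) :=
    (w.smooth_c₂.mul a.contDiffOn_a₁).congr fun t ht => hl t ht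
  -- Closedness, with λ as the coefficient of the identity in J⁽¹⁾G₍₂₎.
  have hl' : ∀ t > 0, deriv lam t = prodSnd a.a₁ a.b₁ w.c₂ w.d₂ t := fun t ht => by
    obtain ⟨u, h0, hu, hut⟩ := exists_energy_eq g hφ hy hp ht
    rw [← closed_relation g w a hn hK hφ hu h0 hut]
    exact hasDerivAt_unique_of_eqOn_Ioi (hasDerivAt_of_contDiffOn_Ioi hlC ht)
      (hasDerivAt_of_contDiffOn_Ioi (contDiffOn_prodFst a.contDiffOn_a₁ w.smooth_c₂) ht) ht
      fun t ht => by rw [hl t ht, prodFst, mul_comm]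
  have hb : ∀ t > 0, a.a₁ t + 2 * t * a.b₁ t = √2 * (√t * (√c + √t * (√2 * a.b₁ t))) :=
    fun t ht => by
      have hs : √t ^ 2 = t := Real.sq_sqrt ht.le
      rw [ComplexCoeffs.a₁, hA]
      linear_combination (-(2 * a.b₁ t)) * hs - √t ^ 2 * a.b₁ t * h2
  have hB : ∀ t > 0, 0 < √c + √t * (√2 * a.b₁ t) := fun t ht => by
    have h := a.pos_b₁ t ht
    rw [hA] at h
    refine pos_of_mul_pos_right (a := √2) ?_ hq.le
    linear_combination h - √t * a.b₁ t * h2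
  -- The factors in the direction of p multiply. That of J⁽¹⁾G₍₂₎ is λ + 2tλ', which gives this
  -- identity for G⁽¹⁾ and the next one for G₍₂₎.
  have hd₁ : ∀ t > 0, w.c₁ t + 2 * t * w.d₁ t =
      (lam t + 2 * t * deriv lam t) * (a.a₁ t + 2 * t * a.b₁ t) := fun t ht => by
    rw [(hherm t ht).2, hl' t ht, hlam t ht, hl t ht, prodFst]
    ring
  have hd₂ : ∀ t > 0, (w.c₂ t + 2 * t * w.d₂ t) * (a.a₁ t + 2 * t * a.b₁ t) =
      lam t + 2 * t * deriv lam t := fun t ht => by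
    rw [hl' t ht, hl t ht, prodSnd]
    ring
  have hs : √t ^ 2 = t := Real.sq_sqrt ht.le
  have hs0 : 0 < √t := Real.sqrt_pos.2 ht
  have ha₁ : a.a₁ t = √2 * (√c * √t) := by rw [ComplexCoeffs.a₁, hA, mul_assoc]
  have ha₁' := a.hasDerivAt_a₁ ht
  have hlD := hasDerivAt_of_contDiffOn_Ioi hlC ht
  have hlD' := hasDerivAt_of_contDiffOn_Ioi (contDiffOn_deriv_Ioi hlC) ht
  have hc₁D := hasDerivAt_of_contDiffOn_Ioi w.smooth_c₁ ht
  have hc₂D := hasDerivAt_of_contDiffOn_Ioi w.smooth_c₂ ht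
  have hd₁D := hasDerivAt_of_contDiffOn_Ioi w.smooth_d₁ ht
  have hd₂D := hasDerivAt_of_contDiffOn_Ioi w.smooth_d₂ ht
  have hbD := hasDerivAt_add_two_mul ha₁' (hasDerivAt_of_contDiffOn_Ioi a.smooth_b₁ ht)
  have hb' : a.A * (1 / (2 * √t)) + (2 * a.b₁ t + 2 * t * deriv a.b₁ t) =
      √2 * (√c / (2 * √t) + √2 * a.b₁ t + √t ^ 2 * (√2 * deriv a.b₁ t)) := by
    rw [hA, hs]
    linear_combination (-(a.b₁ t + t * deriv a.b₁ t)) * h2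
  -- The four relations are differentiated; λ'' comes from the factor λ + 2tλ' and b₁' from a₁ +
  -- 2tb₁.
  have e1 := hasDerivAt_unique_of_eqOn_Ioi hc₁D (hlD.mul ha₁') ht hlam
  have e2 := hasDerivAt_unique_of_eqOn_Ioi (hasDerivAt_add_two_mul hc₁D hd₁D)
    ((hasDerivAt_add_two_mul hlD hlD').mul hbD) ht hd₁
  have e3 := hasDerivAt_unique_of_eqOn_Ioi hlD (hc₂D.mul ha₁') ht hl
  have e4 := hasDerivAt_unique_of_eqOn_Ioi ((hasDerivAt_add_two_mul hc₂D hd₂D).mul hbD)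
    (hasDerivAt_add_two_mul hlD hlD') ht hd₂
  rw [hb', hb t ht] at e2 e4
  rw [ha₁, hA] at e1 e3
  have f1 := hd₁ t ht
  have f2 := hd₂ t ht
  rw [hb t ht] at f1 f2
  have hl0 : 0 < lam t := by
    rw [hl t ht]
    exact mul_pos (w.pos_c₂ t ht) (ha t ht)
  refine ⟨h2, hq, hk, hs0, hl0, ?_, hB t ht, ?_, ?_, ?_, ?_, ?_, ?_, ?_, ?_⟩ <;>
    try rw [hs]
  · rw [← f2]
    exact mul_pos (w.pos_d₂ t ht) (mul_pos hq (mul_pos hs0 (hB t ht)))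
  · rw [hlam t ht, ha₁]
    ring
  · rw [e1]
    field_simp
  · rw [f1]
    ring
  · rw [hs] at e2
    linear_combination e2
  · rw [hl t ht, ha₁]
  · rw [e3]
    field_simp
  · exact f2
  · rw [hs] at e4
    linear_combination e4

theorem explicit_components (hn : 2 ≤ n) {c : ℝ} (hc0 : 0 < c)
    (hc : HasConstantSectionalCurvature g c) (hK : IsKahler (metricG g w) (tensorJ g a))
    {lam : ℝ → ℝ} (hlam : ∀ t > 0, w.c₁ t = lam t * a.a₁ t) (hφ : IsChart φ)
    (hy : y ∈ φ.target) (hp : p ≠ 0) (i j h : Fin n) :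
    Q g w φ y p i j h = explicitQ g c lam a.b₁ φ y p i j h ∧
    P g w φ y p h i j = explicitP g c lam a.b₁ φ y p h i j ∧
    S g w φ y p h i j = explicitS g c lam a.b₁ φ y p h i j := by
  -- The energy becomes a variable, so that it can be replaced by a square.
  obtain ⟨t, ht⟩ : ∃ t, energy g φ y p = t := ⟨_, rfl⟩
  have ht0 : 0 < t := ht ▸ energy_pos g hφ hy hp
  have r := kaehlerRelations g w a hn hc0 hc hK hlam hφ hy hp ht0
  obtain ⟨k, hk, rfl⟩ : ∃ k, 0 < k ∧ c = k ^ 2 :=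
    ⟨√c, Real.sqrt_pos.2 hc0, (Real.sq_sqrt hc0.le).symm⟩
  obtain ⟨s, hs, rfl⟩ : ∃ s, 0 < s ∧ t = s ^ 2 :=
    ⟨√t, Real.sqrt_pos.2 ht0, (Real.sq_sqrt ht0.le).symm⟩
  rw [Real.sqrt_sq hk.le, Real.sqrt_sq hs.le] at r
  obtain ⟨q1, q2, q3⟩ := r.coeffs_Q
  obtain ⟨p1, p2, p3, p4⟩ := r.coeffs_P
  obtain ⟨s1, s2, s3, s4⟩ := r.coeffs_S
  refine ⟨?_, ?_, ?_⟩
  · rw [Q_eq_of_coeffs g w hφ hy hp ht, q1, q2, q3]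
    simp only [explicitQ]
    rw [ht, coeffQ_sq hk.le hs.le, sqrt_mul_sq (by norm_num) hs.le, Real.sqrt_sq hk.le]
    ring
  · rw [P_eq_of_coeffs g w hc hφ hy hp ht, p1, p2, p3, p4]
    simp only [explicitP]
    rw [ht, coeffP_sq hk.le hs.le, Real.sqrt_sq hk.le, Real.sqrt_sq hs.le]
    ring
  · rw [S_eq_of_coeffs g w hc hφ hy hp ht, s1, s2, s3, s4]
    simp only [explicitS]
    rw [ht, coeffS_sq hk.le hs.le, sqrt_mul_sq (by norm_num) hs.le, Real.sqrt_sq hk.le,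
      Real.sqrt_sq hs.le]
    ring

end Explicit

end CotangentLift

end

open CotangentLift
theorem theorem8 (n : ℕ) (M : Type*) [TopologicalSpace M] [ChartedSpace (E n) M]
    [IsManifold 𝓘(ℝ, E n) ∞ M] (g : Metric n M) (w : MetricCoeffs) :
    -- `Q`, `P`, `S` are `M`-tensor fields
    IsMTensor (M := M) 2 1 (fun φ y p a b => Q g w φ y p (a 0) (a 1) (b 0)) ∧
    IsMTensor (M := M) 2 1 (fun φ y p a b => P g w φ y p (a 0) (a 1) (b 0)) ∧
    IsMTensor (M := M) 0 3 (fun φ y p _ b => S g w φ y p (b 0) (b 1) (b 2)) ∧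
    -- the Levi-Civita connection of `G` in the adapted frame
    (∀ nabla : VField n M →
        ((u : TStar n M) → TangentSpace (IStar n) u →L[ℝ] TangentSpace (IStar n) u),
      IsLeviCivita (metricG g w) nabla →
      ∀ φ : OpenPartialHomeomorph M (E n), IsChart φ →
      ∀ u ∈ TStarZero n M, u.1 ∈ φ.source →
      ∀ y p : E n, indChart φ u = (y, p) → ∀ i j : Fin n,
        nabla (dP φ j) u (dP φ i u) =
          ∑ h, Q g w φ y p i j h • dP φ h u ∧
        nabla (dP φ j) u (delta g φ i u) =
          -∑ h, christoffel g φ j i h y • dP φ h u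
            + ∑ h, P g w φ y p h j i • delta g φ h u ∧
        nabla (delta g φ j) u (dP φ i u) =
          ∑ h, P g w φ y p h i j • delta g φ h u ∧
        nabla (delta g φ j) u (delta g φ i u) =
          ∑ h, christoffel g φ h i j y • delta g φ h u
            + ∑ h, S g w φ y p h i j • dP φ h u) ∧
    -- the explicit components over a space form, when `(G, J)` is Kähler
    (2 ≤ n → ∀ c : ℝ, 0 < c → HasConstantSectionalCurvature g c →
      ∀ a : ComplexCoeffs, IsKahler (metricG g w) (tensorJ g a) →
      ∀ lam : ℝ → ℝ, (∀ t > 0, w.c₁ t = lam t * a.a₁ t) →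
      ∀ φ : OpenPartialHomeomorph M (E n), IsChart φ →
      ∀ y ∈ φ.target, ∀ p : E n, p ≠ 0 → ∀ i j h : Fin n,
        Q g w φ y p i j h = explicitQ g c lam a.b₁ φ y p i j h ∧
        P g w φ y p h i j = explicitP g c lam a.b₁ φ y p h i j ∧
        S g w φ y p h i j = explicitS g c lam a.b₁ φ y p h i j) := by
  refine ⟨isMTensor_Q g w, isMTensor_P g w, isMTensor_S g w, ?_, ?_⟩
  · rintro nabla hn φ hφ u h0 hu y p hyp i j
    obtain ⟨rfl, rfl⟩ := Prod.mk.inj hyp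
    exact ⟨nabla_dP_dP g w hn hφ hu h0 i j, nabla_delta_dP g w hn hφ hu h0 i j,
      nabla_dP_delta g w hn hφ hu h0 i j, nabla_delta_delta g w hn hφ hu h0 i j⟩
  · intro hn c hc0 hc a hK lam hlam φ hφ y hy p hp i j h
    exact explicit_components g w a hn hc0 hc hK hlam hφ hy hp i j h
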